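/- Let $k$ be a field of characteristic $0$; everything is homologically $\mathbb Z$-graded over $k$ and the Koszul sign rule is used. Let $\kappa:\mathrm{As}^{¡}\to\mathrm{As}$ be the canonical (Koszul) twisting morphism of symmetric (co)operads. **Objects and $\infty_\kappa$-morphisms.** An $\mathrm{As}$-algebra is a non-unital dg associative algebra $A$. A conilpotent $\mathrm{As}^{¡}$-coalgebra is a chain complex $D$ with a conilpotent decomposition map $\Delta:D\to D\otimes D$ of degree $-1$ such that $d+\Delta$ extends to a square-zero derivation of the tensor algebra $T(D)$; with this differential the tensor algebra is the cobar construction $\Omega_\kappa D$. An $\infty_\kappa$-morphism $\Phi:D'\rightsquigarrow D$ of coalgebras is a morphism of augmented dg algebras $\Omega_\kappa D'\to\Omega_\kappa D$; an $\infty_\kappa$-morphism $\Psi:A\rightsquigarrow A'$ of algebras is a morphism of coaugmented dg coalgebras $B_\kappa A\to B_\kappa A'$ between bar constructions (tensor coalgebras of $sA$, $sA'$). **Convolution algebras.** $\hom^\kappa(D,A)$ is the graded space of (finite sums of) homogeneous linear maps $D\to A$, with the shifted homotopy Lie algebra structure given by $\ell_1(f)=d_Af-(-1)^{|f|}fd_D$,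 by $\ell_2(f,g)=-(-1)^{|f|+|g|}\,\mu_A\,(f\otimes g+(-1)^{|f||g|}g\otimes f)\,\Delta$, and $\ell_n=0$ for $n\ge3$. For $f_1,\dots,f_n\in\hom^\kappa(D,A)$ put $F=\sum_{\sigma\in S_n}\pm f_{\sigma(1)}\otimes\cdots\otimes f_{\sigma(n)}$, with Koszul signs. For $\Phi:D'\rightsquigarrow D$ and a strict morphism $\psi:A\to A'$, the $\infty$-morphism $\hom^\kappa_\ell(\Phi,\psi):\hom^\kappa(D,A)\rightsquigarrow\hom^\kappa(D',A')$ has components $$(f_1,\dots,f_n)\longmapsto\Bigl(D'\xrightarrow{\Phi}T(D)\xrightarrow{\mathrm{proj}_n}D^{\otimes n}\xrightarrow{F}A^{\otimes n}\xrightarrow{\text{product}}A\xrightarrow{\psi}A'\Bigr).$$ For a strict morphism $\phi:D'\to D$ and $\Psi:A\rightsquigarrow A'$, the $\infty$-morphism $\hom^\kappa_r(\phi,\Psi)$ has components $$(f_1,\dots,f_n)\longmapsto\Bigl(D'\xrightarrow{\phi}D\xrightarrow{\Delta^{n}}\mathrm{As}^{¡}(n)\otimes_{S_n}D^{\otimes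 n}\xrightarrow{F}\mathrm{As}^{¡}(n)\otimes_{S_n}A^{\otimes n}\xrightarrow{\Psi_n}A'\Bigr),$$ where $\mathrm{As}^{¡}(n)\otimes_{S_n}D^{\otimes n}$ is identified with the desuspension of $(sD)^{\otimes n}$, $\Delta^n$ being the iterated coproduct of $sD$. Families of multilinear maps between graded spaces are composed as morphisms of cofree conilpotent graded cocommutative coalgebras. **Theorem.** For $\kappa:\mathrm{As}^{¡}\to\mathrm{As}$ the two actions cannot be combined. (a) Let $V=\bigoplus_{i\ge1}k\,v_i$, $|v_i|=i$, $d=0$, $\Delta v_n=\sum_{i+j=n-1,\ i,j\ge1}(-1)^iv_i\otimes v_j$, and let $\Phi:V\rightsquigarrow V$ be given by $\Phi(v_n)=\sum_{m\ge1}\sum_{i_1+\cdots+i_m=n,\ i_j\ge1}v_{i_1}\otimes\cdots\otimes v_{i_m}$. Let $A^2=k[x,y]^+$ be the augmentation ideal of the free graded commutative algebra on $|x|=0$, $|y|=1$, with $dy=x^2$, $dx=0$; let $H^2=k\,z$, $|z|=0$, $z^2=0$, $d=0$; and let $i_\infty:H^2\rightsquigarrow A^2$ have the components $i_1(z)=x$,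 $i_2(z,z)=y$, $i_n=0$ for $n\ge3$. Then $V$, $A^2$, $H^2$ are objects as above, $\Phi$ and $i_\infty$ are $\infty_\kappa$-morphisms, $i_\infty$ is a quasi-isomorphism, and $$\hom^\kappa_\ell(\Phi,1_{A^2})\circ\hom^\kappa_r(1_V,i_\infty)\;\neq\;\hom^\kappa_r(1_V,i_\infty)\circ\hom^\kappa_\ell(\Phi,1_{H^2})$$ as families from $\hom^\kappa(V,H^2)$ to $\hom^\kappa(V,A^2)$. (b) Consequently there is no bifunctor $$\hom^\kappa:(\text{conil. }\infty_\kappa\text{-}\mathrm{As}^{¡}\text{-cog})^{op}\times\infty_\kappa\text{-}\mathrm{As}\text{-alg}\longrightarrow\infty\text{-}\mathscr{S}\mathrm{Lie}_\infty\text{-alg}$$ that restricts to $\hom^\kappa_\ell$ on pairs ($\infty_\kappa$-morphism, strict morphism) and to $\hom^\kappa_r$ on pairs (strict morphism, $\infty_\kappa$-morphism). In particular, for a general twisting morphism $\alpha:\mathscr C\to\mathscr P$ the convolution bifunctor cannot be extended to $\infty_\alpha$-morphisms in both slots at once. -/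

import Mathlib

universe u
open scoped TensorProduct DirectSum

namespace HomConv

section Graded

variable {k : Type u} [Field k] {V : Type u} [AddCommGroup V] [Module k V]

/-- The projection of a `ℤ`-graded vector space onto its part of even (`b = 0`) or odd (`b = 1`)
degree. -/
noncomputable def parityProj {gr : ℤ → Submodule k V} (h : DirectSum.IsInternal gr)
    (b : ZMod 2) : V →ₗ[k] V :=
  letI := h.chooseDecomposition
  DirectSum.toModule k ℤ V (fun i => if (i : ZMod 2) = b then (gr i).subtype else 0) ∘ₗ
    (DirectSum.decomposeLinearEquiv gr).toLinearMap

/-- The sign operator `v ↦ (-1)^|v| v`. -/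
noncomputable def parity {gr : ℤ → Submodule k V} (h : DirectSum.IsInternal gr) : V →ₗ[k] V :=
  parityProj h 0 - parityProj h 1

theorem parityProj_of_mem {gr : ℤ → Submodule k V} (h : DirectSum.IsInternal gr) (b : ZMod 2)
    {i : ℤ} {v : V} (hv : v ∈ gr i) : parityProj h b v = if (i : ZMod 2) = b then v else 0 := by
  let _ := h.chooseDecomposition
  have h2 : DirectSum.decomposeLinearEquiv gr v = DirectSum.lof k ℤ (fun i => gr i) i ⟨v, hv⟩ := by
    rw [DirectSum.decomposeLinearEquiv_apply, DirectSum.decompose_of_mem gr hv]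
    rfl
  simp only [parityProj, LinearMap.comp_apply, LinearEquiv.coe_coe]
  erw [h2]
  rw [DirectSum.toModule_lof]
  split_ifs <;> simp

/-- The Koszul sign `(-1)^(ab)`. -/
def koszul (a b : ZMod 2) : ℤ := if a * b = 1 then -1 else 1

theorem parity_of_mem {gr : ℤ → Submodule k V} (h : DirectSum.IsInternal gr)
    {i : ℤ} {v : V} (hv : v ∈ gr i) : parity h v = koszul i 1 • v := by
  simp only [parity, LinearMap.sub_apply, parityProj_of_mem h _ hv, koszul]
  generalize (i : ZMod 2) = a
  have h01 : (0 : ZMod 2) ≠ 1 := by decide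
  have : a = 0 ∨ a = 1 := by revert a; decide
  rcases this with rfl | rfl <;> simp

/-- `e ^ q` for an involution `e`, where `q` is only known modulo two. -/
def powTwo (e : V →ₗ[k] V) (q : ZMod 2) : V →ₗ[k] V := if q = 0 then LinearMap.id else e

/-- Total degree `n` part of the tensor algebra of a graded vector space. -/
def tensorDeg (gr : ℤ → Submodule k V) (n : ℤ) : Submodule k (TensorAlgebra k V) :=
  Submodule.span k {t | ∃ (m : ℕ) (q : Fin m → ℤ) (x : Fin m → V),
    (∀ i, x i ∈ gr (q i)) ∧ ∑ i, q i = n ∧ t = TensorAlgebra.tprod k V m x}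

theorem tensor_induction {P : TensorAlgebra k V → Prop} (h1 : P 1)
    (hι : ∀ v t, P t → P (TensorAlgebra.ι k v * t)) (hadd : ∀ s t, P s → P t → P (s + t))
    (hsmul : ∀ (c : k) t, P t → P (c • t)) (t : TensorAlgebra k V) : P t := by
  suffices H : ∀ t : TensorAlgebra k V, ∀ s, P s → P (t * s) by simpa using H t 1 h1
  intro t
  induction t using TensorAlgebra.induction with
  | algebraMap r => intro s hs; rw [← Algebra.smul_def]; exact hsmul _ _ hs
  | ι x => intro s hs; exact hι _ _ hs
  | mul a b ha hb => intro s hs; rw [mul_assoc]; exact ha _ (hb _ hs)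
  | add a b ha hb => intro s hs; rw [add_mul]; exact hadd _ _ (ha _ hs) (hb _ hs)

/-- One step of the recursion defining `tensorDer`, on pairs `(t, D t)`. -/
noncomputable def tensorDerStep (e : V →ₗ[k] V) (θ : V →ₗ[k] TensorAlgebra k V) :
    V →ₗ[k] Module.End k (TensorAlgebra k V × TensorAlgebra k V) :=
  LinearMap.mk₂ k (fun (v : V) (p : TensorAlgebra k V × TensorAlgebra k V) =>
      (TensorAlgebra.ι k v * p.1, θ v * p.1 + TensorAlgebra.ι k (e v) * p.2))
    (by intros; ext <;> simp [add_mul]; abel)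
    (by intros; ext <;> simp)
    (by intros; ext <;> simp [mul_add]; abel)
    (by intros; ext <;> simp)

theorem tensorDerStep_apply (e : V →ₗ[k] V) (θ : V →ₗ[k] TensorAlgebra k V) (v : V)
    (p : TensorAlgebra k V × TensorAlgebra k V) :
    tensorDerStep e θ v p =
      (TensorAlgebra.ι k v * p.1, θ v * p.1 + TensorAlgebra.ι k (e v) * p.2) := rfl

/-- The linear map `D` on the tensor algebra determined by `D 1 = 0` and
`D (v t) = θ v * t + e v * D t`. For `e = (-1)^|v|` it is the derivation of odd degree extending
`θ`. -/
noncomputable def tensorDer (e : V →ₗ[k] V) (θ : V →ₗ[k] TensorAlgebra k V) :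
    TensorAlgebra k V →ₗ[k] TensorAlgebra k V :=
  LinearMap.snd k _ _ ∘ₗ
    LinearMap.applyₗ ((1, 0) : TensorAlgebra k V × TensorAlgebra k V) ∘ₗ
    (TensorAlgebra.lift k (tensorDerStep e θ)).toLinearMap

theorem tensorDer_one (e : V →ₗ[k] V) (θ : V →ₗ[k] TensorAlgebra k V) :
    tensorDer e θ 1 = 0 := by
  simp [tensorDer]

theorem tensorDer_ι_mul (e : V →ₗ[k] V) (θ : V →ₗ[k] TensorAlgebra k V) (v : V)
    (t : TensorAlgebra k V) :
    tensorDer e θ (TensorAlgebra.ι k v * t) =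
      θ v * t + TensorAlgebra.ι k (e v) * tensorDer e θ t := by
  have h : ∀ t, (TensorAlgebra.lift k (tensorDerStep e θ) t (1, 0)).1 = t := by
    intro t
    induction t using tensor_induction with
    | h1 => simp
    | hι v t ih => simp [ih, tensorDerStep_apply]
    | hadd s t hs ht => simp [hs, ht]
    | hsmul c t ht => simp [ht]
  simp [tensorDer, tensorDerStep_apply, h]

variable (k V) in
/-- One step of the recursion defining `deconc`, on pairs `(t, Δ t)`. -/
noncomputable def deconcStep :
    V →ₗ[k] Module.End k (TensorAlgebra k V × (TensorAlgebra k V ⊗[k] TensorAlgebra k V)) :=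
  LinearMap.mk₂ k
    (fun (v : V) (p : TensorAlgebra k V × (TensorAlgebra k V ⊗[k] TensorAlgebra k V)) =>
      (TensorAlgebra.ι k v * p.1,
        1 ⊗ₜ[k] (TensorAlgebra.ι k v * p.1) + (TensorAlgebra.ι k v ⊗ₜ[k] 1) * p.2))
    (by intros; ext <;> simp [add_mul, TensorProduct.tmul_add, TensorProduct.add_tmul]; abel)
    (by intros; ext <;> simp [← TensorProduct.smul_tmul'])
    (by intros; ext <;> simp [mul_add, TensorProduct.tmul_add]; abel)
    (by intros; ext <;> simp)

theorem deconcStep_apply (v : V)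
    (p : TensorAlgebra k V × (TensorAlgebra k V ⊗[k] TensorAlgebra k V)) :
    deconcStep k V v p = (TensorAlgebra.ι k v * p.1,
        1 ⊗ₜ[k] (TensorAlgebra.ι k v * p.1) + (TensorAlgebra.ι k v ⊗ₜ[k] 1) * p.2) := rfl

variable (k V) in
/-- Deconcatenation, determined by `Δ 1 = 1 ⊗ 1` and `Δ (v t) = 1 ⊗ v t + (v ⊗ 1) Δ t`; it makes
`TensorAlgebra k V` into the tensor coalgebra of `V`. -/
noncomputable def deconc :
    TensorAlgebra k V →ₗ[k] TensorAlgebra k V ⊗[k] TensorAlgebra k V :=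
  LinearMap.snd k _ _ ∘ₗ
    LinearMap.applyₗ
      ((1, 1 ⊗ₜ[k] 1) : TensorAlgebra k V × (TensorAlgebra k V ⊗[k] TensorAlgebra k V)) ∘ₗ
    (TensorAlgebra.lift k (deconcStep k V)).toLinearMap

theorem deconc_one : deconc k V 1 = 1 ⊗ₜ[k] 1 := by
  simp [deconc]

theorem deconc_ι_mul (v : V) (t : TensorAlgebra k V) :
    deconc k V (TensorAlgebra.ι k v * t) =
      1 ⊗ₜ[k] (TensorAlgebra.ι k v * t) + (TensorAlgebra.ι k v ⊗ₜ[k] 1) * deconc k V t := by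
  have h : ∀ t, (TensorAlgebra.lift k (deconcStep k V) t (1, 1 ⊗ₜ[k] 1)).1 = t := by
    intro t
    induction t using tensor_induction with
    | h1 => simp
    | hι v t ih => simp [ih, deconcStep_apply]
    | hadd s t hs ht => simp [hs, ht]
    | hsmul c t ht => simp [ht]
  simp [deconc, deconcStep_apply, h]

end Graded

section Objects

/-- A (non-unital) differential graded associative algebra, with homological grading. -/
structure DGAlg (k : Type u) [Field k] where
  carrier : Type u
  [ring : NonUnitalRing carrier]
  [module : Module k carrier]
  [tower : IsScalarTower k carrier carrier]
  [comm : SMulCommClass k carrier carrier]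
  gr : ℤ → Submodule k carrier
  internal : DirectSum.IsInternal gr
  mul_mem : ∀ {i j : ℤ} {a b : carrier}, a ∈ gr i → b ∈ gr j → a * b ∈ gr (i + j)
  d : carrier →ₗ[k] carrier
  d_mem : ∀ {i : ℤ} {a : carrier}, a ∈ gr i → d a ∈ gr (i - 1)
  d_d : ∀ a, d (d a) = 0
  leibniz : ∀ a b, d (a * b) = d a * b + parity internal a * d b

attribute [instance] DGAlg.ring DGAlg.module DGAlg.tower DGAlg.comm

/-- A conilpotent differential graded `As^¡`-coalgebra, i.e. a shifted coassociative coalgebra: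
a chain complex `(D, d)` with a decomposition map `Δ : D → D ⊗ D` of degree `-1` such that `d + Δ`
extends to a square-zero derivation of the tensor algebra (`d_d`, `leibniz` and `coassoc` are the
components of this condition in `D`, `D ⊗ D` and `D ⊗ D ⊗ D`), and which is exhausted by
a filtration that `Δ` lowers. -/
structure ShCog (k : Type u) [Field k] where
  carrier : Type u
  [grp : AddCommGroup carrier]
  [module : Module k carrier]
  gr : ℤ → Submodule k carrier
  internal : DirectSum.IsInternal gr
  d : carrier →ₗ[k] carrier
  d_mem : ∀ {i : ℤ} {x : carrier}, x ∈ gr i → d x ∈ gr (i - 1)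
  Δ : carrier →ₗ[k] carrier ⊗[k] carrier
  Δ_mem : ∀ {n : ℤ} {x : carrier}, x ∈ gr n → Δ x ∈ Submodule.span k
    {t | ∃ (i j : ℤ) (y z : carrier), y ∈ gr i ∧ z ∈ gr j ∧ i + j = n - 1 ∧ t = y ⊗ₜ[k] z}
  d_d : ∀ x, d (d x) = 0
  leibniz : Δ ∘ₗ d +
    (TensorProduct.map d LinearMap.id + TensorProduct.map (parity internal) d) ∘ₗ Δ = 0
  coassoc : (TensorProduct.assoc k carrier carrier carrier).toLinearMap ∘ₗ
      TensorProduct.map Δ LinearMap.id ∘ₗ Δ +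
    TensorProduct.map (parity internal) Δ ∘ₗ Δ = 0
  conilpotent : ∃ F : ℕ → Submodule k carrier, F 0 = ⊥ ∧ Monotone F ∧ (∀ x, ∃ n, x ∈ F n) ∧
    ∀ n, ∀ x ∈ F (n + 1),
      Δ x ∈ LinearMap.range (TensorProduct.map (F n).subtype (F n).subtype)

attribute [instance] ShCog.grp ShCog.module

variable {k : Type u} [Field k]

/-- The sign operator of a dg algebra. -/
noncomputable abbrev DGAlg.ε (A : DGAlg k) : A.carrier →ₗ[k] A.carrier := parity A.internal

/-- The sign operator of a coalgebra. -/
noncomputable abbrev ShCog.ε (D : ShCog k) : D.carrier →ₗ[k] D.carrier := parity D.internal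

/-- The grading of the suspension `sA`: `(sA)_n = A_{n-1}`. -/
def DGAlg.sgr (A : DGAlg k) (n : ℤ) : Submodule k A.carrier := A.gr (n - 1)

/-- One step of the recursion defining `merge`, on pairs `(t, L_t)` where `L_t v` merges
`v` with the first letter of `t`. -/
noncomputable def DGAlg.mergeStep (A : DGAlg k) :
    A.carrier →ₗ[k] Module.End k (TensorAlgebra k A.carrier ×
      (A.carrier →ₗ[k] TensorAlgebra k A.carrier)) :=
  LinearMap.mk₂ k (fun w p => (TensorAlgebra.ι k w * p.1,
      LinearMap.mulRight k p.1 ∘ₗ TensorAlgebra.ι k ∘ₗ LinearMap.mulRight k w ∘ₗ A.ε))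
    (by intros; ext <;> simp [add_mul, mul_add])
    (by intros; ext <;> simp [mul_smul_comm])
    (by intros; ext <;> simp [mul_add])
    (by intros; ext <;> simp)

/-- `merge (w t) v = (-1)^|v| (v w) t`, for `v, w ∈ A` and `t` in the tensor algebra, and
`merge 1 v = 0`. -/
noncomputable def DGAlg.merge (A : DGAlg k) :
    TensorAlgebra k A.carrier →ₗ[k] A.carrier →ₗ[k] TensorAlgebra k A.carrier :=
  LinearMap.snd k _ _ ∘ₗ
    LinearMap.applyₗ ((1, 0) : TensorAlgebra k A.carrier ×
      (A.carrier →ₗ[k] TensorAlgebra k A.carrier)) ∘ₗ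
    (TensorAlgebra.lift k A.mergeStep).toLinearMap

theorem DGAlg.merge_one (A : DGAlg k) : A.merge 1 = 0 := by
  simp [DGAlg.merge]

theorem DGAlg.merge_ι_mul (A : DGAlg k) (v w : A.carrier) (t : TensorAlgebra k A.carrier) :
    A.merge (TensorAlgebra.ι k w * t) v = TensorAlgebra.ι k (A.ε v * w) * t := by
  have happ : ∀ w p, A.mergeStep w p = (TensorAlgebra.ι k w * p.1,
      LinearMap.mulRight k p.1 ∘ₗ TensorAlgebra.ι k ∘ₗ LinearMap.mulRight k w ∘ₗ A.ε) :=
    fun _ _ => rfl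
  have h : ∀ t, (TensorAlgebra.lift k A.mergeStep t (1, 0)).1 = t := by
    intro t
    induction t using tensor_induction with
    | h1 => simp
    | hι v t ih => simp [ih, happ]
    | hadd s t hs ht => simp [hs, ht]
    | hsmul c t ht => simp [ht]
  simp [DGAlg.merge, happ, h]

/-- One step of the recursion defining `barDiff`, on pairs `(t, b t)`. -/
noncomputable def DGAlg.barStep (A : DGAlg k) :
    A.carrier →ₗ[k] Module.End k (TensorAlgebra k A.carrier × TensorAlgebra k A.carrier) :=
  LinearMap.mk₂ k (fun v p => (TensorAlgebra.ι k v * p.1,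
      -(TensorAlgebra.ι k (A.d v) * p.1) - TensorAlgebra.ι k (A.ε v) * p.2 + A.merge p.1 v))
    (by intros; ext <;> simp [add_mul]; abel)
    (by intros; ext <;> simp [smul_sub, smul_add])
    (by intros; ext <;> simp [mul_add]; abel)
    (by intros; ext <;> simp [smul_sub, smul_add])

/-- The differential of the bar construction, on the tensor coalgebra of `sA`. It is the
coderivation with components `sa ↦ -s(da)` and `sa ⊗ sb ↦ (-1)^|a| s(ab)`:
`b (v t) = -(dv) t - (-1)^|v| v b(t) + merge t v`. -/
noncomputable def DGAlg.barDiff (A : DGAlg k) :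
    TensorAlgebra k A.carrier →ₗ[k] TensorAlgebra k A.carrier :=
  LinearMap.snd k _ _ ∘ₗ
    LinearMap.applyₗ ((1, 0) : TensorAlgebra k A.carrier × TensorAlgebra k A.carrier) ∘ₗ
    (TensorAlgebra.lift k A.barStep).toLinearMap

theorem DGAlg.barDiff_one (A : DGAlg k) : A.barDiff 1 = 0 := by
  simp [DGAlg.barDiff]

theorem DGAlg.barDiff_ι_mul (A : DGAlg k) (v : A.carrier) (t : TensorAlgebra k A.carrier) :
    A.barDiff (TensorAlgebra.ι k v * t) = -(TensorAlgebra.ι k (A.d v) * t)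
      - TensorAlgebra.ι k (A.ε v) * A.barDiff t + A.merge t v := by
  have happ : ∀ v p, A.barStep v p = (TensorAlgebra.ι k v * p.1,
      -(TensorAlgebra.ι k (A.d v) * p.1) - TensorAlgebra.ι k (A.ε v) * p.2 + A.merge p.1 v) :=
    fun _ _ => rfl
  have h : ∀ t, (TensorAlgebra.lift k A.barStep t (1, 0)).1 = t := by
    intro t
    induction t using tensor_induction with
    | h1 => simp
    | hι v t ih => simp [ih, happ]
    | hadd s t hs ht => simp [hs, ht]
    | hsmul c t ht => simp [ht]
  simp [DGAlg.barDiff, happ, h]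

/-- The decomposition map, with values in the tensor algebra. -/
noncomputable def ShCog.quad (D : ShCog k) : D.carrier →ₗ[k] TensorAlgebra k D.carrier :=
  LinearMap.mul' k (TensorAlgebra k D.carrier) ∘ₗ
    TensorProduct.map (TensorAlgebra.ι k) (TensorAlgebra.ι k) ∘ₗ D.Δ

/-- The differential of the cobar construction, on the tensor algebra of `D`: the derivation
extending `d + Δ`. -/
noncomputable def ShCog.cobarDiff (D : ShCog k) :
    TensorAlgebra k D.carrier →ₗ[k] TensorAlgebra k D.carrier :=
  tensorDer D.ε (TensorAlgebra.ι k ∘ₗ D.d + D.quad)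

end Objects

section Morphisms

variable {k : Type u} [Field k]

/-- Morphisms of dg associative algebras. -/
@[ext]
structure DGAlgHom (A A' : DGAlg k) where
  toLin : A.carrier →ₗ[k] A'.carrier
  map_mul : ∀ a b, toLin (a * b) = toLin a * toLin b
  map_deg : ∀ {i : ℤ} {a : A.carrier}, a ∈ A.gr i → toLin a ∈ A'.gr i
  map_d : ∀ a, toLin (A.d a) = A'.d (toLin a)

/-- Morphisms of conilpotent dg `As^¡`-coalgebras. -/
@[ext]
structure ShCogHom (D' D : ShCog k) where
  toLin : D'.carrier →ₗ[k] D.carrier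
  map_deg : ∀ {i : ℤ} {x : D'.carrier}, x ∈ D'.gr i → toLin x ∈ D.gr i
  map_d : ∀ x, toLin (D'.d x) = D.d (toLin x)
  map_Δ : ∀ x, TensorProduct.map toLin toLin (D'.Δ x) = D.Δ (toLin x)

/-- `∞`-morphisms of algebras: morphisms of (coaugmented) dg coalgebras between the bar
constructions. -/
@[ext]
structure InfAlgHom (A A' : DGAlg k) where
  toLin : TensorAlgebra k A.carrier →ₗ[k] TensorAlgebra k A'.carrier
  map_one : toLin 1 = 1
  counit : ∀ t, TensorAlgebra.algebraMapInv (toLin t) = TensorAlgebra.algebraMapInv t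
  comul : ∀ t, deconc k A'.carrier (toLin t) =
    TensorProduct.map toLin toLin (deconc k A.carrier t)
  map_deg : ∀ {n : ℤ} {t}, t ∈ tensorDeg A.sgr n → toLin t ∈ tensorDeg A'.sgr n
  map_d : ∀ t, toLin (A.barDiff t) = A'.barDiff (toLin t)

/-- `∞`-morphisms of coalgebras: morphisms of (augmented) dg algebras between the cobar
constructions. -/
@[ext]
structure InfCogHom (D' D : ShCog k) where
  toAlg : TensorAlgebra k D'.carrier →ₐ[k] TensorAlgebra k D.carrier
  aug : ∀ t, TensorAlgebra.algebraMapInv (toAlg t) = TensorAlgebra.algebraMapInv t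
  map_deg : ∀ {n : ℤ} {t}, t ∈ tensorDeg D'.gr n → toAlg t ∈ tensorDeg D.gr n
  map_d : ∀ t, toAlg (D'.cobarDiff t) = D.cobarDiff (toAlg t)

/-- Composition of `∞`-morphisms of algebras. -/
def InfAlgHom.comp {A A' A'' : DGAlg k} (Ψ' : InfAlgHom A' A'') (Ψ : InfAlgHom A A') :
    InfAlgHom A A'' where
  toLin := Ψ'.toLin ∘ₗ Ψ.toLin
  map_one := by simp [Ψ.map_one, Ψ'.map_one]
  counit t := by simp [Ψ.counit, Ψ'.counit]
  comul t := by simp [Ψ.comul, Ψ'.comul, TensorProduct.map_comp]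
  map_deg h := Ψ'.map_deg (Ψ.map_deg h)
  map_d t := by simp [Ψ.map_d, Ψ'.map_d]

/-- Composition of `∞`-morphisms of coalgebras. -/
def InfCogHom.comp {D'' D' D : ShCog k} (Φ : InfCogHom D' D) (Φ' : InfCogHom D'' D') :
    InfCogHom D'' D where
  toAlg := Φ.toAlg.comp Φ'.toAlg
  aug t := by simp [Φ.aug, Φ'.aug]
  map_deg h := Φ.map_deg (Φ'.map_deg h)
  map_d t := by simp [Φ.map_d, Φ'.map_d]

/-- Identity morphism of algebras. -/
def DGAlgHom.id (A : DGAlg k) : DGAlgHom A A := ⟨LinearMap.id, by simp, fun h => h, by simp⟩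

/-- Identity morphism of coalgebras. -/
def ShCogHom.id (D : ShCog k) : ShCogHom D D := ⟨LinearMap.id, fun h => h, by simp, by simp⟩

section

variable {V W : Type u} [AddCommGroup V] [Module k V] [AddCommGroup W] [Module k W]

/-- The algebra map between tensor algebras induced by a linear map. -/
noncomputable def tensorMap (f : V →ₗ[k] W) : TensorAlgebra k V →ₐ[k] TensorAlgebra k W :=
  TensorAlgebra.lift k (TensorAlgebra.ι k ∘ₗ f)

theorem tensorMap_ι (f : V →ₗ[k] W) (v : V) :
    tensorMap f (TensorAlgebra.ι k v) = TensorAlgebra.ι k (f v) := by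
  simp [tensorMap]

theorem tensorMap_id : tensorMap (LinearMap.id : V →ₗ[k] V) = AlgHom.id k _ := by
  ext; simp [tensorMap_ι]

theorem tensorMap_aug (f : V →ₗ[k] W) (t : TensorAlgebra k V) :
    TensorAlgebra.algebraMapInv (tensorMap f t) = TensorAlgebra.algebraMapInv t := by
  have : (TensorAlgebra.algebraMapInv (M := W)).comp (tensorMap f) =
      TensorAlgebra.algebraMapInv := by
    ext v; simp [tensorMap_ι, TensorAlgebra.algebraMapInv]
  exact congr($this t)

theorem tensorMap_deg (f : V →ₗ[k] W) {gr : ℤ → Submodule k V} {gr' : ℤ → Submodule k W}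
    (hf : ∀ {i : ℤ} {v : V}, v ∈ gr i → f v ∈ gr' i) {n : ℤ} {t : TensorAlgebra k V}
    (ht : t ∈ tensorDeg gr n) : tensorMap f t ∈ tensorDeg gr' n := by
  refine (Submodule.span_le (p := (tensorDeg gr' n).comap (tensorMap f).toLinearMap)).2 ?_ ht
  rintro _ ⟨m, q, x, hx, hq, rfl⟩
  refine Submodule.subset_span ⟨m, q, fun i => f (x i), fun i => hf (hx i), hq, ?_⟩
  simp [TensorAlgebra.tprod_apply, map_list_prod, List.map_ofFn, Function.comp_def, tensorMap_ι]

theorem tensorMap_comul (f : V →ₗ[k] W) (t : TensorAlgebra k V) :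
    deconc k W (tensorMap f t) =
      TensorProduct.map (tensorMap f).toLinearMap (tensorMap f).toLinearMap (deconc k V t) := by
  induction t using tensor_induction with
  | h1 => simp [deconc_one]
  | hι v t ih =>
    have key : ∀ z : TensorAlgebra k V ⊗[k] TensorAlgebra k V,
        TensorProduct.map (tensorMap f).toLinearMap (tensorMap f).toLinearMap
          ((TensorAlgebra.ι k v ⊗ₜ[k] 1) * z) = (TensorAlgebra.ι k (f v) ⊗ₜ[k] 1) *
        TensorProduct.map (tensorMap f).toLinearMap (tensorMap f).toLinearMap z := by
      intro z
      induction z using TensorProduct.induction_on with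
      | zero => simp
      | tmul x y => simp [tensorMap_ι]
      | add x y hx hy => simp [mul_add, hx, hy]
    simp [deconc_ι_mul, tensorMap_ι, ih, key]
  | hadd s t hs ht => simp [hs, ht]
  | hsmul c t ht => simp [ht]

end

theorem DGAlgHom.map_ε {A A' : DGAlg k} (f : DGAlgHom A A') (a : A.carrier) :
    f.toLin (A.ε a) = A'.ε (f.toLin a) := by
  have ha : a ∈ ⨆ i, A.gr i := by rw [A.internal.submodule_iSup_eq_top]; trivial
  induction ha using Submodule.iSup_induction' with
  | mem i x hx => rw [parity_of_mem _ hx, parity_of_mem _ (f.map_deg hx), map_zsmul]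
  | zero => simp
  | add x y _ _ hx hy => simp [hx, hy]

theorem ShCogHom.map_ε {D' D : ShCog k} (f : ShCogHom D' D) (a : D'.carrier) :
    f.toLin (D'.ε a) = D.ε (f.toLin a) := by
  have ha : a ∈ ⨆ i, D'.gr i := by rw [D'.internal.submodule_iSup_eq_top]; trivial
  induction ha using Submodule.iSup_induction' with
  | mem i x hx => rw [parity_of_mem _ hx, parity_of_mem _ (f.map_deg hx), map_zsmul]
  | zero => simp
  | add x y _ _ hx hy => simp [hx, hy]

theorem DGAlgHom.map_merge {A A' : DGAlg k} (f : DGAlgHom A A') (t : TensorAlgebra k A.carrier)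
    (v : A.carrier) :
    tensorMap f.toLin (A.merge t v) = A'.merge (tensorMap f.toLin t) (f.toLin v) := by
  induction t using tensor_induction with
  | h1 => simp [DGAlg.merge_one]
  | hι w t ih => simp [DGAlg.merge_ι_mul, tensorMap_ι, f.map_mul, f.map_ε]
  | hadd s t hs ht => simp [hs, ht]
  | hsmul c t ht => simp [ht]

/-- A morphism of algebras, seen as an `∞`-morphism. -/
noncomputable def DGAlgHom.toInf {A A' : DGAlg k} (f : DGAlgHom A A') : InfAlgHom A A' where
  toLin := (tensorMap f.toLin).toLinearMap
  map_one := by simp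
  counit t := tensorMap_aug _ t
  comul t := tensorMap_comul _ t
  map_deg h := tensorMap_deg _ (fun h => f.map_deg h) h
  map_d t := by
    simp only [AlgHom.toLinearMap_apply]
    induction t using tensor_induction with
    | h1 => simp [DGAlg.barDiff_one]
    | hι v t ih => simp [DGAlg.barDiff_ι_mul, tensorMap_ι, ih, f.map_merge, f.map_d, f.map_ε]
    | hadd s t hs ht => simp [hs, ht]
    | hsmul c t ht => simp [ht]

/-- A morphism of coalgebras, seen as an `∞`-morphism. -/
noncomputable def ShCogHom.toInf {D' D : ShCog k} (f : ShCogHom D' D) : InfCogHom D' D where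
  toAlg := tensorMap f.toLin
  aug t := tensorMap_aug _ t
  map_deg h := tensorMap_deg _ (fun h => f.map_deg h) h
  map_d t := by
    have key : ∀ z : D'.carrier ⊗[k] D'.carrier,
        tensorMap f.toLin (LinearMap.mul' k _
          (TensorProduct.map (TensorAlgebra.ι k) (TensorAlgebra.ι k) z)) =
        LinearMap.mul' k _ (TensorProduct.map (TensorAlgebra.ι k) (TensorAlgebra.ι k)
          (TensorProduct.map f.toLin f.toLin z)) := by
      intro z
      induction z using TensorProduct.induction_on with
      | zero => simp
      | tmul x y => simp [tensorMap_ι]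
      | add x y hx hy => simp [hx, hy]
    have hq : ∀ v, tensorMap f.toLin (D'.quad v) = D.quad (f.toLin v) := by
      intro v
      simp only [ShCog.quad, LinearMap.comp_apply, key, f.map_Δ]
    induction t using tensor_induction with
    | h1 => simp [ShCog.cobarDiff, tensorDer_one]
    | hι v t ih =>
      simp only [ShCog.cobarDiff] at ih ⊢
      simp [tensorDer_ι_mul, tensorMap_ι, ih, f.map_d, f.map_ε, hq]
    | hadd s t hs ht => simp [hs, ht]
    | hsmul c t ht => simp [ht]

end Morphisms

section Lie

variable {k : Type u} [Field k]

/-- Families of multilinear maps `G^n → H`, one for every arity. -/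
abbrev Family (k G H : Type u) [Field k] [AddCommGroup G] [Module k G] [AddCommGroup H]
    [Module k H] : Type u :=
  ∀ n : ℕ, MultilinearMap k (fun _ : Fin n => G) H

variable {G H K : Type u} [AddCommGroup G] [Module k G] [AddCommGroup H] [Module k H]
  [AddCommGroup K] [Module k K]

/-- Evaluation of a family on a list of arguments. -/
def Family.ev (ψ : Family k G H) (l : List G) : H := ψ l.length l.get

/-- The sublist of `x` with indices in `S`, in increasing order. -/
def sub {n : ℕ} (x : Fin n → G) (S : Finset (Fin n)) : List G :=
  ((List.finRange n).filter (· ∈ S)).map x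

/-- Koszul sign of the reordering `x ↦ x ∘ σ` of elements of parities `p`. -/
def permSign {n : ℕ} (σ : Equiv.Perm (Fin n)) (p : Fin n → ZMod 2) : ℤ :=
  ∏ i, ∏ j, if i < j ∧ σ j < σ i then koszul (p (σ i)) (p (σ j)) else 1

/-- Koszul sign of the reordering that puts the elements with index in `S` first. -/
def subsetSign {n : ℕ} (S : Finset (Fin n)) (p : Fin n → ZMod 2) : ℤ :=
  ∏ i, ∏ j, if i ∈ S ∧ j ∉ S ∧ j < i then koszul (p i) (p j) else 1

/-- Koszul sign of the reordering that groups the elements according to the blocks of `c`. -/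
noncomputable def partSign {n : ℕ} (c : OrderedFinpartition n) (p : Fin n → ZMod 2) : ℤ :=
  ∏ i, ∏ j, if i < j ∧ c.index j < c.index i then koszul (p i) (p j) else 1

/-- `x ↦ ψ (φ (x_{B₁}), …, φ (x_{Bₘ}))` for the blocks `B₁, …, Bₘ` of the partition `c`. -/
noncomputable def compBlocks {n : ℕ} (c : OrderedFinpartition n) (ψ : Family k H K)
    (φ : Family k G H) : MultilinearMap k (fun _ : Fin n => G) K :=
  have key : ∀ (v : Fin n → G) (j : Fin n) (z : G),
      (fun m => φ (c.partSize m) (Function.update v j z ∘ c.emb m)) =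
        Function.update (fun m => φ (c.partSize m) (v ∘ c.emb m)) (c.index j)
          (φ _ (Function.update (v ∘ c.emb (c.index j)) (c.invEmbedding j) z)) := by
    intro v j z
    ext m
    by_cases h : m = c.index j
    · subst h
      rw [Function.update_self]
      congr 1
      rw [← Function.update_comp_eq_of_injective _ (c.emb_strictMono (c.index j)).injective]
      simp
    · rw [Function.update_of_ne h]
      congr 1
      apply Function.update_comp_eq_of_notMem_range
      have A : Disjoint (Set.range (c.emb m)) (Set.range (c.emb (c.index j))) :=
        c.disjoint (Set.mem_univ m) (Set.mem_univ (c.index j)) h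
      have : j ∈ Set.range (c.emb (c.index j)) := Set.mem_range.2 ⟨c.invEmbedding j, by simp⟩
      exact Set.disjoint_right.1 A this
  MultilinearMap.mk' (fun v => ψ c.length (fun m => φ (c.partSize m) (v ∘ c.emb m)))
    (fun v i x y => by simp only [key, MultilinearMap.map_update_add])
    (fun v i a x => by simp only [key, MultilinearMap.map_update_smul])

/-- Given a multilinear formula `M p` for elements of parities `p`, the multilinear map that is
given by `M p` on elements of parities `p`, for all `p`. -/
noncomputable def superExt {gr : ℤ → Submodule k G} (h : DirectSum.IsInternal gr) {n : ℕ}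
    (M : (Fin n → ZMod 2) → MultilinearMap k (fun _ : Fin n => G) H) :
    MultilinearMap k (fun _ : Fin n => G) H :=
  ∑ p : Fin n → ZMod 2, (M p).compLinearMap (fun i => parityProj h (p i))

theorem superExt_of_mem {gr : ℤ → Submodule k G} (h : DirectSum.IsInternal gr) {n : ℕ}
    (M : (Fin n → ZMod 2) → MultilinearMap k (fun _ : Fin n => G) H) (p : Fin n → ℤ)
    (x : Fin n → G) (hx : ∀ i, x i ∈ gr (p i)) :
    superExt h M x = M (fun i => p i) x := by
  simp only [superExt, sum_apply, MultilinearMap.compLinearMap_apply]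
  rw [Finset.sum_eq_single (fun i => (p i : ZMod 2))]
  · congr 1
    ext i
    rw [parityProj_of_mem h _ (hx i), if_pos rfl]
  · intro b _ hb
    obtain ⟨i, hi⟩ := Function.ne_iff.1 hb
    refine (M b).map_coord_zero i ?_
    rw [parityProj_of_mem h _ (hx i), if_neg (fun e => hi e.symm)]
  · simp

/-- The composite of two families, as morphisms of cofree graded cocommutative coalgebras:
`(ψ φ)(x₁, …, xₙ) = ∑ ± ψ (φ (x_{B₁}), …, φ (x_{Bₘ}))`, where the sum runs over all partitions
`B₁ ⊔ … ⊔ Bₘ` of `{1, …, n}`. -/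
noncomputable def Family.comp {gr : ℤ → Submodule k G} (h : DirectSum.IsInternal gr)
    (ψ : Family k H K) (φ : Family k G H) : Family k G K := fun n =>
  superExt h fun p => ∑ c : OrderedFinpartition n, partSign c p • compBlocks c ψ φ

/-- Graded symmetry of a family. -/
def Family.IsSymm (gr : ℤ → Submodule k G) (ψ : Family k G H) : Prop :=
  ∀ (n : ℕ) (p : Fin n → ℤ) (x : Fin n → G), (∀ i, x i ∈ gr (p i)) →
    ∀ σ : Equiv.Perm (Fin n), ψ n (x ∘ σ) = permSign σ (fun i => p i) • ψ n x

/-- A family all of whose members are homogeneous of degree `r`. -/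
def Family.HasDegree (gr : ℤ → Submodule k G) (gr' : ℤ → Submodule k H) (r : ℤ)
    (ψ : Family k G H) : Prop :=
  ∀ (n : ℕ) (p : Fin n → ℤ) (x : Fin n → G), (∀ i, x i ∈ gr (p i)) →
    ψ n x ∈ gr' (∑ i, p i + r)

/-- `∑_S ± ψ (ℓ (x_S), x_{S^c})`, over the non-empty subsets `S` of `{1, …, n}`. For non-empty
`S` this is a sum over shuffles. -/
def insertSum (ψ : Family k G H) (ℓ : Family k G G) {n : ℕ} (p : Fin n → ZMod 2)
    (x : Fin n → G) : H :=
  ∑ S : Finset (Fin n) with S.Nonempty, subsetSign S p • ψ.ev (ℓ.ev (sub x S) :: sub x Sᶜ)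

variable (k) in
/-- A shifted homotopy Lie algebra: graded symmetric operations `ℓₙ`, `n ≥ 1`, of degree `-1` on a
graded vector space, `ℓ₁` being the differential, with `∑_S ± ℓ (ℓ (x_S), x_{S^c}) = 0`. -/
structure SLieInf where
  carrier : Type u
  [grp : AddCommGroup carrier]
  [module : Module k carrier]
  gr : ℤ → Submodule k carrier
  internal : DirectSum.IsInternal gr
  ℓ : Family k carrier carrier
  ℓ_zero : ℓ 0 = 0
  ℓ_deg : ℓ.HasDegree gr gr (-1)
  ℓ_symm : ℓ.IsSymm gr
  rel : ∀ (n : ℕ) (p : Fin n → ℤ) (x : Fin n → carrier), (∀ i, x i ∈ gr (p i)) →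
    insertSum ℓ ℓ (fun i => p i) x = 0

attribute [instance] SLieInf.grp SLieInf.module

/-- An `∞`-morphism of shifted homotopy Lie algebras: graded symmetric maps `ψₙ`, `n ≥ 1`, of
degree `0` with `∑_S ± ψ (ℓ (x_S), x_{S^c}) = ∑ ± ℓ (ψ (x_{B₁}), …, ψ (x_{Bₘ}))`, the second sum
being over all partitions. -/
@[ext]
structure InfLieHom (g h : SLieInf k) where
  ψ : Family k g.carrier h.carrier
  ψ_zero : ψ 0 = 0
  ψ_deg : ψ.HasDegree g.gr h.gr 0
  ψ_symm : ψ.IsSymm g.gr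
  rel : ∀ (n : ℕ) (p : Fin n → ℤ) (x : Fin n → g.carrier), (∀ i, x i ∈ g.gr (p i)) →
    insertSum ψ g.ℓ (fun i => p i) x = Family.comp g.internal h.ℓ ψ n x

variable (k G) in
/-- The identity family: the identity map in arity `1`, zero in all other arities. -/
def idFamily : Family k G G
  | 1 => MultilinearMap.ofSubsingleton k G G 0 LinearMap.id
  | _ => 0

end Lie

section GradedHom

variable {k : Type u} [Field k] {V W : Type u} [AddCommGroup V] [Module k V] [AddCommGroup W]
  [Module k W]

/-- Linear maps of degree `n`. -/
def homDeg (gr : ℤ → Submodule k V) (gr' : ℤ → Submodule k W) (n : ℤ) :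
    Submodule k (V →ₗ[k] W) where
  carrier := {f | ∀ i, ∀ v ∈ gr i, f v ∈ gr' (i + n)}
  add_mem' hf hg i v hv := add_mem (hf i v hv) (hg i v hv)
  zero_mem' _ _ _ := zero_mem _
  smul_mem' c _ hf i v hv := Submodule.smul_mem _ c (hf i v hv)

/-- The graded vector space `hom(V, W)`: finite sums of homogeneous linear maps. -/
def gradedHom (gr : ℤ → Submodule k V) (gr' : ℤ → Submodule k W) : Submodule k (V →ₗ[k] W) :=
  ⨆ n, homDeg gr gr' n

/-- The grading of `hom(V, W)`. -/
def gradedHomGr (gr : ℤ → Submodule k V) (gr' : ℤ → Submodule k W) (n : ℤ) :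
    Submodule k (gradedHom gr gr') :=
  (homDeg gr gr' n).comap (gradedHom gr gr').subtype

theorem homDeg_iSupIndep {gr : ℤ → Submodule k V} {gr' : ℤ → Submodule k W}
    (h : DirectSum.IsInternal gr) (h' : DirectSum.IsInternal gr') :
    iSupIndep (homDeg gr gr') := by
  rw [iSupIndep_iff_finsetSum_eq_zero_imp_eq_zero]
  intro s F hF h0 n hn
  ext v
  have hv : v ∈ ⨆ i, gr i := by rw [h.submodule_iSup_eq_top]; trivial
  induction hv using Submodule.iSup_induction' with
  | mem i v hv =>
    have hind : iSupIndep fun m => gr' (i + m) :=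
      h'.submodule_iSupIndep.comp (fun a b hab => by simpa using hab)
    refine (iSupIndep_iff_finsetSum_eq_zero_imp_eq_zero _).1 hind s (fun m => F m v)
      (fun m hm => hF m hm i v hv) ?_ n hn
    simpa using congr($h0 v)
  | zero => simp
  | add x y _ _ hx hy => simp at hx hy; simp [hx, hy]

theorem gradedHomGr_internal {gr : ℤ → Submodule k V} {gr' : ℤ → Submodule k W}
    (h : DirectSum.IsInternal gr) (h' : DirectSum.IsInternal gr') :
    DirectSum.IsInternal (gradedHomGr gr gr') := by
  refine DirectSum.isInternal_submodule_of_iSupIndep_of_iSup_eq_top ?_ ?_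
  · rw [iSupIndep_iff_finsetSum_eq_zero_imp_eq_zero]
    intro s F hF h0 n hn
    have := (iSupIndep_iff_finsetSum_eq_zero_imp_eq_zero _).1 (homDeg_iSupIndep h h') s
      (fun m => (F m : V →ₗ[k] W)) (fun m hm => hF m hm) (by simpa using congr(($h0).1)) n hn
    exact Subtype.ext this
  · rw [eq_top_iff]
    rintro ⟨f, hf⟩ -
    induction hf using Submodule.iSup_induction' with
    | mem i f hf => exact Submodule.mem_iSup_of_mem i hf
    | zero => exact zero_mem _
    | add x y hx hy hx' hy' => exact add_mem hx' hy'

/-- A multilinear map on a graded vector space that sends homogeneous arguments into a subspace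
takes values in that subspace. -/
theorem multilinear_mem {G H : Type u} [AddCommGroup G] [Module k G] [AddCommGroup H] [Module k H]
    {gr : ℤ → Submodule k G} (h : DirectSum.IsInternal gr) {n : ℕ}
    (M : MultilinearMap k (fun _ : Fin n => G) H) (P : Submodule k H)
    (hM : ∀ (p : Fin n → ℤ) (x : Fin n → G), (∀ i, x i ∈ gr (p i)) → M x ∈ P) (x : Fin n → G) :
    M x ∈ P := by
  classical
  have hx : ∀ i, ∃ (s : Finset ℤ) (y : ℤ → G), (∀ j, y j ∈ gr j) ∧ x i = ∑ j ∈ s, y j := by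
    intro i
    have hv : x i ∈ ⨆ i, gr i := by rw [h.submodule_iSup_eq_top]; trivial
    obtain ⟨f, hf⟩ := (Submodule.mem_iSup_iff_exists_dfinsupp' _ _).1 hv
    exact ⟨f.support, fun j => f j, fun j => (f j).2, hf.symm⟩
  choose s y hy hxy using hx
  rw [show x = fun i => ∑ j ∈ s i, y i j from funext hxy, MultilinearMap.map_sum_finset]
  exact sum_mem fun r _ => hM r _ fun i => hy i _

end GradedHom

section Evaluation

variable {k : Type u} [Field k] {V W G : Type u} [AddCommGroup V] [Module k V] [AddCommGroup W]
  [Module k W] [AddCommGroup G] [Module k G]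

/-- The map of tensor algebras that is `f₁ ⊗ ⋯ ⊗ fₙ` (without signs) on `V^{⊗ n}` and zero on the
other tensor powers. -/
noncomputable def tensorEval (k : Type u) [Field k] (V W : Type u) [AddCommGroup V] [Module k V]
    [AddCommGroup W] [Module k W] (n : ℕ) :
    MultilinearMap k (fun _ : Fin n => V →ₗ[k] W) (TensorAlgebra k V →ₗ[k] TensorAlgebra k W) :=
  (LinearMap.lcomp k (TensorAlgebra k W)
      (DirectSum.component k ℕ (fun n => ⨂[k]^n V) n ∘ₗ TensorAlgebra.toDirectSum.toLinearMap) ∘ₗ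
    LinearMap.llcomp k (⨂[k]^n V) (⨂[k]^n W) (TensorAlgebra k W)
      TensorPower.toTensorAlgebra).compMultilinearMap
    (PiTensorProduct.mapMultilinear k (fun _ => V) (fun _ => W))

theorem tensorEval_apply (n : ℕ) (f : Fin n → (V →ₗ[k] W)) (t : TensorAlgebra k V) :
    tensorEval k V W n f t = TensorPower.toTensorAlgebra (PiTensorProduct.map f
      (DirectSum.component k ℕ (fun n => ⨂[k]^n V) n (TensorAlgebra.toDirectSum t))) := rfl

theorem toDirectSum_tprod (n : ℕ) (x : Fin n → V) :
    TensorAlgebra.toDirectSum (TensorAlgebra.tprod k V n x) =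
      DirectSum.lof k ℕ (fun n => ⨂[k]^n V) n (PiTensorProduct.tprod k x) := by
  rw [← TensorAlgebra.ofDirectSum_of_tprod, TensorAlgebra.toDirectSum_ofDirectSum]
  rfl

theorem tensorEval_tprod (n : ℕ) (f : Fin n → (V →ₗ[k] W)) (x : Fin n → V) :
    tensorEval k V W n f (TensorAlgebra.tprod k V n x) =
      TensorAlgebra.tprod k W n (fun i => f i (x i)) := by
  rw [tensorEval_apply, toDirectSum_tprod, DirectSum.component.lof_self,
    PiTensorProduct.map_tprod, TensorPower.toTensorAlgebra_tprod]

theorem tensorEval_tprod_ne {n m : ℕ} (h : m ≠ n) (f : Fin n → (V →ₗ[k] W)) (x : Fin m → V) :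
    tensorEval k V W n f (TensorAlgebra.tprod k V m x) = 0 := by
  rw [tensorEval_apply, toDirectSum_tprod, DirectSum.component.of, dif_neg h, map_zero, map_zero]

theorem tensorEval_mem {gr : ℤ → Submodule k V} {gr' : ℤ → Submodule k W} {n : ℕ} (r : Fin n → ℤ)
    (f : Fin n → (V →ₗ[k] W)) (hf : ∀ i, f i ∈ homDeg gr gr' (r i)) {N : ℤ}
    {t : TensorAlgebra k V} (ht : t ∈ tensorDeg gr N) :
    tensorEval k V W n f t ∈ tensorDeg gr' (N + ∑ i, r i) := by
  refine (Submodule.span_le (p := (tensorDeg gr' (N + ∑ i, r i)).comap _)).2 ?_ ht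
  rintro _ ⟨m, q, x, hx, rfl, rfl⟩
  rw [SetLike.mem_coe, Submodule.mem_comap]
  by_cases h : m = n
  · subst h
    rw [tensorEval_tprod]
    exact Submodule.subset_span ⟨m, fun i => q i + r i, _, fun i => hf i _ _ (hx i),
      Finset.sum_add_distrib, rfl⟩
  · rw [tensorEval_tprod_ne h]
    exact zero_mem _

/-- The action of `F = f₁ ⊗ ⋯ ⊗ fₙ` on tensors of length `n`, in coinvariants of the symmetric
group: for homogeneous `fᵢ`, `xᵢ` it sends `x₁ ⊗ ⋯ ⊗ xₙ` to
`∑_σ ± f_{σ(1)}(x₁) ⊗ ⋯ ⊗ f_{σ(n)}(xₙ)`, the sign being the product of the Koszul sign of the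
reordering of the `fᵢ` and of `(-1)^(|xᵢ| |f_{σ(j)}|)` for `i < j`. Here `e` is the sign operator
of `V`. -/
noncomputable def symTensor {gr : ℤ → Submodule k G} (h : DirectSum.IsInternal gr)
    (e : V →ₗ[k] V) (j : G →ₗ[k] V →ₗ[k] W) (n : ℕ) :
    MultilinearMap k (fun _ : Fin n => G) (TensorAlgebra k V →ₗ[k] TensorAlgebra k W) :=
  superExt h fun p => ∑ σ : Equiv.Perm (Fin n), permSign σ p •
    ((tensorEval k V W n).compLinearMap fun i =>
      LinearMap.lcomp k W (powTwo e (∑ l with i < l, p (σ l))) ∘ₗ j).domDomCongr σ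

theorem symTensor_of_mem {gr : ℤ → Submodule k G} (h : DirectSum.IsInternal gr)
    (e : V →ₗ[k] V) (j : G →ₗ[k] V →ₗ[k] W) (n : ℕ) (p : Fin n → ℤ) (f : Fin n → G)
    (hf : ∀ i, f i ∈ gr (p i)) : symTensor h e j n f =
      ∑ σ : Equiv.Perm (Fin n), permSign σ (fun i => p i) • tensorEval k V W n
        (fun i => j (f (σ i)) ∘ₗ powTwo e (∑ l with i < l, (p (σ l) : ZMod 2))) := by
  rw [symTensor, superExt_of_mem h _ p f hf]
  simp [sum_apply]
  rfl

theorem symTensor_mem {gr : ℤ → Submodule k V} {gr' : ℤ → Submodule k W}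
    {gG : ℤ → Submodule k G} (h : DirectSum.IsInternal gG)
    (e : V →ₗ[k] V) (he : e ∈ homDeg gr gr 0) (j : G →ₗ[k] V →ₗ[k] W)
    (hj : ∀ r, ∀ g ∈ gG r, j g ∈ homDeg gr gr' r) {n : ℕ} (p : Fin n → ℤ) (f : Fin n → G)
    (hf : ∀ i, f i ∈ gG (p i)) {N : ℤ} {t : TensorAlgebra k V} (ht : t ∈ tensorDeg gr N) :
    symTensor h e j n f t ∈ tensorDeg gr' (N + ∑ i, p i) := by
  rw [symTensor_of_mem h e j n p f hf, LinearMap.sum_apply]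
  refine sum_mem fun σ _ => ?_
  rw [LinearMap.smul_apply]
  refine zsmul_mem ?_ _
  rw [← Equiv.sum_comp σ p]
  refine tensorEval_mem (fun i => p (σ i)) _ (fun i => ?_) ht
  intro a v hv
  refine hj _ _ (hf _) _ _ ?_
  unfold powTwo
  split_ifs
  · exact hv
  · simpa using he _ _ hv

end Evaluation

section Convolution

variable {k : Type u} [Field k]

/-- The graded vector space `hom(D, A)`. -/
abbrev Hom (D : ShCog k) (A : DGAlg k) : Submodule k (D.carrier →ₗ[k] A.carrier) :=
  gradedHom D.gr A.gr

theorem hom_internal (D : ShCog k) (A : DGAlg k) :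
    DirectSum.IsInternal (gradedHomGr D.gr A.gr) :=
  gradedHomGr_internal D.internal A.internal

/-- The grading of the suspension `sD`: `(sD)_n = D_{n-1}`. -/
def ShCog.sgr (D : ShCog k) (n : ℤ) : Submodule k D.carrier := D.gr (n - 1)

/-- The coassociative coproduct of degree `0` on `sD` that corresponds to `Δ`:
`sx ↦ ∑ (-1)^|x'| sx' ⊗ sx''` for `Δ x = ∑ x' ⊗ x''`. -/
noncomputable def ShCog.coprod (D : ShCog k) : D.carrier →ₗ[k] D.carrier ⊗[k] D.carrier :=
  TensorProduct.map D.ε LinearMap.id ∘ₗ D.Δ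

/-- The component `D → As^¡(n) ⊗ D^{⊗ n}` of the coalgebra structure, where
`As^¡(n) ⊗ D^{⊗ n}` is identified with the desuspension of `(sD)^{⊗ n}`: it is the iterated
coproduct of `sD`. -/
noncomputable def ShCog.iterCoprod (D : ShCog k) :
    ℕ → (D.carrier →ₗ[k] TensorAlgebra k D.carrier)
  | 0 => 0
  | 1 => TensorAlgebra.ι k
  | n + 2 => LinearMap.mul' k (TensorAlgebra k D.carrier) ∘ₗ
      TensorProduct.map (TensorAlgebra.ι k) (D.iterCoprod (n + 1)) ∘ₗ D.coprod

/-- The structure map `a₁ ⊗ ⋯ ⊗ aₙ ↦ a₁ ⋯ aₙ` of a (non-unital) algebra, on tensors of positive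
length; it is zero on `1`. -/
noncomputable def DGAlg.γ (A : DGAlg k) : TensorAlgebra k A.carrier →ₗ[k] A.carrier :=
  Unitization.sndHom k k A.carrier ∘ₗ
    (TensorAlgebra.lift k (Unitization.inrHom k k A.carrier)).toLinearMap

theorem parity_mem_homDeg {V : Type u} [AddCommGroup V] [Module k V] {gr : ℤ → Submodule k V}
    (h : DirectSum.IsInternal gr) : parity h ∈ homDeg gr gr 0 := by
  intro i v hv
  rw [parity_of_mem h hv, add_zero]
  exact zsmul_mem hv _

theorem ι_mem_tensorDeg {V : Type u} [AddCommGroup V] [Module k V] {gr : ℤ → Submodule k V}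
    {i : ℤ} {v : V} (hv : v ∈ gr i) : TensorAlgebra.ι k v ∈ tensorDeg gr i :=
  Submodule.subset_span ⟨1, fun _ => i, fun _ => v, fun _ => hv, by simp, by simp⟩

theorem mul_mem_tensorDeg {V : Type u} [AddCommGroup V] [Module k V] {gr : ℤ → Submodule k V}
    {i j : ℤ} {s t : TensorAlgebra k V} (hs : s ∈ tensorDeg gr i) (ht : t ∈ tensorDeg gr j) :
    s * t ∈ tensorDeg gr (i + j) := by
  refine (Submodule.span_le (p := (tensorDeg gr (i + j)).comap (LinearMap.mulRight k t))).2 ?_ hs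
  rintro _ ⟨m, q, x, hx, rfl, rfl⟩
  refine (Submodule.span_le (p := (tensorDeg gr (_ + j)).comap (LinearMap.mulLeft k _))).2 ?_ ht
  rintro _ ⟨m', q', x', hx', rfl, rfl⟩
  refine Submodule.subset_span ⟨m + m', Fin.append q q', Fin.append x x', fun i => ?_, ?_, ?_⟩
  · refine Fin.addCases (fun i => ?_) (fun i => ?_) i <;> simp [hx, hx']
  · simp [Fin.sum_univ_add]
  · simp [TensorAlgebra.tprod_apply, List.ofFn_add]

theorem DGAlg.γ_mem (A : DGAlg k) {n : ℤ} {t : TensorAlgebra k A.carrier}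
    (ht : t ∈ tensorDeg A.gr n) : A.γ t ∈ A.gr n := by
  refine (Submodule.span_le (p := (A.gr n).comap A.γ)).2 ?_ ht
  rintro _ ⟨m, q, x, hx, rfl, rfl⟩
  have key : ∀ (m : ℕ) (q : Fin (m + 1) → ℤ) (x : Fin (m + 1) → A.carrier),
      (∀ i, x i ∈ A.gr (q i)) → ∃ a ∈ A.gr (∑ i, q i),
        TensorAlgebra.lift k (Unitization.inrHom k k A.carrier)
          (TensorAlgebra.tprod k A.carrier (m + 1) x) = Unitization.inr a := by
    intro m
    induction m with
    | zero => intro q x hx; exact ⟨x 0, by simpa using hx 0, by simp⟩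
    | succ m ih =>
      intro q x hx
      obtain ⟨a, ha, hax⟩ := ih (fun i => q i.succ) (fun i => x i.succ) (fun i => hx _)
      refine ⟨x 0 * a, by rw [Fin.sum_univ_succ]; exact A.mul_mem (hx 0) ha, ?_⟩
      rw [TensorAlgebra.tprod_apply] at hax ⊢
      rw [List.ofFn_succ, List.prod_cons, _root_.map_mul, hax]
      simp
  rcases m with _ | m
  · simp [DGAlg.γ]
  · obtain ⟨a, ha, hax⟩ := key m q x hx
    simp only [Submodule.comap_coe, Set.mem_preimage, DGAlg.γ, LinearMap.comp_apply,
      AlgHom.toLinearMap_apply, hax]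
    simpa using ha

theorem ιInv_one {V : Type u} [AddCommGroup V] [Module k V] :
    TensorAlgebra.ιInv (1 : TensorAlgebra k V) = 0 := by
  let _ : Module kᵐᵒᵖ V := Module.compHom _ ((RingHom.id k).fromOpposite mul_comm)
  have _ : IsCentralScalar k V := ⟨fun r m => rfl⟩
  change (TensorAlgebra.toTrivSqZeroExt (R := k) (1 : TensorAlgebra k V)).snd = 0
  rw [_root_.map_one]
  rfl

theorem ιInv_ι {V : Type u} [AddCommGroup V] [Module k V] (v : V) :
    TensorAlgebra.ιInv (TensorAlgebra.ι k v) = v := TensorAlgebra.ι_leftInverse v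

theorem ιInv_ι_mul_ι_mul {V : Type u} [AddCommGroup V] [Module k V] (v w : V)
    (t : TensorAlgebra k V) :
    TensorAlgebra.ιInv (TensorAlgebra.ι k v * (TensorAlgebra.ι k w * t)) = 0 := by
  let _ : Module kᵐᵒᵖ V := Module.compHom _ ((RingHom.id k).fromOpposite mul_comm)
  have _ : IsCentralScalar k V := ⟨fun r m => rfl⟩
  change (TensorAlgebra.toTrivSqZeroExt (R := k)
    (TensorAlgebra.ι k v * (TensorAlgebra.ι k w * t))).snd = 0
  rw [_root_.map_mul, _root_.map_mul, ← mul_assoc, TensorAlgebra.toTrivSqZeroExt_ι,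
    TensorAlgebra.toTrivSqZeroExt_ι, TrivSqZeroExt.inr_mul_inr, zero_mul]
  rfl

theorem ιInv_mem {V : Type u} [AddCommGroup V] [Module k V] {gr : ℤ → Submodule k V} {n : ℤ}
    {t : TensorAlgebra k V} (ht : t ∈ tensorDeg gr n) : TensorAlgebra.ιInv t ∈ gr n := by
  refine (Submodule.span_le (p := (gr n).comap TensorAlgebra.ιInv)).2 ?_ ht
  rintro _ ⟨m, q, x, hx, rfl, rfl⟩
  rw [SetLike.mem_coe, Submodule.mem_comap, TensorAlgebra.tprod_apply]
  rcases m with _ | _ | m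
  · simp [ιInv_one]
  · simpa [ιInv_ι] using hx 0
  · simp only [List.ofFn_succ, List.prod_cons, ιInv_ι_mul_ι_mul]
    exact zero_mem _

theorem ShCog.tensorProduct_mem_aux (D : ShCog k) {W : Type u} [AddCommGroup W] [Module k W]
    (P : Submodule k W) {n : ℤ} {x : D.carrier} (hx : x ∈ D.gr n)
    (L : D.carrier ⊗[k] D.carrier →ₗ[k] W)
    (hL : ∀ i j y z, y ∈ D.gr i → z ∈ D.gr j → i + j = n - 1 → L (y ⊗ₜ z) ∈ P) :
    L (D.Δ x) ∈ P := by
  refine (Submodule.span_le (p := P.comap L)).2 ?_ (D.Δ_mem hx)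
  rintro _ ⟨i, j, y, z, hy, hz, h, rfl⟩
  exact hL i j y z hy hz h

theorem ShCog.quad_mem (D : ShCog k) {n : ℤ} {x : D.carrier} (hx : x ∈ D.gr n) :
    D.quad x ∈ tensorDeg D.gr (n - 1) := by
  refine D.tensorProduct_mem_aux _ hx (LinearMap.mul' k (TensorAlgebra k D.carrier) ∘ₗ
    TensorProduct.map (TensorAlgebra.ι k) (TensorAlgebra.ι k)) ?_
  intro i j y z hy hz h
  rw [← h]
  exact mul_mem_tensorDeg (ι_mem_tensorDeg hy) (ι_mem_tensorDeg hz)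

theorem ShCog.iterCoprod_mem (D : ShCog k) (m : ℕ) {n : ℤ} {x : D.carrier} (hx : x ∈ D.sgr n) :
    D.iterCoprod m x ∈ tensorDeg D.sgr n := by
  induction m generalizing n x with
  | zero => exact zero_mem _
  | succ m ih =>
    rcases m with _ | m
    · exact ι_mem_tensorDeg hx
    · refine D.tensorProduct_mem_aux _ hx (LinearMap.mul' k (TensorAlgebra k D.carrier) ∘ₗ
        TensorProduct.map (TensorAlgebra.ι k) (D.iterCoprod (m + 1)) ∘ₗ
          TensorProduct.map D.ε LinearMap.id) ?_
      intro i j y z hy hz h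
      rw [show n = (i + 1) + (j + 1) by linarith]
      refine mul_mem_tensorDeg (ι_mem_tensorDeg ?_) (ih ?_)
      · rw [ShCog.sgr, add_sub_cancel_right]
        simpa using parity_mem_homDeg D.internal _ _ hy
      · rw [ShCog.sgr, add_sub_cancel_right]
        exact hz

theorem homDeg_shift (D : ShCog k) (A : DGAlg k) (r : ℤ) (f : Hom D A)
    (hf : f ∈ gradedHomGr D.gr A.gr r) : (f : D.carrier →ₗ[k] A.carrier) ∈
      homDeg D.sgr A.sgr r := by
  intro i v hv
  have := hf _ _ hv
  rwa [show i - 1 + r = i + r - 1 by ring] at this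

/-- The family `hom_ℓ(Φ, ψ)`: `(f₁, …, fₙ) ↦ ψ γ_A F Φ_n`. -/
noncomputable def homL {D' D : ShCog k} {A A' : DGAlg k} (Φ : InfCogHom D' D)
    (ψ : DGAlgHom A A') : Family k (Hom D A) (Hom D' A') := fun n =>
  MultilinearMap.codRestrict
    ((LinearMap.lcomp k A'.carrier (Φ.toAlg.toLinearMap ∘ₗ TensorAlgebra.ι k) ∘ₗ
        LinearMap.llcomp k _ _ _ (ψ.toLin ∘ₗ A.γ)).compMultilinearMap
      (symTensor (hom_internal D A) D.ε (Hom D A).subtype n))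
    (Hom D' A') fun f => by
      refine multilinear_mem (hom_internal D A) _ _ (fun p f hf => ?_) f
      refine Submodule.mem_iSup_of_mem (∑ i, p i) fun i x hx => ?_
      exact ψ.map_deg (A.γ_mem (symTensor_mem _ _ (parity_mem_homDeg _) _ (fun r g hg => hg) p f hf
        (Φ.map_deg (ι_mem_tensorDeg hx))))

theorem homL_apply {D' D : ShCog k} {A A' : DGAlg k} (Φ : InfCogHom D' D)
    (ψ : DGAlgHom A A') (n : ℕ) (f : Fin n → Hom D A) (x : D'.carrier) :
    (homL Φ ψ n f : D'.carrier →ₗ[k] A'.carrier) x =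
      ψ.toLin (A.γ (symTensor (hom_internal D A) D.ε (Hom D A).subtype n f
        (Φ.toAlg (TensorAlgebra.ι k x)))) := rfl

/-- The family `hom_r(φ, Ψ)`: `(f₁, …, fₙ) ↦ Ψ F Δ^n φ`. The tensors live in the suspensions `sD`
and `sA`, so that the sign operator is the one of `sD`. -/
noncomputable def homR {D' D : ShCog k} {A A' : DGAlg k} (φ : ShCogHom D' D)
    (Ψ : InfAlgHom A A') : Family k (Hom D A) (Hom D' A') := fun n =>
  MultilinearMap.codRestrict
    ((LinearMap.lcomp k A'.carrier (D.iterCoprod n ∘ₗ φ.toLin) ∘ₗ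
        LinearMap.llcomp k _ _ _ (TensorAlgebra.ιInv ∘ₗ Ψ.toLin)).compMultilinearMap
      (symTensor (hom_internal D A) (-D.ε) (Hom D A).subtype n))
    (Hom D' A') fun f => by
      refine multilinear_mem (hom_internal D A) _ _ (fun p f hf => ?_) f
      refine Submodule.mem_iSup_of_mem (∑ i, p i) fun i x hx => ?_
      have hx' : φ.toLin x ∈ D.sgr (i + 1) := by
        rw [ShCog.sgr, add_sub_cancel_right]; exact φ.map_deg hx
      have := ιInv_mem (Ψ.map_deg (symTensor_mem (gr := D.sgr) (gr' := A.sgr) (hom_internal D A)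
        (-D.ε) (fun i v hv => neg_mem ?_) (Hom D A).subtype (fun r g hg => homDeg_shift D A r g hg)
        p f hf (D.iterCoprod_mem n hx')))
      · rwa [DGAlg.sgr, show i + 1 + ∑ i, p i - 1 = i + ∑ i, p i by ring] at this
      · have := parity_mem_homDeg D.internal _ _ hv
        rwa [ShCog.sgr, show i + 0 - 1 = i - 1 + 0 by ring]

theorem homR_apply {D' D : ShCog k} {A A' : DGAlg k} (φ : ShCogHom D' D)
    (Ψ : InfAlgHom A A') (n : ℕ) (f : Fin n → Hom D A) (x : D'.carrier) :
    (homR φ Ψ n f : D'.carrier →ₗ[k] A'.carrier) x =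
      TensorAlgebra.ιInv (Ψ.toLin (symTensor (hom_internal D A) (-D.ε) (Hom D A).subtype n f
        (D.iterCoprod n (φ.toLin x)))) := rfl

end Convolution

section ConvolutionLie

variable {k : Type u} [Field k]

theorem koszul_zmod (a b : ZMod 2) : koszul a b = if a = 1 ∧ b = 1 then -1 else 1 := by
  revert a b; decide

theorem parity_parity {V : Type u} [AddCommGroup V] [Module k V] {gr : ℤ → Submodule k V}
    (h : DirectSum.IsInternal gr) (v : V) : parity h (parity h v) = v := by
  have hv : v ∈ ⨆ i, gr i := by rw [h.submodule_iSup_eq_top]; trivial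
  induction hv using Submodule.iSup_induction' with
  | mem i x hx =>
    rw [parity_of_mem h hx, map_zsmul, parity_of_mem h hx, smul_smul]
    have : ∀ a : ZMod 2, koszul a 1 * koszul a 1 = 1 := by decide
    rw [this, one_smul]
  | zero => simp
  | add x y _ _ hx hy => simp [hx, hy]

/-- Commutation of the sign operators with a map of degree `r`. -/
theorem parity_comm {V W : Type u} [AddCommGroup V] [Module k V] [AddCommGroup W] [Module k W]
    {gr : ℤ → Submodule k V} {gr' : ℤ → Submodule k W}
    (h : DirectSum.IsInternal gr) (h' : DirectSum.IsInternal gr') {r : ℤ} {f : V →ₗ[k] W}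
    (hf : f ∈ homDeg gr gr' r) (v : V) :
    parity h' (f v) = koszul r 1 • f (parity h v) := by
  have hv : v ∈ ⨆ i, gr i := by rw [h.submodule_iSup_eq_top]; trivial
  induction hv using Submodule.iSup_induction' with
  | mem i x hx =>
    rw [parity_of_mem h hx, parity_of_mem h' (hf i x hx), map_zsmul, smul_smul]
    congr 1
    push_cast
    generalize (i : ZMod 2) = a
    generalize (r : ZMod 2) = b
    revert a b; decide
  | zero => simp
  | add x y _ _ hx hy => simp [hx, hy]

theorem ShCog.Δ_parity (D : ShCog k) (x : D.carrier) :
    D.Δ (D.ε x) = -TensorProduct.map D.ε D.ε (D.Δ x) := by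
  have hv : x ∈ ⨆ i, D.gr i := by rw [D.internal.submodule_iSup_eq_top]; trivial
  induction hv using Submodule.iSup_induction' with
  | mem n x hx =>
    rw [parity_of_mem _ hx, map_zsmul]
    refine sub_eq_zero.1 ((Submodule.mem_bot k).1 (D.tensorProduct_mem_aux ⊥ hx
      (koszul n 1 • LinearMap.id - -TensorProduct.map D.ε D.ε) ?_))
    intro i j y z hy hz h
    rw [Submodule.mem_bot]
    simp only [LinearMap.sub_apply, LinearMap.smul_apply, LinearMap.neg_apply, LinearMap.id_apply,
      TensorProduct.map_tmul, parity_of_mem _ hy, parity_of_mem _ hz]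
    have hn : (n : ZMod 2) = i + j + 1 := by
      have : n = i + j + 1 := by linarith
      rw [this]; push_cast; ring
    rw [hn]
    generalize (i : ZMod 2) = a
    generalize (j : ZMod 2) = b
    have ha : a = 0 ∨ a = 1 := by revert a; decide
    have hb : b = 0 ∨ b = 1 := by revert b; decide
    rcases ha with rfl | rfl <;> rcases hb with rfl | rfl <;>
      simp [koszul, TensorProduct.neg_tmul, TensorProduct.tmul_neg, 
        show (1 : ZMod 2) + 1 = 0 from by decide]
  | zero => simp
  | add x y _ _ hx hy => simp [hx, hy]; abel

/-- The bilinear operation `(f, g) ↦ γ_A (f ⊗ g) Δ` for `g` of parity `q`. -/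
noncomputable def convMul (D : ShCog k) (A : DGAlg k) (q : ZMod 2)
    (f g : D.carrier →ₗ[k] A.carrier) : D.carrier →ₗ[k] A.carrier :=
  LinearMap.mul' k A.carrier ∘ₗ TensorProduct.map (f ∘ₗ powTwo D.ε q) g ∘ₗ D.Δ

/-- The differential `f ↦ d_A f - (-1)^|f| f d_D` of `hom(D, A)`. -/
noncomputable def homDiff (D : ShCog k) (A : DGAlg k) :
    (D.carrier →ₗ[k] A.carrier) →ₗ[k] D.carrier →ₗ[k] A.carrier :=
  LinearMap.llcomp k D.carrier A.carrier A.carrier A.d -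
    (LinearMap.llcomp k D.carrier A.carrier A.carrier A.ε ∘ₗ
      LinearMap.lcomp k A.carrier (D.ε ∘ₗ D.d))

theorem homDiff_apply (D : ShCog k) (A : DGAlg k) (f : D.carrier →ₗ[k] A.carrier) (x : D.carrier) :
    homDiff D A f x = A.d (f x) - A.ε (f (D.ε (D.d x))) := rfl

theorem homDiff_mem (D : ShCog k) (A : DGAlg k) {r : ℤ} {f : D.carrier →ₗ[k] A.carrier}
    (hf : f ∈ homDeg D.gr A.gr r) : homDiff D A f ∈ homDeg D.gr A.gr (r - 1) := by
  intro i x hx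
  rw [homDiff_apply]
  refine sub_mem ?_ ?_
  · rw [← add_sub_assoc]; exact A.d_mem (hf i x hx)
  · have h1 := parity_mem_homDeg D.internal _ _ (D.d_mem hx)
    have h2 := parity_mem_homDeg A.internal _ _ (hf _ _ h1)
    rwa [show i - 1 + 0 + r + 0 = i + (r - 1) by ring] at h2

theorem homDiff_eq (D : ShCog k) (A : DGAlg k) {r : ℤ} {f : D.carrier →ₗ[k] A.carrier}
    (hf : f ∈ homDeg D.gr A.gr r) (x : D.carrier) :
    homDiff D A f x = A.d (f x) - koszul r 1 • f (D.d x) := by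
  rw [homDiff_apply, parity_comm D.internal A.internal hf, parity_parity]

/-- The binary bracket, in its most symmetric form:
`ℓ₂(f, g) = -(-1)^(|f| + |g|) γ_A (f ⊗ g) Δ`, where `f ⊗ g` acts through the symmetrization
`symTensor`. The sign is produced by conjugation with the sign operators. -/
noncomputable def homBracket (D : ShCog k) (A : DGAlg k) :
    MultilinearMap k (fun _ : Fin 2 => Hom D A) (Hom D A) :=
  MultilinearMap.codRestrict
    ((LinearMap.lcomp k A.carrier (D.quad ∘ₗ D.ε) ∘ₗ
        LinearMap.llcomp k _ _ _ (A.ε ∘ₗ A.γ)).compMultilinearMap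
      (symTensor (hom_internal D A) D.ε (Hom D A).subtype 2))
    (Hom D A) fun f => by
      refine multilinear_mem (hom_internal D A) _ _ (fun p f hf => ?_) f
      refine Submodule.mem_iSup_of_mem (∑ i, p i - 1) fun i x hx => ?_
      have h1 := parity_mem_homDeg D.internal _ _ hx
      have h2 := A.γ_mem (symTensor_mem (hom_internal D A) D.ε (parity_mem_homDeg _)
        (Hom D A).subtype (fun r g hg => hg) p f hf (D.quad_mem h1))
      have h3 := parity_mem_homDeg A.internal _ _ h2
      rwa [show i + 0 - 1 + ∑ i, p i + 0 = i + (∑ i, p i - 1) by ring] at h3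

theorem γ_tensorEval_two (D : ShCog k) (A : DGAlg k)
    (f : Fin 2 → (D.carrier →ₗ[k] A.carrier)) (x : D.carrier) :
    A.γ (tensorEval k D.carrier A.carrier 2 f (D.quad x)) =
      LinearMap.mul' k A.carrier (TensorProduct.map (f 0) (f 1) (D.Δ x)) := by
  have key : ∀ z : D.carrier ⊗[k] D.carrier,
      A.γ (tensorEval k D.carrier A.carrier 2 f (LinearMap.mul' k _
        (TensorProduct.map (TensorAlgebra.ι k) (TensorAlgebra.ι k) z))) =
      LinearMap.mul' k A.carrier (TensorProduct.map (f 0) (f 1) z) := by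
    intro z
    induction z using TensorProduct.induction_on with
    | zero => simp
    | tmul y z =>
      have := tensorEval_tprod (k := k) 2 f ![y, z]
      simp [TensorAlgebra.tprod_apply] at this
      simp [this, DGAlg.γ]
    | add x y hx hy => simp only [map_add, hx, hy]
  exact key _

theorem convMul_mem (D : ShCog k) (A : DGAlg k) {p q : ℤ} {f g : D.carrier →ₗ[k] A.carrier}
    (hf : f ∈ homDeg D.gr A.gr p) (hg : g ∈ homDeg D.gr A.gr q) :
    convMul D A q f g ∈ homDeg D.gr A.gr (p + q - 1) := by
  intro n x hx
  refine D.tensorProduct_mem_aux _ hx (LinearMap.mul' k A.carrier ∘ₗ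
    TensorProduct.map (f ∘ₗ powTwo D.ε q) g) ?_
  intro i j y z hy hz h
  have hy' : powTwo D.ε q y ∈ D.gr i := by
    unfold powTwo
    split_ifs
    · exact hy
    · simpa using parity_mem_homDeg D.internal _ _ hy
  have := A.mul_mem (hf _ _ hy') (hg _ _ hz)
  rwa [show i + p + (j + q) = n + (p + q - 1) by linarith] at this

theorem homBracket_eq (D : ShCog k) (A : DGAlg k) (p : Fin 2 → ℤ) (f : Fin 2 → Hom D A)
    (hf : ∀ i, f i ∈ gradedHomGr D.gr A.gr (p i)) :
    (homBracket D A f : D.carrier →ₗ[k] A.carrier) = (-koszul (p 0 + p 1) 1) •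
      (convMul D A (p 1) (f 0) (f 1) + koszul (p 0) (p 1) • convMul D A (p 0) (f 1) (f 0)) := by
  have conj : ∀ (r : ℤ) (g : D.carrier →ₗ[k] A.carrier), g ∈ homDeg D.gr A.gr (r - 1) →
      ∀ x, A.ε (g (D.ε x)) = (-koszul r 1) • g x := by
    intro r g hg x
    rw [parity_comm D.internal A.internal hg, parity_parity]
    congr 1
    push_cast
    generalize (r : ZMod 2) = a
    revert a; decide
  have h0 : (f 0 : D.carrier →ₗ[k] A.carrier) ∈ homDeg D.gr A.gr (p 0) := hf 0
  have h1 : (f 1 : D.carrier →ₗ[k] A.carrier) ∈ homDeg D.gr A.gr (p 1) := hf 1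
  have hF : ∀ x, A.γ (symTensor (hom_internal D A) D.ε (Hom D A).subtype 2 f (D.quad x)) =
      (convMul D A (p 1) (f 0) (f 1) + koszul (p 0) (p 1) • convMul D A (p 0) (f 1) (f 0)) x := by
    intro x
    have hS : ∀ g : Equiv.Perm (Fin 2) → A.carrier, ∑ σ, g σ = g 1 + g (Equiv.swap 0 1) := by
      intro g
      rw [show (Finset.univ : Finset (Equiv.Perm (Fin 2))) = {1, Equiv.swap 0 1} from by decide,
        Finset.sum_pair (by decide)]
    have hs1 : permSign (1 : Equiv.Perm (Fin 2)) (fun i => (p i : ZMod 2)) = 1 := by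
      simp [permSign, Fin.prod_univ_two]
    have hs2 : permSign (Equiv.swap (0 : Fin 2) 1) (fun i => (p i : ZMod 2)) =
        koszul (p 0) (p 1) := by
      simp [permSign, Fin.prod_univ_two, koszul, and_comm]
    have e0 : (Finset.univ.filter fun l : Fin 2 => 0 < l) = {1} := by decide
    have e1 : (Finset.univ.filter fun l : Fin 2 => 1 < l) = ∅ := by decide
    rw [symTensor_of_mem _ _ _ _ p f hf]
    simp only [LinearMap.sum_apply, map_sum, LinearMap.smul_apply, map_zsmul, hS, hs1, hs2,
      γ_tensorEval_two, e0, e1]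
    simp [convMul, powTwo, LinearMap.add_apply]
  ext x
  have := conj (p 0 + p 1) _ (add_mem (convMul_mem D A h0 h1) (zsmul_mem
    (by rw [add_comm (p 0)]; exact convMul_mem D A h1 h0) (koszul (p 0) (p 1)))) x
  rw [← hF] at this
  refine Eq.trans this ?_
  rw [LinearMap.smul_apply]
  push_cast
  rfl

end ConvolutionLie

section ConvolutionAlgebra

variable {k : Type u} [Field k]

theorem zmod_two_cases (a : ZMod 2) : a = 0 ∨ a = 1 := by revert a; decide

theorem powTwo_zero {V : Type u} [AddCommGroup V] [Module k V] (e : V →ₗ[k] V) :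
    powTwo e 0 = LinearMap.id := rfl

theorem powTwo_one {V : Type u} [AddCommGroup V] [Module k V] (e : V →ₗ[k] V) :
    powTwo e 1 = e := rfl

theorem koszul_zero_left (a : ZMod 2) : koszul 0 a = 1 := by simp [koszul]

theorem koszul_zero_right (a : ZMod 2) : koszul a 0 = 1 := by simp [koszul]

theorem koszul_one : koszul 1 1 = -1 := by simp [koszul]

theorem two_one : (1 : ZMod 2) + 1 = 0 := by decide

theorem zero_sub_one : (0 : ZMod 2) - 1 = 1 := by decide

section

variable (D : ShCog k) (A : DGAlg k) (q : ZMod 2) (f f' g : D.carrier →ₗ[k] A.carrier)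

theorem convMul_apply (x : D.carrier) : convMul D A q f g x =
    LinearMap.mul' k A.carrier (TensorProduct.map (f ∘ₗ powTwo D.ε q) g (D.Δ x)) := rfl

theorem convMul_add_left : convMul D A q (f + f') g = convMul D A q f g + convMul D A q f' g := by
  ext x; simp [convMul_apply, LinearMap.add_comp, TensorProduct.map_add_left]

theorem convMul_add_right : convMul D A q g (f + f') = convMul D A q g f + convMul D A q g f' := by
  ext x; simp [convMul_apply, TensorProduct.map_add_right]

theorem convMul_neg_left : convMul D A q (-f) g = -convMul D A q f g := by
  have := convMul_add_left D A q f (-f) g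
  have h0 : convMul D A q 0 g = 0 := by ext x; simp [convMul_apply]
  rw [add_neg_cancel, h0] at this
  exact (neg_eq_of_add_eq_zero_right this.symm).symm

theorem convMul_neg_right : convMul D A q g (-f) = -convMul D A q g f := by
  have := convMul_add_right D A q f (-f) g
  have h0 : convMul D A q g 0 = 0 := by ext x; simp [convMul_apply]
  rw [add_neg_cancel, h0] at this
  exact (neg_eq_of_add_eq_zero_right this.symm).symm

end

theorem ShCog.d_parity (D : ShCog k) (x : D.carrier) : D.d (D.ε x) = -D.ε (D.d x) := by
  have h : D.d ∈ homDeg D.gr D.gr (-1) := fun i v hv => D.d_mem hv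
  rw [parity_comm D.internal D.internal h, show ((-1 : ℤ) : ZMod 2) = 1 from by decide,
    koszul_one]
  simp

theorem convMul_leibniz (D : ShCog k) (A : DGAlg k) {p q : ℤ} {f g : D.carrier →ₗ[k] A.carrier}
    (hf : f ∈ homDeg D.gr A.gr p) (hg : g ∈ homDeg D.gr A.gr q) :
    homDiff D A (convMul D A q f g) = convMul D A q (homDiff D A f) g +
      koszul p 1 • convMul D A (q - 1) f (homDiff D A g) := by
  ext x
  rw [homDiff_eq D A (convMul_mem D A hf hg), LinearMap.add_apply, LinearMap.smul_apply]
  simp only [convMul_apply]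
  have hΔ : D.Δ (D.d x) =
      -(TensorProduct.map D.d LinearMap.id (D.Δ x) + TensorProduct.map D.ε D.d (D.Δ x)) :=
    eq_neg_of_add_eq_zero_left congr($(D.leibniz) x)
  rw [hΔ]
  generalize D.Δ x = t
  induction t using TensorProduct.induction_on with
  | zero => simp
  | add s t hs ht =>
    simp only [map_add, map_neg, smul_add, smul_neg, sub_neg_eq_add] at hs ht ⊢
    have hst := congrArg₂ (fun a b => a + b) hs ht
    refine Eq.trans ?_ (Eq.trans hst ?_) <;> abel
  | tmul y z =>
    simp only [LinearMap.add_apply, TensorProduct.map_tmul, LinearMap.mul'_apply, A.leibniz,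
      LinearMap.comp_apply, homDiff_eq D A hf, homDiff_eq D A hg, map_add, map_neg,
      LinearMap.id_apply]
    rw [← DGAlg.ε, parity_comm D.internal A.internal hf]
    push_cast
    generalize (p : ZMod 2) = a
    generalize (q : ZMod 2) = b
    rcases zmod_two_cases a with rfl | rfl <;> rcases zmod_two_cases b with rfl | rfl <;>
      simp [powTwo_zero, powTwo_one, koszul_zero_left, koszul_one, two_one, zero_sub_one,
        mul_sub, sub_mul, mul_add, add_mul, D.d_parity, parity_parity] <;> abel

theorem powTwo_parity (D : ShCog k) (r : ZMod 2) (x : D.carrier) :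
    D.Δ (powTwo D.ε r x) =
      koszul r 1 • TensorProduct.map (powTwo D.ε r) (powTwo D.ε r) (D.Δ x) := by
  rcases zmod_two_cases r with rfl | rfl
  · simp [powTwo_zero, koszul_zero_left]
  · simp [powTwo_one, koszul_one, D.Δ_parity]

theorem convMul_assoc (D : ShCog k) (A : DGAlg k) (q r : ZMod 2)
    (f g h : D.carrier →ₗ[k] A.carrier) :
    convMul D A r (convMul D A q f g) h =
      (-koszul r 1) • convMul D A (q + r - 1) f (convMul D A r g h) := by
  ext x
  let T : D.carrier ⊗[k] (D.carrier ⊗[k] D.carrier) →ₗ[k] A.carrier :=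
    LinearMap.mul' k A.carrier ∘ₗ TensorProduct.map (f ∘ₗ powTwo D.ε q ∘ₗ powTwo D.ε r)
      (LinearMap.mul' k A.carrier ∘ₗ TensorProduct.map (g ∘ₗ powTwo D.ε r) h)
  have hco : T (TensorProduct.assoc k _ _ _ (TensorProduct.map D.Δ LinearMap.id (D.Δ x))) =
      -T (TensorProduct.map D.ε D.Δ (D.Δ x)) := by
    rw [← map_neg]
    exact congrArg T (eq_neg_of_add_eq_zero_left congr($(D.coassoc) x))
  have h1 : convMul D A r (convMul D A q f g) h x = koszul r 1 •
      T (TensorProduct.assoc k _ _ _ (TensorProduct.map D.Δ LinearMap.id (D.Δ x))) := by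
    rw [convMul_apply]
    generalize D.Δ x = t
    induction t using TensorProduct.induction_on with
    | zero => simp
    | add s t hs ht => simp only [map_add, smul_add, hs, ht]
    | tmul y z =>
      simp only [TensorProduct.map_tmul, LinearMap.comp_apply, convMul_apply, powTwo_parity,
        LinearMap.mul'_apply, map_zsmul, LinearMap.id_apply, smul_mul_assoc]
      congr 1
      generalize D.Δ y = s
      induction s using TensorProduct.induction_on with
      | zero => simp
      | add s t hs ht => simp only [map_add, add_mul, TensorProduct.add_tmul, hs, ht]
      | tmul a b => simp [T, mul_assoc]
  have h2 : convMul D A (q + r - 1) f (convMul D A r g h) x =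
      T (TensorProduct.map D.ε D.Δ (D.Δ x)) := by
    rw [convMul_apply]
    generalize D.Δ x = t
    induction t using TensorProduct.induction_on with
    | zero => simp
    | add s t hs ht => simp only [map_add, hs, ht]
    | tmul y z =>
      have : powTwo D.ε (q + r - 1) y = powTwo D.ε q (powTwo D.ε r (D.ε y)) := by
        rcases zmod_two_cases q with rfl | rfl <;> rcases zmod_two_cases r with rfl | rfl <;>
          simp [powTwo_zero, powTwo_one, two_one, zero_sub_one, parity_parity]
      simp only [TensorProduct.map_tmul, LinearMap.comp_apply, this, T, LinearMap.mul'_apply]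
      rfl
  rw [h1, LinearMap.smul_apply, h2, hco]
  simp

/-- The differential on `hom(D, A)`. -/
noncomputable def homD (D : ShCog k) (A : DGAlg k) : Hom D A →ₗ[k] Hom D A :=
  (homDiff D A).restrict fun f hf => by
    refine (iSup_le fun r => ?_ : Hom D A ≤ (Hom D A).comap (homDiff D A)) hf
    intro f hf
    exact Submodule.mem_iSup_of_mem (r - 1) (homDiff_mem D A hf)

/-- The operations of the convolution algebra: the differential, the binary bracket, and zero in
arities at least three. -/
noncomputable def homOps (D : ShCog k) (A : DGAlg k) : Family k (Hom D A) (Hom D A)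
  | 1 => MultilinearMap.ofSubsingleton k (Hom D A) (Hom D A) 0 (homD D A)
  | 2 => homBracket D A
  | _ => 0

theorem homOps_ev_one (D : ShCog k) (A : DGAlg k) (a : Hom D A) :
    (homOps D A).ev [a] = homD D A a := rfl

theorem homOps_ev_two (D : ShCog k) (A : DGAlg k) (a b : Hom D A) :
    (homOps D A).ev [a, b] = homBracket D A ![a, b] := by
  change homBracket D A _ = _
  congr 1
  ext i
  fin_cases i <;> rfl

theorem homOps_ev_many (D : ShCog k) (A : DGAlg k) (l : List (Hom D A)) (hl : 3 ≤ l.length) :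
    (homOps D A).ev l = 0 := by
  rcases l with _ | ⟨a, _ | ⟨b, _ | ⟨c, l⟩⟩⟩
  · simp at hl
  · simp at hl
  · simp at hl
  · rfl

/-- The bracket, as an operation on homogeneous linear maps of parities `p`, `q`. -/
noncomputable def brk (D : ShCog k) (A : DGAlg k) (p q : ZMod 2)
    (f g : D.carrier →ₗ[k] A.carrier) : D.carrier →ₗ[k] A.carrier :=
  (-koszul (p + q) 1) • (convMul D A q f g + koszul p q • convMul D A p g f)

theorem homBracket_brk (D : ShCog k) (A : DGAlg k) {p q : ℤ} {a b : Hom D A}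
    (ha : a ∈ gradedHomGr D.gr A.gr p) (hb : b ∈ gradedHomGr D.gr A.gr q) :
    (homBracket D A ![a, b] : D.carrier →ₗ[k] A.carrier) = brk D A p q a b := by
  have := homBracket_eq D A ![p, q] ![a, b] (by intro i; fin_cases i <;> simp [ha, hb])
  simpa [brk] using this

theorem homD_mem (D : ShCog k) (A : DGAlg k) {p : ℤ} {a : Hom D A}
    (ha : a ∈ gradedHomGr D.gr A.gr p) : homD D A a ∈ gradedHomGr D.gr A.gr (p - 1) :=
  homDiff_mem D A ha

theorem homBracket_mem (D : ShCog k) (A : DGAlg k) {p q : ℤ} {a b : Hom D A}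
    (ha : a ∈ gradedHomGr D.gr A.gr p) (hb : b ∈ gradedHomGr D.gr A.gr q) :
    homBracket D A ![a, b] ∈ gradedHomGr D.gr A.gr (p + q - 1) := by
  change ((homBracket D A ![a, b] : Hom D A) : D.carrier →ₗ[k] A.carrier) ∈ homDeg D.gr A.gr _
  rw [homBracket_brk D A ha hb, brk]
  refine zsmul_mem (add_mem (convMul_mem D A ha hb) (zsmul_mem ?_ _)) _
  rw [add_comm p]
  exact convMul_mem D A hb ha

theorem homD_homD (D : ShCog k) (A : DGAlg k) {p : ℤ} {a : Hom D A}
    (ha : a ∈ gradedHomGr D.gr A.gr p) : homD D A (homD D A a) = 0 := by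
  refine Subtype.ext (LinearMap.ext fun x => ?_)
  replace ha : (a : D.carrier →ₗ[k] A.carrier) ∈ homDeg D.gr A.gr p := ha
  change homDiff D A (homDiff D A a) x = 0
  rw [homDiff_eq D A (homDiff_mem D A ha), homDiff_eq D A ha, homDiff_eq D A ha, map_sub, A.d_d,
    D.d_d]
  push_cast
  generalize (p : ZMod 2) = c
  rcases zmod_two_cases c with rfl | rfl <;>
    simp [koszul_zero_left, koszul_one, zero_sub_one]

theorem homBracket_leibniz (D : ShCog k) (A : DGAlg k) {p q : ℤ} {a b : Hom D A}
    (ha : a ∈ gradedHomGr D.gr A.gr p) (hb : b ∈ gradedHomGr D.gr A.gr q) :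
    homBracket D A ![homD D A a, b] + koszul p q • homBracket D A ![homD D A b, a] +
      homD D A (homBracket D A ![a, b]) = 0 := by
  have h : (homDiff D A (homBracket D A ![a, b] : Hom D A)) = (-koszul (p + q) 1) •
      (homDiff D A (convMul D A q a b) + koszul p q • homDiff D A (convMul D A p b a)) := by
    rw [homBracket_brk D A ha hb, brk, map_zsmul, map_add, map_zsmul]
  have ha' : (a : D.carrier →ₗ[k] A.carrier) ∈ homDeg D.gr A.gr p := ha
  have hb' : (b : D.carrier →ₗ[k] A.carrier) ∈ homDeg D.gr A.gr q := hb
  rw [convMul_leibniz D A ha' hb', convMul_leibniz D A hb' ha'] at h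
  refine Subtype.ext ?_
  simp only [Submodule.coe_add, Submodule.coe_smul_of_tower, Submodule.coe_zero]
  rw [homBracket_brk D A (homD_mem D A ha) hb, homBracket_brk D A (homD_mem D A hb) ha]
  change brk D A _ _ (homDiff D A a) b + _ • brk D A _ _ (homDiff D A b) a +
    homDiff D A (homBracket D A ![a, b] : Hom D A) = 0
  rw [h]
  simp only [brk]
  push_cast
  generalize (p : ZMod 2) = c
  generalize (q : ZMod 2) = e
  rcases zmod_two_cases c with rfl | rfl <;> rcases zmod_two_cases e with rfl | rfl <;>
    simp [koszul_zero_left, koszul_zero_right, koszul_one, zero_sub_one, two_one] <;> abel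

theorem homBracket_jacobi (D : ShCog k) (A : DGAlg k) {p q r : ℤ} {a b c : Hom D A}
    (ha : a ∈ gradedHomGr D.gr A.gr p) (hb : b ∈ gradedHomGr D.gr A.gr q)
    (hc : c ∈ gradedHomGr D.gr A.gr r) :
    homBracket D A ![homBracket D A ![a, b], c] +
      koszul q r • homBracket D A ![homBracket D A ![a, c], b] +
      (koszul p q * koszul p r) • homBracket D A ![homBracket D A ![b, c], a] = 0 := by
  refine Subtype.ext ?_
  simp only [Submodule.coe_add, Submodule.coe_smul_of_tower, Submodule.coe_zero]
  rw [homBracket_brk D A (homBracket_mem D A ha hb) hc,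
    homBracket_brk D A (homBracket_mem D A ha hc) hb,
    homBracket_brk D A (homBracket_mem D A hb hc) ha, homBracket_brk D A ha hb,
    homBracket_brk D A ha hc, homBracket_brk D A hb hc]
  simp only [brk]
  push_cast
  generalize (p : ZMod 2) = p'
  generalize (q : ZMod 2) = q'
  generalize (r : ZMod 2) = r'
  rcases zmod_two_cases p' with rfl | rfl <;> rcases zmod_two_cases q' with rfl | rfl <;>
    rcases zmod_two_cases r' with rfl | rfl <;>
    simp [koszul_zero_left, koszul_zero_right, koszul_one, zero_sub_one, two_one,
      convMul_add_left, convMul_add_right, convMul_neg_left, convMul_neg_right, convMul_assoc] <;>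
    abel

theorem homOps_deg (D : ShCog k) (A : DGAlg k) :
    (homOps D A).HasDegree (gradedHomGr D.gr A.gr) (gradedHomGr D.gr A.gr) (-1) := by
  intro n p x hx
  rcases n with _ | _ | _ | n
  · exact zero_mem _
  · have := homD_mem D A (hx 0)
    simpa [homOps, ← sub_eq_add_neg] using this
  · have := homBracket_mem D A (hx 0) (hx 1)
    have e : x = ![x 0, x 1] := by ext i; fin_cases i <;> rfl
    rw [Fin.sum_univ_two, ← sub_eq_add_neg, e]
    exact this
  · exact zero_mem _

theorem homOps_symm (D : ShCog k) (A : DGAlg k) :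
    (homOps D A).IsSymm (gradedHomGr D.gr A.gr) := by
  intro n p x hx σ
  rcases n with _ | _ | _ | n
  · simp [homOps]
  · obtain rfl : σ = 1 := Equiv.ext fun i => Subsingleton.elim (α := Fin 1) _ _
    simp [permSign]
  · have hσ : ∀ σ : Equiv.Perm (Fin 2), σ = 1 ∨ σ = Equiv.swap 0 1 := by decide
    rcases hσ σ with rfl | rfl
    · simp [permSign, Fin.prod_univ_two]
    · have hs : permSign (Equiv.swap (0 : Fin 2) 1) (fun i => (p i : ZMod 2)) =
          koszul (p 0) (p 1) := by
        simp [permSign, Fin.prod_univ_two, koszul, and_comm]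
      have e : x = ![x 0, x 1] := by ext i; fin_cases i <;> rfl
      have e' : x ∘ Equiv.swap (0 : Fin 2) 1 = ![x 1, x 0] := by
        ext i; fin_cases i <;> simp
      rw [hs, e']
      change homBracket D A _ = _ • homBracket D A x
      nth_rw 3 [e]
      refine Subtype.ext ?_
      rw [Submodule.coe_smul_of_tower, homBracket_brk D A (hx 1) (hx 0),
        homBracket_brk D A (hx 0) (hx 1)]
      simp only [brk]
      generalize (p 0 : ZMod 2) = c
      generalize (p 1 : ZMod 2) = e
      rcases zmod_two_cases c with rfl | rfl <;> rcases zmod_two_cases e with rfl | rfl <;>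
        simp [koszul_zero_left, koszul_zero_right, koszul_one, two_one] <;> abel
  · simp [homOps]

theorem homOps_ev_zero (D : ShCog k) (A : DGAlg k) (l : List (Hom D A)) :
    (homOps D A).ev (0 :: l) = 0 :=
  MultilinearMap.map_coord_zero _ (⟨0, by simp⟩ : Fin (0 :: l).length) rfl

theorem length_sub {G : Type u} {n : ℕ} (x : Fin n → G) (S : Finset (Fin n)) :
    (sub x S).length = S.card := by
  rw [sub, List.length_map, ← List.toFinset_card_of_nodup ((List.nodup_finRange n).filter _)]
  congr 1
  ext i
  simp

theorem homOps_rel (D : ShCog k) (A : DGAlg k) (n : ℕ) (p : Fin n → ℤ) (x : Fin n → Hom D A)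
    (hx : ∀ i, x i ∈ gradedHomGr D.gr A.gr (p i)) :
    insertSum (homOps D A) (homOps D A) (fun i => p i) x = 0 := by
  rcases n with _ | _ | _ | _ | n
  · refine Finset.sum_eq_zero fun S hS => ?_
    obtain ⟨i, -⟩ := (Finset.mem_filter.1 hS).2
    exact i.elim0
  · have hS : (Finset.univ.filter fun S : Finset (Fin 1) => S.Nonempty) = {{0}} := by decide
    have h1 : sub x {0} = [x 0] := rfl
    have h2 : sub x {0}ᶜ = [] := rfl
    rw [insertSum, hS, Finset.sum_singleton, h1, h2, homOps_ev_one, homOps_ev_one,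
      homD_homD D A (hx 0), smul_zero]
  · have hS : (Finset.univ.filter fun S : Finset (Fin 2) => S.Nonempty) =
      {{0}, {1}, {0, 1}} := by decide
    have h1 : sub x {0} = [x 0] := rfl
    have h2 : sub x {0}ᶜ = [x 1] := rfl
    have h3 : sub x {1} = [x 1] := rfl
    have h4 : sub x {1}ᶜ = [x 0] := rfl
    have h5 : sub x {0, 1} = [x 0, x 1] := rfl
    have h6 : sub x {0, 1}ᶜ = [] := rfl
    have s1 : subsetSign {0} (fun i => (p i : ZMod 2)) = 1 := by
      simp [subsetSign, Fin.prod_univ_two]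
    have s2 : subsetSign {1} (fun i => (p i : ZMod 2)) = koszul (p 0) (p 1) := by
      simp [subsetSign, Fin.prod_univ_two, koszul, and_comm]
    have s3 : subsetSign {0, 1} (fun i => (p i : ZMod 2)) = 1 := by
      simp [subsetSign, Fin.prod_univ_two]
    rw [insertSum, hS, Finset.sum_insert (by decide), Finset.sum_insert (by decide),
      Finset.sum_singleton, h1, h2, h3, h4, h5, h6, s1, s2, s3, one_smul, one_smul, ← add_assoc]
    simp only [homOps_ev_one, homOps_ev_two]
    exact homBracket_leibniz D A (hx 0) (hx 1)
  · have hS : (Finset.univ.filter fun S : Finset (Fin 3) => S.Nonempty) =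
      {{0, 1}, {0, 2}, {1, 2}, {0}, {1}, {2}, {0, 1, 2}} := by decide
    have h1 : sub x {0, 1} = [x 0, x 1] := rfl
    have h2 : sub x {0, 1}ᶜ = [x 2] := rfl
    have h3 : sub x {0, 2} = [x 0, x 2] := rfl
    have h4 : sub x {0, 2}ᶜ = [x 1] := rfl
    have h5 : sub x {1, 2} = [x 1, x 2] := rfl
    have h6 : sub x {1, 2}ᶜ = [x 0] := rfl
    have s1 : subsetSign {0, 1} (fun i => (p i : ZMod 2)) = 1 := by
      simp [subsetSign, Fin.prod_univ_three]
    have s2 : subsetSign {0, 2} (fun i => (p i : ZMod 2)) = koszul (p 1) (p 2) := by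
      simp [subsetSign, Fin.prod_univ_three, koszul, and_comm]
    have s3 : subsetSign {1, 2} (fun i => (p i : ZMod 2)) =
        koszul (p 0) (p 1) * koszul (p 0) (p 2) := by
      simp [subsetSign, Fin.prod_univ_three, koszul, and_comm]
    have t1 : (homOps D A).ev ((homOps D A).ev (sub x {0}) :: sub x {0}ᶜ) = 0 :=
      homOps_ev_many D A _ (by rw [List.length_cons, length_sub]; decide)
    have t2 : (homOps D A).ev ((homOps D A).ev (sub x {1}) :: sub x {1}ᶜ) = 0 :=
      homOps_ev_many D A _ (by rw [List.length_cons, length_sub]; decide)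
    have t3 : (homOps D A).ev ((homOps D A).ev (sub x {2}) :: sub x {2}ᶜ) = 0 :=
      homOps_ev_many D A _ (by rw [List.length_cons, length_sub]; decide)
    have t4 : (homOps D A).ev (sub x {0, 1, 2}) = 0 :=
      homOps_ev_many D A _ (by rw [length_sub]; decide)
    rw [insertSum, hS]
    rw [Finset.sum_insert (by decide), Finset.sum_insert (by decide), Finset.sum_insert (by decide),
      Finset.sum_insert (by decide), Finset.sum_insert (by decide), Finset.sum_insert (by decide),
      Finset.sum_singleton, h1, h2, h3, h4, h5, h6, s1, s2, s3, t1, t2, t3, t4, homOps_ev_zero]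
    simp only [homOps_ev_two, smul_zero, add_zero, one_smul, ← add_assoc]
    exact homBracket_jacobi D A (hx 0) (hx 1) (hx 2)
  · refine Finset.sum_eq_zero fun S _ => ?_
    by_cases h : 3 ≤ S.card
    · rw [homOps_ev_many D A (sub x S) (by rwa [length_sub]), homOps_ev_zero, smul_zero]
    · rw [homOps_ev_many, smul_zero]
      rw [List.length_cons, length_sub, Finset.card_compl, Fintype.card_fin]
      omega

/-- The convolution algebra `hom(D, A)`, a shifted Lie algebra with the differential
`f ↦ d_A f - (-1)^|f| f d_D` and the bracket
`{f, g} = -(-1)^(|f| + |g|) (γ_A (f ⊗ g) Δ + (-1)^(|f| |g|) γ_A (g ⊗ f) Δ)`. -/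
noncomputable def homK (D : ShCog k) (A : DGAlg k) : SLieInf k where
  carrier := Hom D A
  gr := gradedHomGr D.gr A.gr
  internal := hom_internal D A
  ℓ := homOps D A
  ℓ_zero := rfl
  ℓ_deg := homOps_deg D A
  ℓ_symm := homOps_symm D A
  rel := homOps_rel D A

end ConvolutionAlgebra

section Bifunctor

variable {k : Type u} [Field k]

variable (k) in
/-- A bifunctor from conilpotent `As^¡`-coalgebras (contravariant) and associative algebras, both
with their `∞`-morphisms, to shifted homotopy Lie algebras with their `∞`-morphisms, that is the
convolution algebra on objects. -/
structure ConvBifunctor where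
  map : ∀ {D' D : ShCog k} {A A' : DGAlg k}, InfCogHom D' D → InfAlgHom A A' →
    InfLieHom (homK D A) (homK D' A')
  map_id : ∀ (D : ShCog k) (A : DGAlg k),
    (map (ShCogHom.id D).toInf (DGAlgHom.id A).toInf).ψ = idFamily k (Hom D A)
  map_comp : ∀ {D'' D' D : ShCog k} {A A' A'' : DGAlg k} (Φ : InfCogHom D' D)
    (Φ' : InfCogHom D'' D') (Ψ : InfAlgHom A A') (Ψ' : InfAlgHom A' A''),
    (map (Φ.comp Φ') (Ψ'.comp Ψ)).ψ =
      Family.comp (hom_internal D A) (map Φ' Ψ').ψ (map Φ Ψ).ψ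

/-- The bifunctor restricts to `hom_ℓ` (`∞`-morphisms of coalgebras, morphisms of algebras). -/
def ConvBifunctor.RestrictsL (B : ConvBifunctor k) : Prop :=
  ∀ {D' D : ShCog k} {A A' : DGAlg k} (Φ : InfCogHom D' D) (ψ : DGAlgHom A A'),
    (B.map Φ ψ.toInf).ψ = homL Φ ψ

/-- The bifunctor restricts to `hom_r` (morphisms of coalgebras, `∞`-morphisms of algebras). -/
def ConvBifunctor.RestrictsR (B : ConvBifunctor k) : Prop :=
  ∀ {D' D : ShCog k} {A A' : DGAlg k} (φ : ShCogHom D' D) (Ψ : InfAlgHom A A'),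
    (B.map φ.toInf Ψ).ψ = homR φ Ψ

end Bifunctor

section Example

open TensorAlgebra

variable {k : Type u} [Field k]

/-- `V` has the basis `v₁, v₂, …` (with `vᵢ₊₁ = v i`), `|vᵢ| = i`, `d = 0` and
`Δ vₙ = ∑_{i + j = n - 1} (-1)^i vᵢ ⊗ vⱼ`. -/
structure IsV (V : ShCog k) (v : Module.Basis ℕ k V.carrier) : Prop where
  mem : ∀ i : ℕ, v i ∈ V.gr (i + 1)
  d_eq : V.d = 0
  Δ_zero : V.Δ (v 0) = 0
  Δ_one : V.Δ (v 1) = 0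
  Δ_add_two : ∀ n, V.Δ (v (n + 2)) =
    ∑ i ∈ Finset.range (n + 1), (-1 : ℤ) ^ (i + 1) • (v i ⊗ₜ[k] v (n - i))

/-- `Φ vₙ = ∑ v_{i₁} ⊗ ⋯ ⊗ v_{iₘ}`, over all compositions `n = i₁ + ⋯ + iₘ`. -/
def IsPhi {V : ShCog k} (v : Module.Basis ℕ k V.carrier) (Φ : InfCogHom V V) : Prop :=
  ∀ n, Φ.toAlg (ι k (v n)) =
    ∑ c : Composition (n + 1), (c.blocks.map fun i => ι k (v (i - 1))).prod

/-- `A` is the augmentation ideal of the free graded commutative algebra `k[x, y]` with `|x| = 0`,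
`|y| = 1`, `dy = x²`; the basis vectors are `inl i ↦ x^(i+1)` and `inr i ↦ x^i y`. -/
structure IsA2 (A : DGAlg k) (b : Module.Basis (ℕ ⊕ ℕ) k A.carrier) : Prop where
  x_mem : ∀ i, b (.inl i) ∈ A.gr 0
  y_mem : ∀ i, b (.inr i) ∈ A.gr 1
  x_mul_x : ∀ i j, b (.inl i) * b (.inl j) = b (.inl (i + j + 1))
  x_mul_y : ∀ i j, b (.inl i) * b (.inr j) = b (.inr (i + j + 1))
  y_mul_x : ∀ i j, b (.inr i) * b (.inl j) = b (.inr (i + j + 1))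
  y_mul_y : ∀ i j, b (.inr i) * b (.inr j) = 0
  d_x : ∀ i, A.d (b (.inl i)) = 0
  d_y : ∀ i, A.d (b (.inr i)) = b (.inl (i + 1))

/-- `H` is one-dimensional, spanned by `z` of degree zero, with `z² = 0` and `d = 0`. -/
structure IsH2 (H : DGAlg k) (z : Module.Basis Unit k H.carrier) : Prop where
  mem : z () ∈ H.gr 0
  mul_eq : z () * z () = 0
  d_eq : H.d = 0

/-- The components of `i_∞`: `z ↦ x`, `z ⊗ z ↦ y`, and zero on longer tensors. -/
structure IsIInf {H A : DGAlg k} (z : Module.Basis Unit k H.carrier)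
    (b : Module.Basis (ℕ ⊕ ℕ) k A.carrier) (Ψ : InfAlgHom H A) : Prop where
  one : ιInv (Ψ.toLin (ι k (z ()))) = b (.inl 0)
  two : ιInv (Ψ.toLin (ι k (z ()) ^ 2)) = b (.inr 0)
  many : ∀ n, 3 ≤ n → ιInv (Ψ.toLin (ι k (z ()) ^ n)) = 0

/-- The linear component of the `∞`-morphism induces a bijection (injective, surjective) on
homology. -/
def InfAlgHom.IsQuasiIso {A A' : DGAlg k} (Ψ : InfAlgHom A A') : Prop :=
  (∀ a, A.d a = 0 → (∃ b, A'.d b = ιInv (Ψ.toLin (ι k a))) → ∃ c, A.d c = a) ∧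
  ∀ a', A'.d a' = 0 → ∃ a b, A.d a = 0 ∧ a' = ιInv (Ψ.toLin (ι k a)) + A'.d b

end Example

end HomConv

/-!
The two actions of `∞`-morphisms on convolution algebras do not commute, and the failure is visible
in arity two. Both `hom_ℓ(Φ, 1) ∘ hom_r(1, i_∞)` and `hom_r(1, i_∞) ∘ hom_ℓ(Φ, 1)` have two terms
there, one for each partition of a set with two elements. As the linear part of `Φ` is the identity,
the terms that contain the binary component of `i_∞` are the same. The other terms compare the
product of `A²` with the one of `H²`: evaluated on `(f, f)` for `f` dual to `v₂` (of even degree, so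
that there are no signs) and on `v₄`, whose image under `Φ` contains `v₂ ⊗ v₂`, they are `2 x²` and
`2 i₁(z²) = 0`. See `homL_comp_homR_ne`.

A bifunctor that restricts to `hom_ℓ` and `hom_r` takes on `(Φ, i_∞)` the value of both composites
(`ConvBifunctor.homL_comp_homR`), and so there is none.

The remaining work is the construction of the objects.
* `V`, `A²` and `H²` are given by explicit bases, and graded by the degrees of the basis vectors.
  `A²` is modelled on pairs of polynomials, `(p, q)` standing for `x p + q y`.
* `Φ` sends `∑ vᵢ tⁱ` to `W - 1`, where `W = 1 / (1 - ∑ vᵢ tⁱ)` is a power series over the tensor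
  algebra. Compatibility with the cobar differential is the identity `cobarDiff_geomSeries` of such
  series; it holds as both sides solve the same fixed point equation.
* `i_∞` sends `zⁿ` to the sum `Pₙ` of all words of weight `n` in `x` (weight one) and `y` (weight
  two). These are divided powers for deconcatenation (`deconc_psiWord`) and cycles for the bar
  differential (`barDiff_psiWord`).
-/

namespace HomConv

/-! ### Gradings by the degree of basis vectors -/

section BasisGrading

variable {k : Type u} [Field k] {V : Type u} [AddCommGroup V] [Module k V] {I : Type*}

/-- The `ℤ`-grading of a vector space with basis `b` in which `b i` has degree `deg i`. -/
def basisGr (b : Module.Basis I k V) (deg : I → ℤ) (n : ℤ) : Submodule k V :=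
  Submodule.span k (b '' {i | deg i = n})

theorem basis_mem_basisGr (b : Module.Basis I k V) (deg : I → ℤ) (i : I) :
    b i ∈ basisGr b deg (deg i) :=
  Submodule.subset_span ⟨i, rfl, rfl⟩

theorem basisGr_internal (b : Module.Basis I k V) (deg : I → ℤ) :
    DirectSum.IsInternal (basisGr b deg) := by
  refine DirectSum.isInternal_submodule_of_iSupIndep_of_iSup_eq_top (fun n => ?_) ?_
  · refine (b.linearIndependent.disjoint_span_image (s := {i | deg i = n})
      (t := {i | deg i ≠ n}) ?_).mono_right ?_
    · exact Set.disjoint_left.2 fun i hi hi' => hi' hi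
    · refine iSup₂_le fun m hm => Submodule.span_mono (Set.image_mono ?_)
      rintro i rfl
      exact hm
  · rw [eq_top_iff, ← b.span_eq, Submodule.span_le]
    rintro _ ⟨i, rfl⟩
    exact Submodule.mem_iSup_of_mem (deg i) (basis_mem_basisGr b deg i)

/-- A linear condition on the elements of degree `n` has to be checked on basis vectors only. -/
theorem basisGr_induction {W : Type*} [AddCommGroup W] [Module k W] (b : Module.Basis I k V)
    (deg : I → ℤ) (f : V →ₗ[k] W) (P : Submodule k W) {n : ℤ} (h : ∀ i, deg i = n → f (b i) ∈ P)
    {v : V} (hv : v ∈ basisGr b deg n) : f v ∈ P := by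
  refine (Submodule.span_le (p := P.comap f)).2 ?_ hv
  rintro _ ⟨i, hi, rfl⟩
  exact h i hi

theorem parity_basis (b : Module.Basis I k V) (deg : I → ℤ) (i : I) :
    parity (basisGr_internal b deg) (b i) = koszul (deg i) 1 • b i :=
  parity_of_mem _ (basis_mem_basisGr b deg i)

theorem koszul_natCast_one (n : ℕ) : koszul ((n : ℤ) : ZMod 2) 1 = (-1) ^ n := by
  rw [Int.cast_natCast]
  rcases Nat.even_or_odd n with h | h
  · rw [h.neg_one_pow, (ZMod.natCast_eq_zero_iff_even).2 h, koszul_zero_left]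
  · rw [h.neg_one_pow, (ZMod.natCast_eq_one_iff_odd).2 h, koszul_one]

end BasisGrading

/-! ### The one-dimensional algebra with zero multiplication -/

section TrivialAlgebra

variable (k : Type u) [Field k]

/-- The field `k`, considered as a vector space, with zero multiplication. -/
def ZeroMulAlg : Type u := k

namespace ZeroMulAlg

noncomputable instance : AddCommGroup (ZeroMulAlg k) := inferInstanceAs (AddCommGroup k)

noncomputable instance : Module k (ZeroMulAlg k) := inferInstanceAs (Module k k)

noncomputable instance : NonUnitalRing (ZeroMulAlg k) where
  mul _ _ := 0
  left_distrib _ _ _ := (add_zero (0 : ZeroMulAlg k)).symm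
  right_distrib _ _ _ := (add_zero (0 : ZeroMulAlg k)).symm
  zero_mul _ := rfl
  mul_zero _ := rfl
  mul_assoc _ _ _ := rfl

variable {k} in
theorem mul_eq_zero (a b : ZeroMulAlg k) : a * b = 0 := rfl

instance : IsScalarTower k (ZeroMulAlg k) (ZeroMulAlg k) :=
  ⟨fun c _ _ => (smul_zero (A := ZeroMulAlg k) c).symm⟩

instance : SMulCommClass k (ZeroMulAlg k) (ZeroMulAlg k) :=
  ⟨fun c _ _ => smul_zero (A := ZeroMulAlg k) c⟩

/-- The basis vector `z` is the unit of `k`. -/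
noncomputable def basis : Module.Basis Unit k (ZeroMulAlg k) := Module.Basis.singleton Unit k

end ZeroMulAlg

/-- The algebra `H²`, concentrated in degree zero. -/
noncomputable def algH : DGAlg k where
  carrier := ZeroMulAlg k
  gr := basisGr (ZeroMulAlg.basis k) fun _ => 0
  internal := basisGr_internal _ _
  mul_mem _ _ := zero_mem _
  d := 0
  d_mem _ := zero_mem _
  d_d _ := rfl
  leibniz _ _ := by simp [ZeroMulAlg.mul_eq_zero]

theorem isH2_algH : IsH2 (algH k) (ZeroMulAlg.basis k) where
  mem := basis_mem_basisGr (ZeroMulAlg.basis k) (fun _ => 0) ()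
  mul_eq := rfl
  d_eq := rfl

end TrivialAlgebra

/-! ### The Koszul algebra -/

section KoszulAlgebra

open Polynomial

variable (k : Type u) [Field k]

theorem basisMonomials_eq_X_pow (i : ℕ) : Polynomial.basisMonomials k i = X ^ i := by
  rw [coe_basisMonomials]
  exact monomial_one_right_eq_X_pow i

/-- The augmentation ideal of `k[x, y]` with `|x| = 0`, `|y| = 1`: the pair `(p, q)` of polynomials
stands for `x p(x) + q(x) y`. -/
def KoszulAlg : Type u := k[X] × k[X]

namespace KoszulAlg

noncomputable instance : AddCommGroup (KoszulAlg k) := inferInstanceAs (AddCommGroup (k[X] × k[X]))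

noncomputable instance : Module k (KoszulAlg k) := inferInstanceAs (Module k (k[X] × k[X]))

variable {k}

/-- The element `x p(x) + q(x) y`. -/
def mk (p q : k[X]) : KoszulAlg k := (p, q)

theorem mk_surjective (a : KoszulAlg k) : ∃ p q, a = mk p q := ⟨a.1, a.2, rfl⟩

theorem mk_inj {p q p' q' : k[X]} : mk p q = mk p' q' ↔ p = p' ∧ q = q' := Prod.mk_inj

theorem mk_add (p q p' q' : k[X]) : mk p q + mk p' q' = mk (p + p') (q + q') := rfl

theorem smul_mk (c : k) (p q : k[X]) : c • mk p q = mk (c • p) (c • q) := rfl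

theorem mk_zero : mk (0 : k[X]) 0 = 0 := rfl

noncomputable instance : Mul (KoszulAlg k) :=
  ⟨fun a b => mk (X * a.1 * b.1) (X * (a.1 * b.2 + a.2 * b.1))⟩

theorem mk_mul (p q p' q' : k[X]) :
    mk p q * mk p' q' = mk (X * p * p') (X * (p * q' + q * p')) := rfl

noncomputable instance : NonUnitalRing (KoszulAlg k) where
  left_distrib := by
    rintro ⟨p, q⟩ ⟨p', q'⟩ ⟨p'', q''⟩
    refine Prod.ext ?_ ?_
    · change X * p * (p' + p'') = X * p * p' + X * p * p''
      ring
    · change X * (p * (q' + q'') + q * (p' + p'')) = X * (p * q' + q * p') + X * (p * q'' + q * p'')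
      ring
  right_distrib := by
    rintro ⟨p, q⟩ ⟨p', q'⟩ ⟨p'', q''⟩
    refine Prod.ext ?_ ?_
    · change X * (p + p') * p'' = X * p * p'' + X * p' * p''
      ring
    · change X * ((p + p') * q'' + (q + q') * p'') =
        X * (p * q'' + q * p'') + X * (p' * q'' + q' * p'')
      ring
  zero_mul := by
    rintro ⟨p, q⟩
    refine Prod.ext ?_ ?_
    · change X * 0 * p = 0
      ring
    · change X * (0 * q + 0 * p) = 0
      ring
  mul_zero := by
    rintro ⟨p, q⟩
    refine Prod.ext ?_ ?_
    · change X * p * 0 = 0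
      ring
    · change X * (p * 0 + q * 0) = 0
      ring
  mul_assoc := by
    rintro ⟨p, q⟩ ⟨p', q'⟩ ⟨p'', q''⟩
    refine Prod.ext ?_ ?_
    · change X * (X * p * p') * p'' = X * p * (X * p' * p'')
      ring
    · change X * (X * p * p' * q'' + X * (p * q' + q * p') * p'') =
        X * (p * (X * (p' * q'' + q' * p'')) + q * (X * p' * p''))
      ring

instance : IsScalarTower k (KoszulAlg k) (KoszulAlg k) := by
  refine ⟨fun c a b => ?_⟩
  obtain ⟨p, q, rfl⟩ := mk_surjective a
  obtain ⟨p', q', rfl⟩ := mk_surjective b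
  simp only [smul_eq_mul, smul_mk, mk_mul, mk_inj, Polynomial.smul_eq_C_mul]
  constructor <;> ring

instance : SMulCommClass k (KoszulAlg k) (KoszulAlg k) := by
  refine ⟨fun c a b => ?_⟩
  obtain ⟨p, q, rfl⟩ := mk_surjective a
  obtain ⟨p', q', rfl⟩ := mk_surjective b
  simp only [smul_eq_mul, smul_mk, mk_mul, mk_inj, Polynomial.smul_eq_C_mul]
  constructor <;> ring

variable (k)

/-- The basis of the monomials `x^(i+1)` and `x^i y`. -/
noncomputable def basis : Module.Basis (ℕ ⊕ ℕ) k (KoszulAlg k) :=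
  (Polynomial.basisMonomials k).prod (Polynomial.basisMonomials k)

variable {k}

theorem basis_inl (i : ℕ) : basis k (.inl i) = mk (X ^ i) 0 := by
  refine Prod.ext ?_ ?_
  · exact (Module.Basis.prod_apply_inl_fst _ _ _).trans (basisMonomials_eq_X_pow k i)
  · exact Module.Basis.prod_apply_inl_snd _ _ _

theorem basis_inr (i : ℕ) : basis k (.inr i) = mk 0 (X ^ i) := by
  refine Prod.ext ?_ ?_
  · exact Module.Basis.prod_apply_inr_fst _ _ _
  · exact (Module.Basis.prod_apply_inr_snd _ _ _).trans (basisMonomials_eq_X_pow k i)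

theorem inl_mul_inl (i j : ℕ) :
    basis k (.inl i) * basis k (.inl j) = basis k (.inl (i + j + 1)) := by
  simp only [basis_inl, mk_mul, mk_inj]
  exact ⟨by ring, by ring⟩

theorem inl_mul_inr (i j : ℕ) :
    basis k (.inl i) * basis k (.inr j) = basis k (.inr (i + j + 1)) := by
  simp only [basis_inl, basis_inr, mk_mul, mk_inj]
  exact ⟨by ring, by ring⟩

theorem inr_mul_inl (i j : ℕ) :
    basis k (.inr i) * basis k (.inl j) = basis k (.inr (i + j + 1)) := by
  simp only [basis_inl, basis_inr, mk_mul, mk_inj]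
  exact ⟨by ring, by ring⟩

theorem inr_mul_inr (i j : ℕ) :
    basis k (.inr i) * basis k (.inr j) = 0 := by
  simp only [basis_inr, mk_mul, ← mk_zero, mk_inj]
  exact ⟨by ring, by ring⟩

/-- The degrees of the basis vectors. -/
def deg : ℕ ⊕ ℕ → ℤ := Sum.elim (fun _ => 0) (fun _ => 1)

variable (k) in
/-- The differential `x p + q y ↦ x² q`. -/
noncomputable def diff : KoszulAlg k →ₗ[k] KoszulAlg k where
  toFun a := mk (X * a.2) 0
  map_add' := by
    rintro ⟨p, q⟩ ⟨p', q'⟩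
    refine Prod.ext ?_ (add_zero (0 : k[X])).symm
    exact mul_add X q q'
  map_smul' := by
    rintro c ⟨p, q⟩
    refine Prod.ext ?_ (smul_zero c).symm
    exact mul_smul_comm c X q

theorem diff_mk (p q : k[X]) : diff k (mk p q) = mk (X * q) 0 := rfl

theorem diff_inl (i : ℕ) : diff k (basis k (.inl i)) = 0 := by
  rw [basis_inl, diff_mk, mul_zero, mk_zero]

theorem diff_inr (i : ℕ) : diff k (basis k (.inr i)) = basis k (.inl (i + 1)) := by
  rw [basis_inl, basis_inr, diff_mk, pow_succ']

theorem parity_mk (p q : k[X]) : parity (basisGr_internal (basis k) deg) (mk p q) = mk p (-q) := by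
  -- The sign operator is computed on the basis, where it has to agree with `L`.
  let L : KoszulAlg k →ₗ[k] KoszulAlg k :=
    LinearMap.prodMap (LinearMap.id (M := k[X])) (-(LinearMap.id (M := k[X])))
  have h : parity (basisGr_internal (basis k) deg) = L := by
    refine (basis k).ext ?_
    rintro (i | i)
    · rw [parity_basis, basis_inl]
      simp only [deg, Sum.elim_inl, Int.cast_zero, koszul_zero_left, one_smul]
      exact Prod.ext rfl neg_zero.symm
    · rw [parity_basis, basis_inr]
      simp only [deg, Sum.elim_inr, Int.cast_one, koszul_one, neg_smul, one_smul]
      exact Prod.ext neg_zero rfl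
  rw [h]
  rfl

end KoszulAlg

open KoszulAlg in
/-- The dg algebra `A²`. -/
noncomputable def algA : DGAlg k where
  carrier := KoszulAlg k
  gr := basisGr (KoszulAlg.basis k) KoszulAlg.deg
  internal := basisGr_internal _ _
  mul_mem {i j a c} ha hc := by
    refine basisGr_induction _ _ (LinearMap.mulRight k c) _ (fun s hs => ?_) ha
    refine basisGr_induction _ _ (LinearMap.mulLeft k (KoszulAlg.basis k s)) _ (fun t ht => ?_) hc
    subst hs ht
    rw [LinearMap.mulLeft_apply]
    rcases s with s | s <;> rcases t with t | t
    · rw [inl_mul_inl]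
      exact basis_mem_basisGr (KoszulAlg.basis k) KoszulAlg.deg (.inl (s + t + 1))
    · rw [inl_mul_inr]
      exact basis_mem_basisGr (KoszulAlg.basis k) KoszulAlg.deg (.inr (s + t + 1))
    · rw [inr_mul_inl]
      exact basis_mem_basisGr (KoszulAlg.basis k) KoszulAlg.deg (.inr (s + t + 1))
    · rw [inr_mul_inr]
      exact zero_mem _
  d := KoszulAlg.diff k
  d_mem {i a} ha := by
    refine basisGr_induction _ _ (KoszulAlg.diff k) _ (fun s hs => ?_) ha
    subst hs
    rcases s with s | s
    · rw [diff_inl]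
      exact zero_mem _
    · rw [diff_inr]
      exact basis_mem_basisGr (KoszulAlg.basis k) KoszulAlg.deg (.inl (s + 1))
  d_d a := by
    obtain ⟨p, q, rfl⟩ := mk_surjective a
    simp [diff_mk, mk_zero]
  leibniz a c := by
    obtain ⟨p, q, rfl⟩ := mk_surjective a
    obtain ⟨p', q', rfl⟩ := mk_surjective c
    simp only [parity_mk, diff_mk, mk_mul, mk_add, mk_inj]
    exact ⟨by ring, by ring⟩

open KoszulAlg in
theorem isA2_algA : IsA2 (algA k) (KoszulAlg.basis k) where
  x_mem i := basis_mem_basisGr (KoszulAlg.basis k) KoszulAlg.deg (.inl i)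
  y_mem i := basis_mem_basisGr (KoszulAlg.basis k) KoszulAlg.deg (.inr i)
  x_mul_x := inl_mul_inl
  x_mul_y := inl_mul_inr
  y_mul_x := inr_mul_inl
  y_mul_y := inr_mul_inr
  d_x := diff_inl
  d_y := diff_inr

end KoszulAlgebra

/-! ### The coalgebra -/

section Coalgebra

open Finset.HasAntidiagonal (antidiagonal)

variable (k : Type u) [Field k]

/-- The vector space underlying `V`. -/
def SpaceV : Type u := ℕ →₀ k

noncomputable instance : AddCommGroup (SpaceV k) := inferInstanceAs (AddCommGroup (ℕ →₀ k))

noncomputable instance : Module k (SpaceV k) := inferInstanceAs (Module k (ℕ →₀ k))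

/-- The basis of `V`; the vector with index `i` is the one denoted by `vᵢ₊₁`. -/
noncomputable def basisV : Module.Basis ℕ k (SpaceV k) :=
  Finsupp.basisSingleOne (R := k) (ι := ℕ)

/-- The values of the decomposition map of `V` on the basis. -/
noncomputable def deltaV : ℕ → (SpaceV k) ⊗[k] (SpaceV k)
  | 0 => 0
  | 1 => 0
  | n + 2 => ∑ p ∈ antidiagonal n,
      (-1 : ℤ) ^ (p.1 + 1) • (basisV k p.1 ⊗ₜ[k] basisV k p.2)

/-- The degree of a basis vector of `V`. -/
def degV (i : ℕ) : ℤ := i + 1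

variable {k} in
theorem parity_basisV (i : ℕ) : parity (basisGr_internal (basisV k) degV) (basisV k i) =
    (-1 : ℤ) ^ (i + 1) • basisV k i := by
  rw [parity_basis, show degV i = ((i + 1 : ℕ) : ℤ) by simp [degV], koszul_natCast_one]

/-- The two ways to sum over all triples with sum `n`. -/
theorem sum_antidiagonal_assoc {M : Type*} [AddCommMonoid M] (f : ℕ → ℕ → ℕ → M) (n : ℕ) :
    ∑ p ∈ antidiagonal n, ∑ q ∈ antidiagonal p.1, f q.1 q.2 p.2 =
      ∑ p ∈ antidiagonal n, ∑ q ∈ antidiagonal p.2, f p.1 q.1 q.2 := by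
  simp only [Finset.sum_sigma']
  refine Finset.sum_nbij' (fun ⟨⟨_i, j⟩, ⟨a, b⟩⟩ => ⟨(a, b + j), (b, j)⟩)
    (fun ⟨⟨i, _j⟩, ⟨a, b⟩⟩ => ⟨(i + a, b), (i, a)⟩) ?_ ?_ ?_ ?_ ?_
  · rintro ⟨⟨i, j⟩, ⟨a, b⟩⟩ h
    simp at h ⊢
    omega
  · rintro ⟨⟨i, j⟩, ⟨a, b⟩⟩ h
    simp at h ⊢
    omega
  · rintro ⟨⟨i, j⟩, ⟨a, b⟩⟩ h
    simp at h ⊢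
    omega
  · rintro ⟨⟨i, j⟩, ⟨a, b⟩⟩ h
    simp at h ⊢
    omega
  · rintro ⟨⟨i, j⟩, ⟨a, b⟩⟩ h
    rfl

theorem deltaV_zero : deltaV k 0 = 0 := rfl

theorem deltaV_one : deltaV k 1 = 0 := rfl

theorem deltaV_add_two (n : ℕ) : deltaV k (n + 2) = ∑ p ∈ antidiagonal n,
      (-1 : ℤ) ^ (p.1 + 1) • (basisV k p.1 ⊗ₜ[k] basisV k p.2) := rfl

/-- After the signs have been collected, both terms are sums of `vₐ ⊗ v_b ⊗ v_c` over the same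
triples, with the signs `(-1)^b` and `-(-1)^b` (for the indices of `basisV`). -/
theorem coassoc_deltaV (n : ℕ) :
    TensorProduct.assoc k _ _ _ (TensorProduct.map ((basisV k).constr ℕ (deltaV k)) LinearMap.id
      (deltaV k n)) +
    TensorProduct.map (parity (basisGr_internal (basisV k) degV))
      ((basisV k).constr ℕ (deltaV k)) (deltaV k n) = 0 := by
  have hT : ∀ (c : ℤ) (i j : ℕ), TensorProduct.assoc k _ _ _
      (TensorProduct.map ((basisV k).constr ℕ (deltaV k)) LinearMap.id
        (c • (basisV k i ⊗ₜ[k] basisV k j))) =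
      c • TensorProduct.assoc k _ _ _ (deltaV k i ⊗ₜ[k] basisV k j) := by
    intro c i j
    rw [← Int.cast_smul_eq_zsmul k, map_smul, map_smul, TensorProduct.map_tmul,
      Module.Basis.constr_basis, LinearMap.id_apply, Int.cast_smul_eq_zsmul]
  have hS : ∀ (c c' : ℤ) (i j l : ℕ), c • TensorProduct.assoc k _ _ _
      ((c' • (basisV k i ⊗ₜ[k] basisV k j)) ⊗ₜ[k] basisV k l) =
      (c * c') • (basisV k i ⊗ₜ[k] (basisV k j ⊗ₜ[k] basisV k l)) := by
    intro c c' i j l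
    rw [← Int.cast_smul_eq_zsmul k c', ← TensorProduct.smul_tmul', map_smul,
      TensorProduct.assoc_tmul, Int.cast_smul_eq_zsmul, smul_smul]
  have hR : ∀ (c : ℤ) (i j l : ℕ), basisV k i ⊗ₜ[k] (c • (basisV k j ⊗ₜ[k] basisV k l)) =
      c • (basisV k i ⊗ₜ[k] (basisV k j ⊗ₜ[k] basisV k l)) := by
    intro c i j l
    rw [← Int.cast_smul_eq_zsmul k c, TensorProduct.tmul_smul, Int.cast_smul_eq_zsmul]
  rcases n with _ | _ | n
  · simp [deltaV_zero]
  · simp [deltaV_one]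
  have e1 : TensorProduct.assoc k _ _ _ (TensorProduct.map ((basisV k).constr ℕ (deltaV k))
      LinearMap.id (deltaV k (n + 2))) = ∑ p ∈ antidiagonal n, (-1 : ℤ) ^ (p.1 + 1) •
        TensorProduct.assoc k _ _ _ (deltaV k p.1 ⊗ₜ[k] basisV k p.2) := by
    simp only [deltaV_add_two, map_sum, hT]
  have e2 : TensorProduct.map (parity (basisGr_internal (basisV k) degV))
      ((basisV k).constr ℕ (deltaV k)) (deltaV k (n + 2)) = ∑ p ∈ antidiagonal n,
        basisV k p.1 ⊗ₜ[k] deltaV k p.2 := by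
    simp only [deltaV_add_two, map_sum, map_zsmul, TensorProduct.map_tmul,
      Module.Basis.constr_basis]
    refine Finset.sum_congr rfl fun p _ => ?_
    rw [parity_basisV, ← TensorProduct.smul_tmul', smul_smul, ← mul_pow]
    simp
  rw [e1, e2]
  -- The decomposition map vanishes on the first two basis vectors, so that the indices shift.
  rcases n with _ | _ | n
  · simp [deltaV_zero]
  · simp [deltaV_zero, deltaV_one, Finset.Nat.antidiagonal_succ]
  rw [Finset.Nat.sum_antidiagonal_succ, Finset.Nat.sum_antidiagonal_succ,
    Finset.Nat.sum_antidiagonal_succ', Finset.Nat.sum_antidiagonal_succ']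
  simp only [deltaV_zero, deltaV_one, TensorProduct.zero_tmul, TensorProduct.tmul_zero, zero_add,
    map_zero, smul_zero, add_assoc, Nat.reduceAdd]
  have e3 := sum_antidiagonal_assoc (fun a b c => (-1 : ℤ) ^ b •
    (basisV k a ⊗ₜ[k] (basisV k b ⊗ₜ[k] basisV k c))) n
  simp only [deltaV_add_two, TensorProduct.sum_tmul, TensorProduct.tmul_sum, map_sum,
    Finset.smul_sum, hS, hR]
  rw [← eq_neg_iff_add_eq_zero]
  simp only [← Finset.sum_neg_distrib, ← neg_smul]
  have e4 : ∀ b, -(-1 : ℤ) ^ (b + 1) = (-1) ^ b := fun b => by rw [pow_succ]; ring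
  simp only [e4, ← e3]
  refine Finset.sum_congr rfl fun p _ => Finset.sum_congr rfl fun q hq => ?_
  congr 1
  rw [← Finset.HasAntidiagonal.mem_antidiagonal.1 hq, ← pow_add]
  rw [show q.1 + q.2 + 3 + (q.1 + 1) = 2 * (q.1 + 2) + q.2 by ring, pow_add, pow_mul]
  simp

/-- The filtration that shows that `V` is conilpotent. -/
noncomputable def filV (n : ℕ) : Submodule k (SpaceV k) := Submodule.span k (basisV k '' {i | i < n})

variable {k} in
theorem basisV_mem_filV {i n : ℕ} (h : i < n) : basisV k i ∈ filV k n :=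
  Submodule.subset_span ⟨i, h, rfl⟩

/-- The coalgebra `V`, with zero differential. -/
noncomputable def cogV : ShCog k where
  carrier := SpaceV k
  gr := basisGr (basisV k) degV
  internal := basisGr_internal _ _
  d := 0
  d_mem _ := zero_mem _
  Δ := (basisV k).constr ℕ (deltaV k)
  Δ_mem {n x} hx := by
    refine basisGr_induction _ _ ((basisV k).constr ℕ (deltaV k)) _ (fun i hi => ?_) hx
    rw [Module.Basis.constr_basis]
    subst hi
    rcases i with _ | _ | i
    · exact zero_mem _
    · exact zero_mem _
    refine sum_mem fun p hp => zsmul_mem ?_ _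
    refine Submodule.subset_span ⟨degV p.1, degV p.2, _, _,
      basis_mem_basisGr _ _ _, basis_mem_basisGr _ _ _, ?_, rfl⟩
    have := Finset.HasAntidiagonal.mem_antidiagonal.1 hp
    simp only [degV]
    omega
  d_d _ := rfl
  leibniz := by ext; simp
  coassoc := by
    refine (basisV k).ext fun n => ?_
    simp only [LinearMap.add_apply, LinearMap.comp_apply, Module.Basis.constr_basis,
      LinearEquiv.coe_coe, LinearMap.zero_apply]
    exact coassoc_deltaV k n
  conilpotent := by
    refine ⟨filV k, ?_, ?_, ?_, ?_⟩
    · simp [filV]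
    · exact fun m n h => Submodule.span_mono (Set.image_mono fun i hi => lt_of_lt_of_le hi h)
    · have hmono : Monotone (filV k) :=
        fun m n h => Submodule.span_mono (Set.image_mono fun i hi => lt_of_lt_of_le hi h)
      intro x
      have hx : x ∈ Submodule.span k (Set.range (basisV k)) := by
        rw [(basisV k).span_eq]
        trivial
      induction hx using Submodule.span_induction with
      | mem y hy =>
        obtain ⟨i, rfl⟩ := hy
        exact ⟨i + 1, basisV_mem_filV (Nat.lt_succ_self i)⟩
      | zero => exact ⟨0, zero_mem _⟩
      | add y z _ _ hy hz =>
        obtain ⟨m, hm⟩ := hy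
        obtain ⟨n, hn⟩ := hz
        exact ⟨max m n, add_mem (hmono (le_max_left m n) hm) (hmono (le_max_right m n) hn)⟩
      | smul c y _ hy =>
        obtain ⟨m, hm⟩ := hy
        exact ⟨m, Submodule.smul_mem _ c hm⟩
    · intro n x hx
      refine (Submodule.span_le (p := (LinearMap.range (TensorProduct.map (filV k n).subtype
        (filV k n).subtype)).comap ((basisV k).constr ℕ (deltaV k)))).2 ?_ hx
      rintro _ ⟨i, hi, rfl⟩
      rw [SetLike.mem_coe, Submodule.mem_comap, Module.Basis.constr_basis]
      rcases i with _ | _ | i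
      · exact zero_mem _
      · exact zero_mem _
      refine sum_mem fun p hp => zsmul_mem ?_ _
      have hp' := Finset.HasAntidiagonal.mem_antidiagonal.1 hp
      have hi' : i + 2 < n + 1 := hi
      exact ⟨⟨basisV k p.1, basisV_mem_filV (by omega)⟩ ⊗ₜ
        ⟨basisV k p.2, basisV_mem_filV (by omega)⟩, rfl⟩

/-- The basis of `V`, as a basis of the underlying space of `cogV`. -/
noncomputable def cogBasis : Module.Basis ℕ k (cogV k).carrier := basisV k

theorem cogV_Δ_basis (n : ℕ) : (cogV k).Δ (cogBasis k n) = deltaV k n :=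
  Module.Basis.constr_basis (basisV k) ℕ (deltaV k) n

theorem cogV_Δ_basis_add_two (n : ℕ) : (cogV k).Δ (cogBasis k (n + 2)) =
    ∑ p ∈ antidiagonal n, (-1 : ℤ) ^ (p.1 + 1) • (cogBasis k p.1 ⊗ₜ[k] cogBasis k p.2) :=
  cogV_Δ_basis k (n + 2)

theorem isV_cogV : IsV (cogV k) (cogBasis k) where
  mem i := basis_mem_basisGr (basisV k) degV i
  d_eq := rfl
  Δ_zero := cogV_Δ_basis k 0
  Δ_one := cogV_Δ_basis k 1
  Δ_add_two n := (cogV_Δ_basis_add_two k n).trans <|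
    Finset.Nat.sum_antidiagonal_eq_sum_range_succ
      (fun i j => (-1 : ℤ) ^ (i + 1) • (cogBasis k i ⊗ₜ[k] cogBasis k j)) n

end Coalgebra

/-! ### Sums over compositions -/

section Compositions

open Finset.HasAntidiagonal (antidiagonal)

variable {R : Type*}

/-- The sum of `a i₁ ⋯ a iₘ` over all compositions `i₁ + ⋯ + iₘ = n`. -/
def compSum [Semiring R] (a : ℕ → R) (n : ℕ) : R :=
  ∑ c : Composition n, (c.blocks.map a).prod

theorem compSum_zero [Semiring R] (a : ℕ → R) : compSum a 0 = 1 := by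
  have h : ∀ c : Composition 0, c.blocks = [] := fun c => c.blocks_eq_nil.2 rfl
  have hc : Fintype.card (Composition 0) = 1 := composition_card 0
  simp [compSum, h, hc]

/-- Splitting off the first block of a composition. -/
theorem compSum_succ [Semiring R] (a : ℕ → R) (n : ℕ) :
    compSum a (n + 1) = ∑ p ∈ antidiagonal n, a (p.1 + 1) * compSum a p.2 := by
  simp only [compSum, Finset.mul_sum, Finset.sum_sigma']
  symm
  refine Finset.sum_bij (fun s hs => (⟨(s.1.1 + 1) :: s.2.blocks, ?_, ?_⟩ : Composition (n + 1)))
    ?_ ?_ ?_ ?_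
  · intro i hi
    rcases List.mem_cons.1 hi with rfl | hi
    · exact Nat.succ_pos _
    · exact s.2.blocks_pos hi
  · have := Finset.HasAntidiagonal.mem_antidiagonal.1 (Finset.mem_sigma.1 hs).1
    rw [List.sum_cons, s.2.blocks_sum]
    omega
  · intro _ _
    exact Finset.mem_univ _
  · rintro ⟨⟨i, j⟩, c⟩ hs ⟨⟨i', j'⟩, c'⟩ hs' h
    have h1 := Finset.HasAntidiagonal.mem_antidiagonal.1 (Finset.mem_sigma.1 hs).1
    have h2 := Finset.HasAntidiagonal.mem_antidiagonal.1 (Finset.mem_sigma.1 hs').1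
    simp only [Composition.mk.injEq, List.cons.injEq, add_left_inj] at h h1 h2
    obtain ⟨rfl, h⟩ := h
    obtain rfl : j = j' := by omega
    rw [Composition.ext h]
  · rintro ⟨_ | ⟨i, l⟩, hp, hs⟩ -
    · simp at hs
    · have hi : 0 < i := hp (by simp)
      have hs' : i + l.sum = n + 1 := by simpa using hs
      refine ⟨⟨(i - 1, l.sum), ⟨l, fun hj => hp (by simp [hj]), rfl⟩⟩, ?_, ?_⟩
      · simp only [Finset.mem_sigma, Finset.HasAntidiagonal.mem_antidiagonal, Finset.mem_univ,
          and_true]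
        omega
      · refine Composition.ext ?_
        simp only [List.cons.injEq, and_true]
        omega
  · intro s hs
    simp

end Compositions

/-! ### The derivation of the tensor algebra -/

section Derivation

variable {k : Type u} [Field k] {V : Type u} [AddCommGroup V] [Module k V]

/-- The twisted Leibniz rule. -/
theorem tensorDer_mul (e : V →ₗ[k] V) (θ : V →ₗ[k] TensorAlgebra k V) (s t : TensorAlgebra k V) :
    tensorDer e θ (s * t) = tensorDer e θ s * t + tensorMap e s * tensorDer e θ t := by
  induction s using tensor_induction with
  | h1 => simp [tensorDer_one]
  | hι v s ih =>
    rw [mul_assoc, tensorDer_ι_mul, ih, tensorDer_ι_mul, _root_.map_mul, tensorMap_ι]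
    simp only [mul_add, add_mul, mul_assoc, add_assoc]
  | hadd s s' hs hs' =>
    simp only [add_mul, map_add, hs, hs']
    abel
  | hsmul c s hs => simp [hs]

theorem tensorDer_ι (e : V →ₗ[k] V) (θ : V →ₗ[k] TensorAlgebra k V) (v : V) :
    tensorDer e θ (TensorAlgebra.ι k v) = θ v := by
  simpa [tensorDer_one] using tensorDer_ι_mul e θ v 1

/-- An algebra map that preserves the degrees of the generators preserves all degrees. -/
theorem algHom_mem_tensorDeg {W : Type u} [AddCommGroup W] [Module k W] {gr : ℤ → Submodule k V}
    {gr' : ℤ → Submodule k W} (F : TensorAlgebra k V →ₐ[k] TensorAlgebra k W)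
    (hF : ∀ {i : ℤ} {v : V}, v ∈ gr i → F (TensorAlgebra.ι k v) ∈ tensorDeg gr' i) {n : ℤ}
    {t : TensorAlgebra k V} (ht : t ∈ tensorDeg gr n) : F t ∈ tensorDeg gr' n := by
  refine (Submodule.span_le (p := (tensorDeg gr' n).comap F.toLinearMap)).2 ?_ ht
  rintro _ ⟨m, q, x, hx, rfl, rfl⟩
  rw [SetLike.mem_coe, Submodule.mem_comap, AlgHom.toLinearMap_apply, TensorAlgebra.tprod_apply]
  clear ht
  induction m with
  | zero => exact Submodule.subset_span ⟨0, ![], ![], by simp, by simp, by simp⟩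
  | succ m ih =>
    rw [List.ofFn_succ, List.prod_cons, _root_.map_mul, Fin.sum_univ_succ]
    exact mul_mem_tensorDeg (hF (hx 0)) (ih _ _ fun i => hx i.succ)

end Derivation

/-! ### The `∞`-morphism of coalgebras -/

section Phi

open TensorAlgebra
open Finset.HasAntidiagonal (antidiagonal)

/-- The equation determines the coefficients of a solution one after the other. -/
theorem powerSeries_fixedPoint_unique {R : Type*} [Ring R] {A B C Q : PowerSeries R}
    (hA : A = C - PowerSeries.X * (Q * A)) (hB : B = C - PowerSeries.X * (Q * B)) : A = B := by
  ext n
  induction n using Nat.strong_induction_on with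
  | _ n ih =>
    rw [hA, hB, map_sub, map_sub]
    rcases n with _ | n
    · simp
    · rw [PowerSeries.coeff_succ_X_mul, PowerSeries.coeff_succ_X_mul, PowerSeries.coeff_mul,
        PowerSeries.coeff_mul]
      congr 1
      refine Finset.sum_congr rfl fun p hp => ?_
      rw [ih p.2 (by have := Finset.HasAntidiagonal.mem_antidiagonal.1 hp; omega)]

variable {k : Type u} [Field k] {V : ShCog k} (v : Module.Basis ℕ k V.carrier)

/-- The coefficients of the series `1 / (1 - ∑ vᵢ tⁱ)`, `i ≥ 1`, over the tensor algebra of `V`. -/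
noncomputable def geomCoeff (n : ℕ) : TensorAlgebra k V.carrier :=
  compSum (fun i => ι k (v (i - 1))) n

theorem geomCoeff_zero : geomCoeff v 0 = 1 := compSum_zero _

theorem geomCoeff_succ (n : ℕ) :
    geomCoeff v (n + 1) = ∑ p ∈ antidiagonal n, ι k (v p.1) * geomCoeff v p.2 :=
  compSum_succ _ _

/-- The value `vₙ ↦ ∑ v_{i₁} ⊗ ⋯ ⊗ v_{iₘ}`, extended to the tensor algebra. -/
noncomputable def phiAlg : TensorAlgebra k V.carrier →ₐ[k] TensorAlgebra k V.carrier :=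
  TensorAlgebra.lift k (v.constr ℕ fun n => geomCoeff v (n + 1))

theorem phiAlg_ι (n : ℕ) : phiAlg v (ι k (v n)) = geomCoeff v (n + 1) := by
  rw [phiAlg, TensorAlgebra.lift_ι_apply, Module.Basis.constr_basis]

/-- The sign operator acts on `geomCoeff v n`, which has degree `n`, by `(-1)^n`. -/
theorem tensorMap_geomCoeff {e : V.carrier →ₗ[k] V.carrier}
    (he : ∀ i, e (v i) = (-1 : ℤ) ^ (i + 1) • v i) (n : ℕ) :
    tensorMap e (geomCoeff v n) = (-1 : ℤ) ^ n • geomCoeff v n := by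
  induction n using Nat.strong_induction_on with
  | _ n ih =>
    rcases n with _ | n
    · simp [geomCoeff_zero]
    · simp only [geomCoeff_succ, map_sum, _root_.map_mul, tensorMap_ι, Finset.smul_sum]
      refine Finset.sum_congr rfl fun p hp => ?_
      have hp' := Finset.HasAntidiagonal.mem_antidiagonal.1 hp
      rw [ih p.2 (by omega), he, map_zsmul, smul_mul_smul_comm, ← pow_add]
      congr 2
      omega

theorem geomCoeff_mem {gr : ℤ → Submodule k V.carrier} (hv : ∀ i : ℕ, v i ∈ gr (i + 1)) (n : ℕ) :
    geomCoeff v n ∈ tensorDeg gr n := by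
  induction n using Nat.strong_induction_on with
  | _ n ih =>
    rcases n with _ | n
    · rw [geomCoeff_zero]
      exact Submodule.subset_span ⟨0, ![], ![], by simp, by simp, by simp⟩
    · rw [geomCoeff_succ]
      refine sum_mem fun p hp => ?_
      have hp' := Finset.HasAntidiagonal.mem_antidiagonal.1 hp
      have := mul_mem_tensorDeg (ι_mem_tensorDeg (hv p.1)) (ih p.2 (by omega))
      rwa [show (p.1 : ℤ) + 1 + p.2 = ((n + 1 : ℕ) : ℤ) by push_cast; omega] at this

theorem algebraMapInv_geomCoeff_succ (n : ℕ) :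
    algebraMapInv (geomCoeff v (n + 1)) = 0 := by
  rw [geomCoeff_succ, map_sum]
  refine Finset.sum_eq_zero fun p _ => ?_
  rw [_root_.map_mul]
  simp [algebraMapInv]

variable {v}

theorem quad_zero (hV : IsV V v) : V.quad (v 0) = 0 := by
  simp [ShCog.quad, hV.Δ_zero]

theorem quad_one (hV : IsV V v) : V.quad (v 1) = 0 := by
  simp [ShCog.quad, hV.Δ_one]

theorem quad_add_two (hV : IsV V v) (n : ℕ) : V.quad (v (n + 2)) =
    ∑ p ∈ antidiagonal n, (-1 : ℤ) ^ (p.1 + 1) • (ι k (v p.1) * ι k (v p.2)) := by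
  rw [Finset.Nat.sum_antidiagonal_eq_sum_range_succ
    (fun i j => (-1 : ℤ) ^ (i + 1) • (ι k (v i) * ι k (v j)))]
  simp only [ShCog.quad, LinearMap.comp_apply, hV.Δ_add_two, map_sum, map_zsmul,
    TensorProduct.map_tmul, LinearMap.mul'_apply]

theorem parity_v (hV : IsV V v) (i : ℕ) : V.ε (v i) = (-1 : ℤ) ^ (i + 1) • v i := by
  rw [ShCog.ε, parity_of_mem _ (hV.mem i),
    show ((i : ℤ) + 1) = ((i + 1 : ℕ) : ℤ) by push_cast; rfl, koszul_natCast_one]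

theorem cobarDiff_ι (hV : IsV V v) (x : V.carrier) : V.cobarDiff (ι k x) = V.quad x := by
  simp [ShCog.cobarDiff, tensorDer_ι, hV.d_eq]

/-- With `W` the series of the `geomCoeff v n`, `W̄ = W(-t)` and `D` the differential of the cobar
construction, `D W = t (W̄ - 1) (W - 1)`. Indeed `W = 1 + t v W` and `D v = - t² v̄ v` for
`v = ∑ vᵢ₊₁ tⁱ`, and so both sides solve the equation `E = - t² v̄ (W - 1) - t v̄ E`. -/
theorem cobarDiff_geomSeries (hV : IsV V v) :
    PowerSeries.mk (fun n => V.cobarDiff (geomCoeff v n)) =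
      PowerSeries.X * ((PowerSeries.mk (fun n => (-1 : ℤ) ^ n • geomCoeff v n) - 1) *
        (PowerSeries.mk (geomCoeff v) - 1)) := by
  set W := PowerSeries.mk (geomCoeff v) with hW
  set W' := PowerSeries.mk (fun n => (-1 : ℤ) ^ n • geomCoeff v n) with hW'
  set E := PowerSeries.mk (fun n => V.cobarDiff (geomCoeff v n)) with hE
  set S := PowerSeries.mk (fun n => ι k (v n)) with hS
  set S' := PowerSeries.mk (fun n => (-1 : ℤ) ^ n • ι k (v n)) with hS'
  set T := PowerSeries.mk (fun n => V.quad (v n)) with hT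
  have h1 : W - 1 = PowerSeries.X * (S * W) := by
    ext n
    rcases n with _ | n
    · simp [hW, geomCoeff_zero]
    · rw [PowerSeries.coeff_succ_X_mul, PowerSeries.coeff_mul]
      simp [hW, hS, geomCoeff_succ, PowerSeries.coeff_one]
  have h2 : W' - 1 = -(PowerSeries.X * (S' * W')) := by
    ext n
    rcases n with _ | n
    · simp [hW', geomCoeff_zero]
    · rw [map_neg, PowerSeries.coeff_succ_X_mul, PowerSeries.coeff_mul]
      simp only [hW', hS', geomCoeff_succ, PowerSeries.coeff_one, map_sub, PowerSeries.coeff_mk,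
        Nat.succ_ne_zero, if_false, sub_zero, Finset.smul_sum, ← Finset.sum_neg_distrib]
      refine Finset.sum_congr rfl fun p hp => ?_
      have hp' := Finset.HasAntidiagonal.mem_antidiagonal.1 hp
      rw [smul_mul_smul_comm, ← pow_add, hp', ← neg_smul, pow_succ]
      simp
  have h3 : T = -(PowerSeries.X * (PowerSeries.X * (S' * S))) := by
    ext n
    rw [map_neg]
    rcases n with _ | _ | n
    · simp [hT, quad_zero hV]
    · rw [PowerSeries.coeff_succ_X_mul]
      simp [hT, quad_one hV]
    · rw [PowerSeries.coeff_succ_X_mul, PowerSeries.coeff_succ_X_mul, PowerSeries.coeff_mul]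
      simp only [hT, hS, hS', PowerSeries.coeff_mk, quad_add_two hV, ← Finset.sum_neg_distrib]
      refine Finset.sum_congr rfl fun p hp => ?_
      rw [pow_succ, smul_mul_assoc, ← neg_smul]
      simp
  have h4 : E = PowerSeries.X * (T * W) - PowerSeries.X * (S' * E) := by
    ext n
    rcases n with _ | n
    · simp [hE, geomCoeff_zero, ShCog.cobarDiff, tensorDer_one]
    · rw [map_sub, PowerSeries.coeff_succ_X_mul, PowerSeries.coeff_succ_X_mul,
        PowerSeries.coeff_mul, PowerSeries.coeff_mul, ← Finset.sum_sub_distrib]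
      simp only [hE, hT, hW, hS', PowerSeries.coeff_mk, geomCoeff_succ, map_sum]
      refine Finset.sum_congr rfl fun p hp => ?_
      have := tensorDer_mul V.ε (ι k ∘ₗ V.d + V.quad) (ι k (v p.1)) (geomCoeff v p.2)
      rw [← ShCog.cobarDiff, cobarDiff_ι hV, tensorMap_ι, parity_v hV] at this
      rw [this, pow_succ, map_zsmul, sub_eq_add_neg, ← neg_mul]
      simp
  refine powerSeries_fixedPoint_unique (Q := S') h4 ?_
  have hX : ∀ A : PowerSeries (TensorAlgebra k V.carrier),
      S' * (PowerSeries.X * A) = PowerSeries.X * (S' * A) := fun A => by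
    rw [← mul_assoc, ← PowerSeries.X_mul, mul_assoc]
  have h5 : W' - 1 = -(PowerSeries.X * S') - PowerSeries.X * (S' * (W' - 1)) := by
    rw [mul_sub, mul_sub, mul_one, h2]
    abel
  have h6 : T * W = -(PowerSeries.X * (S' * (W - 1))) := by
    rw [h3, h1, hX]
    simp only [neg_mul, mul_assoc]
  rw [h6, hX]
  conv_lhs => rw [h5]
  generalize W' - 1 = A, W - 1 = B
  simp only [sub_mul, neg_mul, mul_assoc, mul_sub, mul_neg]

theorem cobarDiff_geomCoeff_succ (hV : IsV V v) (n : ℕ) :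
    V.cobarDiff (geomCoeff v (n + 1)) = phiAlg v (V.quad (v n)) := by
  have h := congrArg (PowerSeries.coeff (n + 1)) (cobarDiff_geomSeries hV)
  rw [PowerSeries.coeff_mk, PowerSeries.coeff_succ_X_mul, PowerSeries.coeff_mul] at h
  rw [h]
  rcases n with _ | _ | n
  · simp [quad_zero hV, geomCoeff_zero]
  · simp [quad_one hV, geomCoeff_zero, Finset.Nat.antidiagonal_succ]
  · rw [Finset.Nat.sum_antidiagonal_succ, Finset.Nat.sum_antidiagonal_succ', quad_add_two hV]
    simp [geomCoeff_zero, PowerSeries.coeff_one, phiAlg_ι, mul_assoc]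

/-- The `∞`-morphism `Φ`. -/
noncomputable def phi (hV : IsV V v) (hgr : V.gr = basisGr v degV) : InfCogHom V V where
  toAlg := phiAlg v
  aug t := by
    have h : (algebraMapInv.comp (phiAlg v) : TensorAlgebra k V.carrier →ₐ[k] k) =
        algebraMapInv := by
      refine TensorAlgebra.hom_ext (v.ext fun n => ?_)
      simp only [LinearMap.comp_apply, AlgHom.toLinearMap_apply, AlgHom.comp_apply, phiAlg_ι,
        algebraMapInv_geomCoeff_succ]
      simp [algebraMapInv]
    exact congr($h t)
  map_deg ht := by
    refine algHom_mem_tensorDeg _ (fun {i x} hx => ?_) ht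
    rw [hgr] at hx
    refine basisGr_induction v degV ((phiAlg v).toLinearMap ∘ₗ ι k) _ (fun n hn => ?_) hx
    rw [LinearMap.comp_apply, AlgHom.toLinearMap_apply, phiAlg_ι, ← hn]
    exact_mod_cast geomCoeff_mem v hV.mem (n + 1)
  map_d t := by
    have hθ : ∀ x, phiAlg v (V.cobarDiff (ι k x)) = V.cobarDiff (phiAlg v (ι k x)) := by
      have h : (phiAlg v).toLinearMap ∘ₗ V.cobarDiff ∘ₗ ι k =
          V.cobarDiff ∘ₗ (phiAlg v).toLinearMap ∘ₗ ι k := by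
        refine v.ext fun n => ?_
        simp only [LinearMap.comp_apply, AlgHom.toLinearMap_apply, phiAlg_ι,
          cobarDiff_geomCoeff_succ hV, cobarDiff_ι hV]
      exact fun x => congr($h x)
    have hε : ∀ x, phiAlg v (ι k (V.ε x)) = tensorMap V.ε (phiAlg v (ι k x)) := by
      have h : (phiAlg v).toLinearMap ∘ₗ ι k ∘ₗ V.ε =
          (tensorMap V.ε).toLinearMap ∘ₗ (phiAlg v).toLinearMap ∘ₗ ι k := by
        refine v.ext fun n => ?_
        simp only [LinearMap.comp_apply, AlgHom.toLinearMap_apply, phiAlg_ι,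
          tensorMap_geomCoeff v (parity_v hV), parity_v hV, map_zsmul]
      exact fun x => congr($h x)
    induction t using tensor_induction with
    | h1 => simp [ShCog.cobarDiff, tensorDer_one]
    | hι x t ih =>
      rw [_root_.map_mul (phiAlg v), ShCog.cobarDiff, tensorDer_mul, tensorDer_mul, ← ShCog.cobarDiff,
        map_add, _root_.map_mul (phiAlg v), _root_.map_mul (phiAlg v), hθ, ih, tensorMap_ι, hε]
    | hadd s t hs ht => simp only [map_add, hs, ht]
    | hsmul c t ht => simp only [map_smul, ht]

theorem isPhi_phi (hV : IsV V v) (hgr : V.gr = basisGr v degV) : IsPhi v (phi hV hgr) :=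
  fun n => phiAlg_ι v n

end Phi

/-! ### The `∞`-morphism of algebras -/

section Psi

open TensorAlgebra
open Finset.HasAntidiagonal (antidiagonal)

variable {k : Type u} [Field k] {H A : DGAlg k}

/-- Linear maps on the tensor algebra of a one-dimensional space agree if they agree on the powers
of the generator. -/
theorem tensor_linearMap_ext {V M : Type u} [AddCommGroup V] [Module k V] [AddCommGroup M]
    [Module k M] (z : Module.Basis Unit k V) {f g : TensorAlgebra k V →ₗ[k] M}
    (h : ∀ n, f (ι k (z ()) ^ n) = g (ι k (z ()) ^ n)) : f = g := by
  have hspan : ∀ t : TensorAlgebra k V,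
      t ∈ Submodule.span k (Set.range fun n : ℕ => ι k (z ()) ^ n) := by
    intro t
    induction t using tensor_induction with
    | h1 => exact Submodule.subset_span ⟨0, pow_zero _⟩
    | hι v t ht =>
      have hv : v = z.repr v () • z () := by
        simpa using (z.sum_repr v).symm
      rw [hv, (ι k).map_smul, smul_mul_assoc]
      refine Submodule.smul_mem _ _ ?_
      refine (Submodule.span_le (p := (Submodule.span k _).comap
        (LinearMap.mulLeft k (ι k (z ()))))).2 ?_ ht
      rintro _ ⟨n, rfl⟩
      exact Submodule.subset_span ⟨n + 1, pow_succ' _ _⟩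
    | hadd s t hs ht => exact add_mem hs ht
    | hsmul c t ht => exact Submodule.smul_mem _ c ht
  refine LinearMap.ext_on_range (v := fun n : ℕ => ι k (z ()) ^ n) ?_ h
  exact eq_top_iff.2 fun t _ => hspan t

theorem deconc_ι_pow {V : Type u} [AddCommGroup V] [Module k V] (v : V) (n : ℕ) :
    deconc k V (ι k v ^ n) = ∑ p ∈ antidiagonal n, (ι k v ^ p.1) ⊗ₜ[k] (ι k v ^ p.2) := by
  induction n with
  | zero => simp [deconc_one]
  | succ n ih =>
    rw [pow_succ', deconc_ι_mul, ih, Finset.Nat.sum_antidiagonal_succ, Finset.mul_sum]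
    simp only [Algebra.TensorProduct.tmul_mul_tmul, one_mul, ← pow_succ', pow_zero]

section Word

variable (a c : A.carrier)

/-- The sum `Pₙ` of all words of weight `n` in the letters `a` of weight `1` and `c` of weight
`2`. -/
noncomputable def psiWord : ℕ → TensorAlgebra k A.carrier
  | 0 => 1
  | 1 => ι k a
  | n + 2 => ι k a * psiWord (n + 1) + ι k c * psiWord n

theorem psiWord_zero : psiWord a c 0 = 1 := rfl

theorem psiWord_one : psiWord a c 1 = ι k a := rfl

theorem psiWord_add_two (n : ℕ) :
    psiWord a c (n + 2) = ι k a * psiWord a c (n + 1) + ι k c * psiWord a c n := rfl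

theorem deconc_psiWord (n : ℕ) : deconc k A.carrier (psiWord a c n) =
    ∑ p ∈ antidiagonal n, psiWord a c p.1 ⊗ₜ[k] psiWord a c p.2 := by
  induction n using Nat.strong_induction_on with
  | _ n ih =>
    rcases n with _ | _ | n
    · simp [psiWord_zero, deconc_one]
    · have := deconc_ι_pow (k := k) a 1
      simpa [psiWord_zero, psiWord_one, Finset.Nat.antidiagonal_succ] using this
    · rw [psiWord_add_two, map_add, deconc_ι_mul, deconc_ι_mul, ih (n + 1) (by omega),
        ih n (by omega), Finset.Nat.sum_antidiagonal_succ, Finset.Nat.sum_antidiagonal_succ,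
        Finset.Nat.sum_antidiagonal_succ]
      simp only [mul_add, Finset.mul_sum, Algebra.TensorProduct.tmul_mul_tmul, one_mul,
        psiWord_add_two, psiWord_zero, psiWord_one, mul_one, TensorProduct.add_tmul,
        TensorProduct.tmul_add, Finset.sum_add_distrib, zero_add]
      abel

theorem psiWord_mem (ha : a ∈ A.gr 0) (hc : c ∈ A.gr 1) (n : ℕ) :
    psiWord a c n ∈ tensorDeg A.sgr n := by
  have ha' : ι k a ∈ tensorDeg A.sgr 1 := ι_mem_tensorDeg ha
  have hc' : ι k c ∈ tensorDeg A.sgr 2 := ι_mem_tensorDeg hc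
  induction n using Nat.strong_induction_on with
  | _ n ih =>
    rcases n with _ | _ | n
    · exact Submodule.subset_span ⟨0, ![], ![], by simp, by simp, by simp [psiWord_zero]⟩
    · simpa [psiWord_one] using ha'
    · rw [psiWord_add_two]
      refine add_mem ?_ ?_
      · have := mul_mem_tensorDeg ha' (ih (n + 1) (by omega))
        rwa [show 1 + ((n + 1 : ℕ) : ℤ) = ((n + 2 : ℕ) : ℤ) by push_cast; ring] at this
      · have := mul_mem_tensorDeg hc' (ih n (by omega))
        rwa [show 2 + (n : ℤ) = ((n + 2 : ℕ) : ℤ) by push_cast; ring] at this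

theorem algebraMapInv_psiWord_succ (n : ℕ) : algebraMapInv (psiWord a c (n + 1)) = 0 := by
  rcases n with _ | n
  · simp [psiWord_one, algebraMapInv]
  · simp [psiWord_add_two, algebraMapInv]

theorem ιInv_ι_mul_psiWord_succ (w : A.carrier) (n : ℕ) :
    ιInv (ι k w * psiWord a c (n + 1)) = 0 := by
  rcases n with _ | n
  · simpa [psiWord_one] using ιInv_ι_mul_ι_mul w a (1 : TensorAlgebra k A.carrier)
  · rw [psiWord_add_two, mul_add, map_add, ιInv_ι_mul_ι_mul, ιInv_ι_mul_ι_mul, add_zero]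

/-- The bar differential kills all `Pₙ`: in `b Pₙ₊₂` the term `(a a) Pₙ` coming from the product
cancels `(d c) Pₙ`, and the terms in which `a` and `c` are multiplied cancel each other. -/
theorem barDiff_psiWord (ha : a ∈ A.gr 0) (hc : c ∈ A.gr 1) (hda : A.d a = 0)
    (hdc : A.d c = a * a) (hac : c * a = a * c) (hcc : c * c = 0) (n : ℕ) :
    A.barDiff (psiWord a c n) = 0 := by
  have ea : A.ε a = a := by
    rw [DGAlg.ε, parity_of_mem _ ha, Int.cast_zero, koszul_zero_left, one_smul]
  have ec : A.ε c = -c := by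
    rw [DGAlg.ε, parity_of_mem _ hc, Int.cast_one, koszul_one, neg_one_smul]
  have hm1 : ∀ u w, A.merge (ι k u) w = ι k (A.ε w * u) := by
    intro u w
    simpa using A.merge_ι_mul w u 1
  have key : ∀ n, A.merge (psiWord a c (n + 1)) a + A.merge (psiWord a c n) c =
      ι k (a * a) * psiWord a c n := by
    intro n
    rcases n with _ | _ | n
    · simp [psiWord_one, psiWord_zero, hm1, A.merge_one, ea]
    · simp [psiWord_add_two, psiWord_one, psiWord_zero, hm1, A.merge_ι_mul, ea, ec, hac]
    · simp [psiWord_add_two, A.merge_ι_mul, ea, ec, hac, hcc]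
  induction n using Nat.strong_induction_on with
  | _ n ih =>
    rcases n with _ | _ | n
    · rw [psiWord_zero, A.barDiff_one]
    · have := A.barDiff_ι_mul a 1
      simpa [A.barDiff_one, A.merge_one, hda, psiWord_one] using this
    · rw [psiWord_add_two, map_add, A.barDiff_ι_mul, A.barDiff_ι_mul, ih (n + 1) (by omega),
        ih n (by omega), hda, hdc]
      have := key n
      simp only [map_zero, zero_mul, mul_zero, neg_zero, sub_zero, zero_add]
      rw [← this]
      abel

end Word

variable (z : Module.Basis Unit k H.carrier) (b : Module.Basis (ℕ ⊕ ℕ) k A.carrier)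

/-- One step of the recursion for `psiWord`. -/
noncomputable def psiStep (a c : A.carrier) :
    Module.End k (TensorAlgebra k A.carrier × TensorAlgebra k A.carrier) :=
  LinearMap.prod (LinearMap.mulLeft k (ι k a) ∘ₗ LinearMap.fst k _ _ +
    LinearMap.mulLeft k (ι k c) ∘ₗ LinearMap.snd k _ _) (LinearMap.fst k _ _)

theorem psiStep_pow_succ (a c : A.carrier) (n : ℕ) :
    (psiStep a c ^ (n + 1)) (1, 0) = (psiWord a c (n + 1), psiWord a c n) := by
  induction n with
  | zero => simp [psiStep, psiWord_one, psiWord_zero]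
  | succ n ih =>
    rw [pow_succ', Module.End.mul_apply, ih]
    rfl

/-- The linear map with `zⁿ ↦ Pₙ`. -/
noncomputable def psiLin : TensorAlgebra k H.carrier →ₗ[k] TensorAlgebra k A.carrier :=
  LinearMap.fst k _ _ ∘ₗ
    LinearMap.applyₗ ((1, 0) : TensorAlgebra k A.carrier × TensorAlgebra k A.carrier) ∘ₗ
    (TensorAlgebra.lift k
      ((z.coord ()).smulRight (psiStep (b (.inl 0)) (b (.inr 0))))).toLinearMap

theorem psiLin_pow (n : ℕ) :
    psiLin z b (ι k (z ()) ^ n) = psiWord (b (.inl 0)) (b (.inr 0)) n := by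
  have h : psiLin z b (ι k (z ()) ^ n) =
      ((psiStep (b (.inl 0)) (b (.inr 0)) ^ n) (1, 0)).1 := by
    simp [psiLin]
  rw [h]
  rcases n with _ | n
  · simp [psiWord_zero]
  · rw [psiStep_pow_succ]

variable {z b}

theorem barDiff_pow (hH : IsH2 H z) (n : ℕ) : H.barDiff (ι k (z ()) ^ n) = 0 := by
  have ez : H.ε (z ()) = z () := by
    rw [DGAlg.ε, parity_of_mem _ hH.mem, Int.cast_zero, koszul_zero_left, one_smul]
  have hm : ∀ n, H.merge (ι k (z ()) ^ n) (z ()) = 0 := by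
    intro n
    rcases n with _ | n
    · simp [H.merge_one]
    · rw [pow_succ', H.merge_ι_mul, ez, hH.mul_eq, map_zero, zero_mul]
  induction n with
  | zero => rw [pow_zero, H.barDiff_one]
  | succ n ih => rw [pow_succ', H.barDiff_ι_mul, ih, hm, hH.d_eq]; simp

/-- The `∞`-morphism `i_∞`. -/
noncomputable def psi (hH : IsH2 H z) (hgr : H.gr = basisGr z fun _ => 0) (hA : IsA2 A b) :
    InfAlgHom H A where
  toLin := psiLin z b
  map_one := by simpa [psiWord_zero] using psiLin_pow z b 0
  counit t := by
    have h : algebraMapInv.toLinearMap ∘ₗ psiLin z b =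
        (algebraMapInv.toLinearMap : TensorAlgebra k H.carrier →ₗ[k] k) := by
      refine tensor_linearMap_ext z fun n => ?_
      rw [LinearMap.comp_apply, psiLin_pow]
      rcases n with _ | n
      · simp [psiWord_zero]
      · simp only [AlgHom.toLinearMap_apply, algebraMapInv_psiWord_succ]
        simp [algebraMapInv]
    exact congr($h t)
  comul t := by
    have h : deconc k A.carrier ∘ₗ psiLin z b =
        TensorProduct.map (psiLin z b) (psiLin z b) ∘ₗ deconc k H.carrier := by
      refine tensor_linearMap_ext z fun n => ?_
      simp only [LinearMap.comp_apply, psiLin_pow, deconc_ι_pow, deconc_psiWord, map_sum,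
        TensorProduct.map_tmul]
    exact congr($h t)
  map_deg {n t} ht := by
    refine (Submodule.span_le (p := (tensorDeg A.sgr n).comap (psiLin z b))).2 ?_ ht
    rintro _ ⟨m, q, x, hx, hq, rfl⟩
    rw [SetLike.mem_coe, Submodule.mem_comap]
    have hzero : ∀ r x, x ∈ H.sgr r → r ≠ 1 → x = 0 := by
      intro r x hx hr
      rw [DGAlg.sgr, hgr] at hx
      refine basisGr_induction z _ LinearMap.id ⊥ (fun i hi => ?_) hx
      omega
    by_cases h1 : ∀ i, q i = 1
    · have hc : ∀ i, x i = z.repr (x i) () • z () := fun i => by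
        simpa using (z.sum_repr (x i)).symm
      have hm : n = m := by rw [← hq]; simp [h1]
      rw [show x = fun i => z.repr (x i) () • z () from funext hc,
        MultilinearMap.map_smul_univ, map_smul, TensorAlgebra.tprod_apply]
      refine Submodule.smul_mem _ _ ?_
      rw [List.ofFn_const, List.prod_replicate, psiLin_pow, hm]
      exact psiWord_mem _ _ (hA.x_mem 0) (hA.y_mem 0) m
    · push Not at h1
      obtain ⟨i, hi⟩ := h1
      rw [MultilinearMap.map_coord_zero _ i (hzero _ _ (hx i) hi), map_zero]
      exact zero_mem _
  map_d t := by
    have h : psiLin z b ∘ₗ H.barDiff = A.barDiff ∘ₗ psiLin z b := by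
      refine tensor_linearMap_ext z fun n => ?_
      rw [LinearMap.comp_apply, LinearMap.comp_apply, barDiff_pow hH, psiLin_pow, map_zero,
        barDiff_psiWord _ _ (hA.x_mem 0) (hA.y_mem 0) (hA.d_x 0)]
      · rw [hA.d_y, hA.x_mul_x]
      · rw [hA.y_mul_x, hA.x_mul_y]
      · exact hA.y_mul_y 0 0
    exact congr($h t)

theorem psi_ι (hH : IsH2 H z) (hgr : H.gr = basisGr z fun _ => 0) (hA : IsA2 A b) :
    ιInv ((psi hH hgr hA).toLin (ι k (z ()))) = b (.inl 0) := by
  have := psiLin_pow z b 1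
  rw [pow_one] at this
  rw [psi, this, psiWord_one, ιInv_ι]

theorem isIInf_psi (hH : IsH2 H z) (hgr : H.gr = basisGr z fun _ => 0) (hA : IsA2 A b) :
    IsIInf z b (psi hH hgr hA) where
  one := psi_ι hH hgr hA
  two := by
    rw [psi, psiLin_pow, psiWord_add_two, map_add, ιInv_ι_mul_psiWord_succ, psiWord_zero, mul_one,
      ιInv_ι, zero_add]
  many n hn := by
    obtain ⟨m, rfl⟩ := Nat.exists_eq_add_of_le' hn
    rw [psi, psiLin_pow, psiWord_add_two, map_add, ιInv_ι_mul_psiWord_succ,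
      ιInv_ι_mul_psiWord_succ, add_zero]

/-- The homology of `A²` is spanned by the class of `x`: the linear map with `x^(i+2) ↦ x^i y`, zero
on `x` and on the `x^i y`, is a homotopy from the identity to the projection onto `k x`. -/
theorem isQuasiIso_of_isIInf (hH : IsH2 H z) (hA : IsA2 A b) {Ψ : InfAlgHom H A} (h : IsIInf z b Ψ) :
    Ψ.IsQuasiIso := by
  have h1 : ∀ a : H.carrier, ιInv (Ψ.toLin (ι k a)) = z.repr a () • b (.inl 0) := by
    intro a
    have ha : a = z.repr a () • z () := by simpa using (z.sum_repr a).symm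
    conv_lhs => rw [ha, map_smul, map_smul, map_smul, h.one]
  constructor
  · rintro a - ⟨c, hc⟩
    have h2 : b.coord (.inl 0) ∘ₗ A.d = 0 := by
      refine b.ext ?_
      rintro (i | i) <;> simp [hA.d_x, hA.d_y]
    have h3 : b.coord (.inl 0) (A.d c) = 0 := congr($h2 c)
    rw [hc, h1, map_smul] at h3
    have ha : a = 0 := z.ext_elem fun i => by simpa using h3
    exact ⟨0, by rw [ha, map_zero]⟩
  · intro a ha
    let s : A.carrier →ₗ[k] A.carrier := b.constr ℕ
      (Sum.elim (fun i => Nat.casesOn i 0 fun i => b (.inr i)) fun _ => 0)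
    have s_zero : s (b (.inl 0)) = 0 := b.constr_basis _ _ _
    have s_succ : ∀ i, s (b (.inl (i + 1))) = b (.inr i) := fun i => b.constr_basis _ _ _
    have s_inr : ∀ i, s (b (.inr i)) = 0 := fun i => b.constr_basis _ _ _
    have hs : A.d ∘ₗ s + s ∘ₗ A.d + (b.coord (.inl 0)).smulRight (b (.inl 0)) =
        LinearMap.id := by
      refine b.ext ?_
      rintro ((_ | i) | i)
      · simp [s_zero, hA.d_x]
      · simp [s_succ, hA.d_x, hA.d_y]
      · simp [s_succ, s_inr, hA.d_y]
    refine ⟨b.coord (.inl 0) a • z (), s a, ?_, ?_⟩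
    · rw [hH.d_eq, LinearMap.zero_apply]
    · have := congr($hs a)
      simp only [LinearMap.add_apply, LinearMap.comp_apply, ha, map_zero, add_zero,
        LinearMap.smulRight_apply, LinearMap.id_apply] at this
      have hr : z.repr (b.coord (.inl 0) a • z ()) () = b.coord (.inl 0) a := by simp
      rw [h1, hr, add_comm, this]

end Psi

/-! ### Families evaluated on arguments of even degree -/

section Even

variable {k : Type u} [Field k] {G H K : Type u} [AddCommGroup G] [Module k G] [AddCommGroup H]
  [Module k H] [AddCommGroup K] [Module k K]

theorem sum_orderedFinpartition_two {M : Type*} [AddCommMonoid M]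
    (F : OrderedFinpartition 2 → M) :
    ∑ c, F c = F (OrderedFinpartition.atomic 1).extendLeft +
      F ((OrderedFinpartition.atomic 1).extendMiddle (0 : Fin 1)) := by
  rw [← Fintype.sum_equiv (OrderedFinpartition.extendEquiv 1) (fun s => F (s.1.extend s.2)) F
    fun _ => rfl, Fintype.sum_sigma, Fintype.sum_unique, Fintype.sum_option]
  refine congrArg₂ (· + ·) rfl ?_
  exact Fintype.sum_unique (ι := Fin 1) _

/-- In arity two, the composite has the two terms that correspond to the two partitions of a set
with two elements. -/
theorem Family.comp_two {gr : ℤ → Submodule k G} (h : DirectSum.IsInternal gr) (ψ : Family k H K)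
    (φ : Family k G H) (x : Fin 2 → G) (p : Fin 2 → ℤ) (hx : ∀ i, x i ∈ gr (p i))
    (hp : ∀ i, ((p i : ℤ) : ZMod 2) = 0) :
    Family.comp h ψ φ 2 x = ψ 2 (fun i => φ 1 fun _ => x i) + ψ 1 (fun _ => φ 2 x) := by
  have hs : ∀ c : OrderedFinpartition 2, partSign c (fun i => (p i : ZMod 2)) = 1 := by
    intro c
    simp [partSign, hp, koszul_zero_left]
  rw [Family.comp, superExt_of_mem h _ p x hx, sum_apply]
  simp only [hs, one_smul]
  rw [sum_orderedFinpartition_two]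
  refine congrArg₂ (· + ·) ?_ ?_
  · change ψ 2 _ = _
    congr 1
    funext m
    fin_cases m
    · change φ 1 _ = φ 1 _
      rfl
    · change φ 1 _ = φ 1 _
      rfl
  · change ψ 1 _ = _
    congr 1
    funext m
    fin_cases m
    change φ 2 _ = φ 2 _
    congr 1
    funext i
    fin_cases i <;> rfl

end Even

section Eval

open TensorAlgebra

variable {k : Type u} [Field k] {V W G : Type u} [AddCommGroup V] [Module k V] [AddCommGroup W]
  [Module k W] [AddCommGroup G] [Module k G]

theorem mem_span_tprod (t : TensorAlgebra k V) :
    t ∈ Submodule.span k {t | ∃ (m : ℕ) (x : Fin m → V), t = tprod k V m x} := by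
  induction t using tensor_induction with
  | h1 => exact Submodule.subset_span ⟨0, ![], by simp⟩
  | hι v t ht =>
    refine (Submodule.span_le (p := (Submodule.span k _).comap
      (LinearMap.mulLeft k (ι k v)))).2 ?_ ht
    rintro _ ⟨m, x, rfl⟩
    exact Submodule.subset_span ⟨m + 1, Fin.cons v x, by simp [tprod_apply, List.ofFn_succ]⟩
  | hadd s t hs ht => exact add_mem hs ht
  | hsmul c t ht => exact Submodule.smul_mem _ c ht

theorem tensorEval_ι_mul (n : ℕ) (f : Fin (n + 1) → (V →ₗ[k] W)) (v : V) (t : TensorAlgebra k V) :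
    tensorEval k V W (n + 1) f (ι k v * t) =
      ι k (f 0 v) * tensorEval k V W n (fun i => f i.succ) t := by
  have h : ∀ L : TensorAlgebra k V →ₗ[k] TensorAlgebra k W,
      (∀ m (x : Fin m → V), L (tprod k V m x) = 0) → ∀ t, L t = 0 := by
    intro L hL t
    refine (Submodule.mem_bot k).1 ((Submodule.span_le (p := (⊥ : Submodule k _).comap L)).2 ?_
      (mem_span_tprod t))
    rintro _ ⟨m, x, rfl⟩
    exact hL m x
  refine sub_eq_zero.1 (h (tensorEval k V W (n + 1) f ∘ₗ LinearMap.mulLeft k (ι k v) -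
    LinearMap.mulLeft k (ι k (f 0 v)) ∘ₗ tensorEval k V W n fun i => f i.succ) ?_ t)
  intro m x
  have hc : ι k v * tprod k V m x = tprod k V (m + 1) (Fin.cons v x) := by
    simp [tprod_apply, List.ofFn_succ]
  simp only [LinearMap.sub_apply, LinearMap.comp_apply, LinearMap.mulLeft_apply, hc]
  by_cases hm : m = n
  · subst hm
    rw [tensorEval_tprod, tensorEval_tprod]
    simp [tprod_apply, List.ofFn_succ]
  · rw [tensorEval_tprod_ne hm, tensorEval_tprod_ne (by omega), mul_zero, sub_zero]

theorem tensorEval_zero_ι_mul (f : Fin 0 → (V →ₗ[k] W)) (v : V) (t : TensorAlgebra k V) :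
    tensorEval k V W 0 f (ι k v * t) = 0 := by
  refine (Submodule.mem_bot k).1 ((Submodule.span_le (p := (⊥ : Submodule k _).comap
    (tensorEval k V W 0 f ∘ₗ LinearMap.mulLeft k (ι k v)))).2 ?_ (mem_span_tprod t))
  rintro _ ⟨m, x, rfl⟩
  have hc : ι k v * tprod k V m x = tprod k V (m + 1) (Fin.cons v x) := by
    simp [tprod_apply, List.ofFn_succ]
  simp only [SetLike.mem_coe, Submodule.mem_comap, LinearMap.comp_apply, LinearMap.mulLeft_apply,
    hc, tensorEval_tprod_ne (Nat.succ_ne_zero m), Submodule.mem_bot]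

theorem tensorEval_zero_one (f : Fin 0 → (V →ₗ[k] W)) : tensorEval k V W 0 f 1 = 1 := by
  simpa [tprod_apply] using tensorEval_tprod (k := k) 0 f (![] : Fin 0 → V)

theorem tensorEval_succ_one (n : ℕ) (f : Fin (n + 1) → (V →ₗ[k] W)) :
    tensorEval k V W (n + 1) f 1 = 0 := by
  simpa [tprod_apply] using tensorEval_tprod_ne (k := k) (Nat.succ_ne_zero n).symm f
    (![] : Fin 0 → V)

theorem tensorEval_one_ι (f : Fin 1 → (V →ₗ[k] W)) (v : V) :
    tensorEval k V W 1 f (ι k v) = ι k (f 0 v) := by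
  have := tensorEval_ι_mul 0 f v 1
  rwa [mul_one, tensorEval_zero_one, mul_one] at this

/-- On equal arguments of even degree the symmetrization is multiplication by `n!`. -/
theorem symTensor_even {gr : ℤ → Submodule k G} (h : DirectSum.IsInternal gr) (e : V →ₗ[k] V)
    (j : G →ₗ[k] V →ₗ[k] W) (n : ℕ) {p : ℤ} {g : G} (hg : g ∈ gr p) (hp : (p : ZMod 2) = 0) :
    symTensor h e j n (fun _ => g) = n.factorial • tensorEval k V W n (fun _ => j g) := by
  rw [symTensor_of_mem h e j n (fun _ => p) _ fun _ => hg]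
  simp [hp, permSign, koszul_zero_left, powTwo_zero, Fintype.card_perm]

theorem symTensor_one {gr : ℤ → Submodule k G} (h : DirectSum.IsInternal gr) (e : V →ₗ[k] V)
    (j : G →ₗ[k] V →ₗ[k] W) (f : Fin 1 → G) :
    symTensor h e j 1 f = tensorEval k V W 1 (fun i => j (f i)) := by
  have := multilinear_mem h
    (symTensor h e j 1 - (tensorEval k V W 1).compLinearMap fun _ => j) ⊥ ?_ f
  · exact sub_eq_zero.1 ((Submodule.mem_bot k).1 this)
  · intro p x hx
    rw [Submodule.mem_bot, sub_apply, symTensor_of_mem h e j 1 p x hx,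
      Fintype.sum_unique]
    simp [permSign, Subsingleton.elim _ (0 : Fin 1), powTwo_zero]

theorem γ_ι (A : DGAlg k) (a : A.carrier) : A.γ (ι k a) = a := by
  simp [DGAlg.γ]

theorem γ_ι_mul_ι (A : DGAlg k) (a c : A.carrier) : A.γ (ι k a * ι k c) = a * c := by
  simp [DGAlg.γ]

end Eval

/-! ### The two composites -/

section Composites

open TensorAlgebra
open Finset.HasAntidiagonal (antidiagonal)

variable {k : Type u} [Field k] {V : ShCog k} {v : Module.Basis ℕ k V.carrier}

theorem tensorEval_zero_geomCoeff_succ {W : Type u} [AddCommGroup W] [Module k W]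
    (f : Fin 0 → (V.carrier →ₗ[k] W)) (n : ℕ) :
    tensorEval k V.carrier W 0 f (geomCoeff v (n + 1)) = 0 := by
  rw [geomCoeff_succ, map_sum]
  exact Finset.sum_eq_zero fun p _ => tensorEval_zero_ι_mul f _ _

theorem tensorEval_one_geomCoeff_succ {W : Type u} [AddCommGroup W] [Module k W]
    (f : Fin 1 → (V.carrier →ₗ[k] W)) (n : ℕ) :
    tensorEval k V.carrier W 1 f (geomCoeff v (n + 1)) = ι k (f 0 (v n)) := by
  rw [geomCoeff_succ, map_sum]
  simp only [tensorEval_ι_mul]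
  rcases n with _ | n
  · simp [geomCoeff_zero, tensorEval_zero_one]
  · rw [Finset.Nat.sum_antidiagonal_succ']
    simp [tensorEval_zero_geomCoeff_succ, geomCoeff_zero, tensorEval_zero_one]

theorem tensorEval_two_geomCoeff_add_two {W : Type u} [AddCommGroup W] [Module k W]
    (f : Fin 2 → (V.carrier →ₗ[k] W)) (n : ℕ) :
    tensorEval k V.carrier W 2 f (geomCoeff v (n + 2)) =
      ∑ p ∈ antidiagonal n, ι k (f 0 (v p.1)) * ι k (f 1 (v p.2)) := by
  rw [geomCoeff_succ, map_sum]
  simp only [tensorEval_ι_mul]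
  rw [Finset.Nat.sum_antidiagonal_succ']
  simp [tensorEval_one_geomCoeff_succ, geomCoeff_zero, tensorEval_succ_one]

theorem homL_one {Φ : InfCogHom V V} (hΦ : IsPhi v Φ) (A : DGAlg k) (f : Fin 1 → Hom V A) :
    homL Φ (DGAlgHom.id A) 1 f = f 0 := by
  refine Subtype.ext (v.ext fun n => ?_)
  rw [homL_apply, symTensor_one, hΦ n]
  change A.γ (tensorEval k V.carrier A.carrier 1 _ (geomCoeff v (n + 1))) = _
  rw [tensorEval_one_geomCoeff_succ, γ_ι]
  rfl

/-- The value of the binary component on `v₄`, for two equal arguments of even degree that vanish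
on `v₁`. -/
theorem homL_two {Φ : InfCogHom V V} (hΦ : IsPhi v Φ) (A : DGAlg k) {p : ℤ} {f : Hom V A}
    (hf : f ∈ gradedHomGr V.gr A.gr p) (hp : (p : ZMod 2) = 0) (h0 : f.1 (v 0) = 0) :
    (homL Φ (DGAlgHom.id A) 2 fun _ => f : Hom V A).1 (v 3) = 2 • (f.1 (v 1) * f.1 (v 1)) := by
  refine (homL_apply _ _ _ _ _).trans ?_
  rw [symTensor_even _ _ _ _ hf hp, hΦ 3]
  change A.γ ((Nat.factorial 2) • tensorEval k V.carrier A.carrier 2 _ (geomCoeff v 4)) = _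
  rw [tensorEval_two_geomCoeff_add_two, map_nsmul]
  simp [Finset.Nat.antidiagonal_succ, h0, γ_ι_mul_ι]

theorem homR_one {H A : DGAlg k} (Ψ : InfAlgHom H A) (f : Fin 1 → Hom V H) (x : V.carrier) :
    (homR (ShCogHom.id V) Ψ 1 f : Hom V A).1 x = ιInv (Ψ.toLin (ι k ((f 0).1 x))) := by
  refine (homR_apply _ _ _ _ _).trans ?_
  rw [symTensor_one]
  change ιInv (Ψ.toLin (tensorEval k V.carrier H.carrier 1 _ (ι k x))) = _
  rw [tensorEval_one_ι]
  rfl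

/-- For `f` dual to `v₂` with value `z`, the two composites differ by `2 x²` on `(f, f)` and `v₄`.
The terms with the binary component of `i_∞` are the same on both sides. The remaining term is
formed with the square of `i₁ z = x` on one side, and with the square `z² = 0` on the other. -/
theorem homL_comp_homR_ne [CharZero k] (hgr : V.gr = basisGr v degV)
    {Φ : InfCogHom V V} (hΦ : IsPhi v Φ) {H A : DGAlg k} {z : Module.Basis Unit k H.carrier}
    (hH : IsH2 H z) {b : Module.Basis (ℕ ⊕ ℕ) k A.carrier} (hA : IsA2 A b) {Ψ : InfAlgHom H A}
    (hΨ : IsIInf z b Ψ) :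
    Family.comp (hom_internal V H) (homL Φ (DGAlgHom.id A)) (homR (ShCogHom.id V) Ψ) ≠
      Family.comp (hom_internal V H) (homR (ShCogHom.id V) Ψ) (homL Φ (DGAlgHom.id H)) := by
  intro heq
  let f₀ : V.carrier →ₗ[k] H.carrier := (v.coord 1).smulRight (z ())
  have hf₀ : f₀ ∈ homDeg V.gr H.gr (-2) := by
    intro i x hx
    rw [hgr] at hx
    refine basisGr_induction v degV f₀ _ (fun n hn => ?_) hx
    by_cases h1 : n = 1
    · subst h1 hn
      simpa [f₀, degV] using hH.mem
    · have : f₀ (v n) = 0 := by simp [f₀, h1]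
      rw [this]
      exact zero_mem _
  have hf₀1 : f₀ (v 1) = z () := by simp [f₀]
  have hf₀0 : f₀ (v 0) = 0 := by simp [f₀]
  let f : Hom V H := ⟨f₀, Submodule.mem_iSup_of_mem (-2) hf₀⟩
  have hf : f ∈ gradedHomGr V.gr H.gr (-2) := hf₀
  have h2 : ((-2 : ℤ) : ZMod 2) = 0 := by decide
  -- The linear component of `hom_r(1, Ψ)` turns `f` into `g`, with the value `x` on `v₂`.
  let g : Hom V A := homR (ShCogHom.id V) Ψ 1 fun _ => f
  have hg : g ∈ gradedHomGr V.gr A.gr (-2) := by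
    intro i x hx
    have h3 : f₀ x ∈ H.sgr (i + -2 + 1) := by
      rw [DGAlg.sgr, add_sub_cancel_right]
      exact hf₀ i x hx
    have h4 := ιInv_mem (Ψ.map_deg (ι_mem_tensorDeg h3))
    rw [DGAlg.sgr, add_sub_cancel_right] at h4
    have h5 := homR_one Ψ (fun _ => f) x
    rw [← h5] at h4
    exact h4
  have hg1 : g.1 (v 1) = b (.inl 0) := by
    refine (homR_one Ψ (fun _ => f) (v 1)).trans ?_
    rw [← hΨ.one, ← hf₀1]
  have hg0 : g.1 (v 0) = 0 := by
    refine (homR_one Ψ (fun _ => f) (v 0)).trans ?_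
    change ιInv (Ψ.toLin (ι k (f₀ (v 0)))) = 0
    rw [hf₀0, map_zero, map_zero, map_zero]
  have h := congrFun heq 2
  have h' := congrArg (fun M => M fun _ => f) h
  simp only [Family.comp_two (hom_internal V H) _ _ (fun _ => f) (fun _ => -2) (fun _ => hf)
    (fun _ => h2), homL_one hΦ] at h'
  have hL := homL_two hΦ A hg h2 hg0
  have hR : (homR (ShCogHom.id V) Ψ 1 fun _ => homL Φ (DGAlgHom.id H) 2 fun _ => f : Hom V A).1
      (v 3) = 0 := by
    rw [homR_one, homL_two hΦ H hf h2 hf₀0]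
    change ιInv (Ψ.toLin (ι k (2 • (f₀ (v 1) * f₀ (v 1))))) = 0
    rw [hf₀1, hH.mul_eq, smul_zero, map_zero, map_zero, map_zero]
  -- The term `hom_r(1, Ψ)₂ (f, f)` occurs on both sides and cancels.
  rw [add_comm (homR _ _ 2 _)] at h'
  have h6 : (2 : ℕ) • b (.inl 1) = 0 := by
    have h7 := congrArg (fun F : Hom V A => F.1 (v 3)) (add_right_cancel h')
    refine Eq.trans ?_ (h7.trans hR)
    refine Eq.trans ?_ hL.symm
    rw [hg1, hA.x_mul_x]
  have h8 : (2 : k) • b (.inl 1) = 0 := by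
    rw [← h6, ofNat_smul_eq_nsmul]
  exact (smul_eq_zero.1 h8).elim two_ne_zero (b.ne_zero _)

end Composites

/-! ### The bifunctor -/

section NoBifunctor

variable {k : Type u} [Field k]

theorem InfCogHom.comp_id {V' V : ShCog k} (Φ : InfCogHom V' V) :
    Φ.comp (ShCogHom.id V').toInf = Φ := by
  refine InfCogHom.ext ?_
  change Φ.toAlg.comp (tensorMap LinearMap.id) = Φ.toAlg
  rw [tensorMap_id, AlgHom.comp_id]

theorem InfCogHom.id_comp {V' V : ShCog k} (Φ : InfCogHom V' V) :
    (ShCogHom.id V).toInf.comp Φ = Φ := by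
  refine InfCogHom.ext ?_
  change (tensorMap LinearMap.id).comp Φ.toAlg = Φ.toAlg
  rw [tensorMap_id, AlgHom.id_comp]

theorem InfAlgHom.comp_id {H A : DGAlg k} (Ψ : InfAlgHom H A) :
    Ψ.comp (DGAlgHom.id H).toInf = Ψ := by
  refine InfAlgHom.ext ?_
  change Ψ.toLin ∘ₗ (tensorMap LinearMap.id).toLinearMap = Ψ.toLin
  rw [tensorMap_id, AlgHom.toLinearMap_id, LinearMap.comp_id]

theorem InfAlgHom.id_comp {H A : DGAlg k} (Ψ : InfAlgHom H A) :
    (DGAlgHom.id A).toInf.comp Ψ = Ψ := by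
  refine InfAlgHom.ext ?_
  change (tensorMap LinearMap.id).toLinearMap ∘ₗ Ψ.toLin = Ψ.toLin
  rw [tensorMap_id, AlgHom.toLinearMap_id, LinearMap.id_comp]

/-- A bifunctor that extends `hom_ℓ` and `hom_r` forces the two actions to commute, since both
composites are its value on `(Φ, Ψ)`. -/
theorem ConvBifunctor.homL_comp_homR {B : ConvBifunctor k} (hl : B.RestrictsL) (hr : B.RestrictsR)
    {V' V : ShCog k} {H A : DGAlg k} (Φ : InfCogHom V' V) (Ψ : InfAlgHom H A) :
    Family.comp (hom_internal V H) (homL Φ (DGAlgHom.id A)) (homR (ShCogHom.id V) Ψ) =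
      Family.comp (hom_internal V H) (homR (ShCogHom.id V') Ψ) (homL Φ (DGAlgHom.id H)) := by
  have h1 := B.map_comp (ShCogHom.id V).toInf Φ Ψ (DGAlgHom.id A).toInf
  have h2 := B.map_comp Φ (ShCogHom.id V').toInf (DGAlgHom.id H).toInf Ψ
  rw [InfCogHom.id_comp, InfAlgHom.id_comp, hl, hr] at h1
  rw [InfCogHom.comp_id, InfAlgHom.comp_id, hl, hr] at h2
  exact h1.symm.trans h2

end NoBifunctor

end HomConv

theorem mainTheorem2 (k : Type u) [Field k] [CharZero k] :
    (∃ (V : HomConv.ShCog k) (v : Module.Basis ℕ k V.carrier)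
      (A : HomConv.DGAlg k) (b : Module.Basis (ℕ ⊕ ℕ) k A.carrier)
      (H : HomConv.DGAlg k) (z : Module.Basis Unit k H.carrier)
      (Φ : HomConv.InfCogHom V V) (Ψ : HomConv.InfAlgHom H A),
      HomConv.IsV V v ∧ HomConv.IsPhi v Φ ∧ HomConv.IsA2 A b ∧ HomConv.IsH2 H z ∧
      HomConv.IsIInf z b Ψ ∧ Ψ.IsQuasiIso ∧
      HomConv.Family.comp (HomConv.hom_internal V H)
          (HomConv.homL Φ (HomConv.DGAlgHom.id A)) (HomConv.homR (HomConv.ShCogHom.id V) Ψ) ≠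
        HomConv.Family.comp (HomConv.hom_internal V H)
          (HomConv.homR (HomConv.ShCogHom.id V) Ψ) (HomConv.homL Φ (HomConv.DGAlgHom.id H))) ∧
    ¬ ∃ B : HomConv.ConvBifunctor k, B.RestrictsL ∧ B.RestrictsR := by
  have hV := HomConv.isV_cogV k
  have hA := HomConv.isA2_algA k
  have hH := HomConv.isH2_algH k
  have hΦ := HomConv.isPhi_phi hV rfl
  have hΨ := HomConv.isIInf_psi hH rfl hA
  have hne := HomConv.homL_comp_homR_ne rfl hΦ hH hA hΨ
  exact ⟨⟨HomConv.cogV k, _, HomConv.algA k, _, HomConv.algH k, _, _, _, hV, hΦ, hA, hH, hΨ,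
    HomConv.isQuasiIso_of_isIInf hH hA hΨ, hne⟩, fun ⟨_, hl, hr⟩ =>
    hne (HomConv.ConvBifunctor.homL_comp_homR hl hr _ _)⟩
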